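/- **Setting.** Let $M$ be a smooth ($C^\infty$) connected finite-dimensional manifold, possibly non-compact, with or without boundary, and let $F$ be a smooth vector field on $M$ tangent to $\partial M$. Let $\Sigma=\{z\in M: F(z)=0\}$ be its set of singular points, and let $\Phi:\mathrm{dom}(\Phi)\to M$, $\mathrm{dom}(\Phi)\subset M\times\mathbb R$, be the (maximal) local flow of $F$. Let $V\subset M$ be open. * The *shift map* $\mathrm{Sh}_V$ sends a smooth function $\alpha:V\to\mathbb R$ whose graph lies in $\mathrm{dom}(\Phi)$ to the smooth map $V\to M$, $x\mapsto\Phi(x,\alpha(x))$; $\operatorname{im}\mathrm{Sh}_V\subset C^\infty(V,M)$ is its image. If $h(x)=\Phi(x,\alpha(x))$ for all $x$ in a set $A$, then $\alpha$ is called a *shift function* for $h$ on $A$. * $\mathcal E(F,V)$ is the set of all $h\in C^\infty(V,M)$ such that $h(\mathcal O\cap V)\subset \mathcal O$ for every orbit $\mathcal O$ of $F$, and $h$ is a local diffeomorphism at every $z\in\Sigma\cap V$. * For $0\le k\le\infty$, $\mathcal E_{\mathrm{id}}^k(F,V)$ is the path component of the inclusion $V\hookrightarrow M$ in $\mathcal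 E(F,V)$ for the weak $C^k$ topology (uniform convergence on compact sets, in charts, of the derivatives of all orders $\le k$; for $k=\infty$, of all finite orders). * A *$k$-homotopy* in $\mathcal E(F,V)$ is a continuous map $\Omega:V\times[0,1]\to M$ such that $\Omega_t=\Omega(\cdot,t)\in\mathcal E(F,V)$ for all $t$ and the map $(x,t)\mapsto j^k\Omega_t(x)$ into the $k$-jets is continuous (for $k=\infty$: for all finite orders). * Property $ES(0,1,k)$ of $F$ at a point $z\in\Sigma$ near which $\Sigma$ is nowhere dense: for every connected open neighbourhood $U$ of $z$, every $k$-homotopy $\Omega$ in $\mathcal E(F,U)$ such that for some $t_0\in[0,1]$ the map $\Omega_{t_0}$ has a $C^\infty$ shift function $\alpha$ on all of $U$, and the (unique) continuous $\Lambda:(U\setminus\Sigma)\times[0,1]\to\mathbb R$ with $\Omega(x,t)=\Phi(x,\Lambda(x,t))$ and $\Lambda_{t_0}=\alpha|_{U\setminus\Sigma}$, there is a neighbourhood $W\subset U$ of $z$ such that for each $t\in[0,1]$ the function $\Lambda_t|_{W\setminus\Sigma}$ extends to a $C^\infty$ function on $W$. When $V=M$ the letter $V$ is dropped: $\mathrm{Sh}_F$,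 $\mathcal E_{\mathrm{id}}^k(F)$. **Theorem.** Let $V\subset M$ be open and $k\in\{0,1,\dots,\infty\}$. Suppose that $\Sigma\cap V$ is nowhere dense in $V$ and that $F$ has property $ES(0,1,k)$ at every $z\in\Sigma\cap V$. Then $$\operatorname{im}\mathrm{Sh}_V=\mathcal E_{\mathrm{id}}^k(F,V).$$ In particular, if $V=M$, then $\operatorname{im}\mathrm{Sh}_F=\mathcal E_{\mathrm{id}}^k(F)$. -/

import Mathlib

open Set Topology TopologicalSpace
open scoped Manifold ContDiff

namespace ShiftMap

section

variable {E : Type*} [NormedAddCommGroup E] [NormedSpace ℝ E]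
  {H : Type*} [TopologicalSpace H] {I : ModelWithCorners ℝ E H}
  {M : Type*} [TopologicalSpace M] [ChartedSpace H M]
  {N : Type*} [TopologicalSpace N] [ChartedSpace H N]

/-! ### Vector fields and their local flows -/

/-- Let the model space be the half-space `{v | 0 ≤ ℓ v}` (all of `E` when `ℓ = 0`). The vector
field `F` is tangent to the boundary: at every boundary point `z`, the vector `F z`, read in the
preferred chart at `z`, lies in the hyperplane `ker ℓ`. -/
def TangentToBoundary (ℓ : E →L[ℝ] ℝ) (F : (x : M) → TangentSpace I x) : Prop :=
  ∀ z : M, I.IsBoundaryPoint z → ℓ (F z : E) = 0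

/-- The set of singular points of a vector field. -/
def singularSet (F : (x : M) → TangentSpace I x) : Set M := {z | F z = 0}

/-- The graph of the local flow of `F`: some integral curve of `F`, defined on an open interval
containing `0` and `t`, is at `x` at time `0` and at `y` at time `t`. In other words, `(x, t)` is in
the domain of the local flow and the flow takes `x` to `y` in time `t`. -/
def FlowsTo (F : (x : M) → TangentSpace I x) (x : M) (t : ℝ) (y : M) : Prop :=
  ∃ (γ : ℝ → M) (a b : ℝ), 0 ∈ Ioo a b ∧ t ∈ Ioo a b ∧
    IsMIntegralCurveOn γ F (Ioo a b) ∧ γ 0 = x ∧ γ t = y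

/-- The orbit of `x`. -/
def orbit (F : (x : M) → TangentSpace I x) (x : M) : Set M := {y | ∃ t, FlowsTo F x t y}

/-! ### Weak topologies and deformations -/

/-- The `j`-th derivative of `f : N → M` at `x`, read in the preferred chart at `a` in the source
and in the preferred chart at `b` in the target; meaningful if `x` and `f x` lie in the domains
of these charts. -/
noncomputable def chartDeriv (a : N) (b : M) (j : ℕ) (f : C^∞⟮I, N; I, M⟯) (x : N) :
    ContinuousMultilinearMap ℝ (fun _ : Fin j => E) E :=
  iteratedFDerivWithin ℝ j (extChartAt I b ∘ f ∘ (extChartAt I a).symm) (range I)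
    (extChartAt I a x)

/-- A subbasic set of the weak topology: the maps `g` which send the compact set `K` into the
chart domain at `b` and whose `j`-th derivative in the charts is uniformly `ε`-close on `K` to the
one of `f`. -/
def weakNhd (f : C^∞⟮I, N; I, M⟯) (a : N) (b : M) (K : Set N) (j : ℕ) (ε : ℝ) :
    Set C^∞⟮I, N; I, M⟯ :=
  {g | MapsTo g K (extChartAt I b).source ∧
    ∀ x ∈ K, ‖chartDeriv a b j g x - chartDeriv a b j f x‖ < ε}

/-- The weak (compact-open) `C^k` topology on `C^∞(N, M)`, `0 ≤ k ≤ ∞`: uniform convergence of all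
derivatives of order at most `k` on compact subsets of charts. For `k = ∞` it is generated by the
topologies with finite `k`. -/
@[reducible] def weakTopology (k : ℕ∞) : TopologicalSpace C^∞⟮I, N; I, M⟯ :=
  generateFrom {S | ∃ (f : C^∞⟮I, N; I, M⟯) (a : N) (b : M) (K : Set N) (j : ℕ) (ε : ℝ),
    IsCompact K ∧ K ⊆ (extChartAt I a).source ∧ MapsTo f K (extChartAt I b).source ∧
    (j : ℕ∞) ≤ k ∧ 0 < ε ∧ S = weakNhd f a b K j ε}

/-- `Ω` is a `(T; k)`-deformation in `S ⊆ C^∞(N, M)`: every `Ω t` is in `S`, the map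
`(x, t) ↦ Ω t x` is continuous, and so is the map `(x, t) ↦ j^k(Ω t)(x)` into the space of
`k`-jets, that is, in local charts the derivatives of `Ω t` of all orders `j ≤ k` depend
continuously on `(x, t)`. For `T = [0, 1]` this is a `k`-homotopy in `S`. -/
def IsDeformation {T : Type*} [TopologicalSpace T] (k : ℕ∞) (S : Set C^∞⟮I, N; I, M⟯)
    (Ω : T → C^∞⟮I, N; I, M⟯) : Prop :=
  (∀ t, Ω t ∈ S) ∧ Continuous (fun p : N × T => Ω p.2 p.1) ∧
    ∀ (a : N) (b : M) (j : ℕ), (j : ℕ∞) ≤ k →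
      ContinuousOn (fun p : N × T => chartDeriv a b j (Ω p.2) p.1)
        {p | p.1 ∈ (extChartAt I a).source ∧ Ω p.2 p.1 ∈ (extChartAt I b).source}

/-! ### Shift maps and endomorphisms

Below `i : N → M` is either the inclusion of an open subset or the identity of `M`. -/

/-- The inclusion of an open subset `V` of `M`. -/
def incl (I : ModelWithCorners ℝ E H) (V : Opens M) : C^∞⟮I, V; I, M⟯ :=
  ⟨Subtype.val, contMDiff_subtype_val⟩

/-- The image of the shift map: all smooth maps `h` of the form `x ↦ Φ(x, α x)`, with `Φ` the local
flow of `F` and `α` a smooth function whose graph lies in the domain of `Φ`. -/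
def shiftImage (F : (x : M) → TangentSpace I x) (i : C^∞⟮I, N; I, M⟯) : Set C^∞⟮I, N; I, M⟯ :=
  {h | ∃ α : C^∞⟮I, N; ℝ⟯, ∀ x, FlowsTo F (i x) (α x) (h x)}

/-- The set of smooth maps which send the points of each orbit into that orbit and which are local
diffeomorphisms at all singular points. -/
def endomorphisms (F : (x : M) → TangentSpace I x) (i : C^∞⟮I, N; I, M⟯) :
    Set C^∞⟮I, N; I, M⟯ :=
  {h | (∀ y, MapsTo h (i ⁻¹' orbit F y) (orbit F y)) ∧
    ∀ z, i z ∈ singularSet F → IsLocalDiffeomorphAt I I ∞ h z}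

/-- The path component of the inclusion `i` in the space of endomorphisms, for the weak `C^k`
topology. -/
def identityComponent (F : (x : M) → TangentSpace I x) (k : ℕ∞) (i : C^∞⟮I, N; I, M⟯) :
    Set C^∞⟮I, N; I, M⟯ :=
  @pathComponentIn _ (weakTopology k) (endomorphisms F i) i

/-- Property `ES(0, 1, k)` of `F` at the singular point `z` (extension of shift functions under
`k`-deformations with parameter space `[0, 1]`). Let `V` be a connected open neighbourhood of `z`,
`Ω` a `k`-homotopy in the endomorphisms `V → M`, such that `Ω t₀` has a smooth shift function `α` on
`V`, and `Λ` the continuous shift function for `Ω` over the regular points of `V` with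
`Λ t₀ = α`. Then on one neighbourhood `W` of `z` all the functions `Λ t` extend smoothly. -/
def HasES01 (F : (x : M) → TangentSpace I x) (k : ℕ∞) (z : M) : Prop :=
  ∀ V : Opens M, z ∈ V → IsConnected (V : Set M) →
  ∀ Ω : unitInterval → C^∞⟮I, V; I, M⟯, IsDeformation k (endomorphisms F (incl I V)) Ω →
  ∀ (t₀ : unitInterval) (α : C^∞⟮I, V; ℝ⟯), (∀ x : V, FlowsTo F x (α x) (Ω t₀ x)) →
  ∀ Λ : V × unitInterval → ℝ, ContinuousOn Λ {p | (p.1 : M) ∉ singularSet F} →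
    (∀ (x : V) (t : unitInterval), (x : M) ∉ singularSet F →
      FlowsTo F x (Λ (x, t)) (Ω t x)) →
    (∀ x : V, (x : M) ∉ singularSet F → Λ (x, t₀) = α x) →
  ∃ W : Opens M, z ∈ W ∧ W ≤ V ∧ ∀ t : unitInterval, ∃ β : M → ℝ,
    ContMDiffOn I 𝓘(ℝ, ℝ) ∞ β W ∧
    ∀ x : V, (x : M) ∈ W → (x : M) ∉ singularSet F → β x = Λ (x, t)

end

end ShiftMap

/-! One inclusion needs neither density nor the extension property. If `h` is the shift by `α`, then
`Φ(x, t α(x))`, `t ∈ [0, 1]`, joins the inclusion to `h`. It preserves orbits, and at a singular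
point `z` it is a local diffeomorphism: since `Φ(z, s) = z` for all `s`, the implicit function
theorem recovers the shift time from the image point, and flowing back inverts the map
(`isLocalDiffeomorphAt_shift`). Joint smoothness in `(x, t)` makes the jets continuous, hence the
path is continuous for the weak topology.

Conversely, over a locally compact source a weakly continuous path `Ω` is a `k`-homotopy
(`isDeformation_of_continuous`). For regular `x` the path `Ω_t(x)` stays in one orbit, and it lifts
to a continuous time `Λ(x, t)` with `Λ(x, 0) = 0`. The delicate point is that an orbit may return to
a small set infinitely often, so a path in it might a priori jump between nearby strands.
`exists_time_function` excludes this: the orbit meets a small transversal for only countably many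
crossing times, and a connected countable set in a metric space is a point. The lifts are jointly
continuous (`continuousOn_lift`), and `Λ(·, 1)` is smooth at regular points by the implicit function
theorem (`contMDiffAt_of_flowsTo`).

Near a singular point, `ES(0, 1, k)` applies with `t₀ = 0` and the zero shift function and extends
`Λ(·, 1)` smoothly. The local extensions agree because the regular points are dense
(`exists_contMDiff_extension`). At a singular point every time is a shift time, so the extended
function is a shift function for `h`.

All this rests on a smooth local flow with open domain on a manifold with boundary (`flow_smooth`).
It is built on a half-space: a Lipschitz retraction reduces existence to the Picard–Lindelöf
theorem, tangency keeps solutions inside, and the equation of first variation gives smoothness by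
induction. -/

namespace ShiftMap

/-! ### Local flows on a half-space: existence and differentiability. -/

section LocalFlow

universe u

/-- The closed half-space `{v | 0 ≤ ℓ v}`. -/
def halfSpace {E : Type*} [NormedAddCommGroup E] [NormedSpace ℝ E] (ℓ : E →L[ℝ] ℝ) : Set E :=
  {v | 0 ≤ ℓ v}

/-- The open-closed argument in the form used throughout: for agreement of curves and of lifts, for
smoothness of the flow along a trajectory, and for existence of lifts. -/
lemma iff_of_eventually_iff {α : Type*} [TopologicalSpace α] {s : Set α} (hs : IsPreconnected s)
    (P : α → Prop) (h : ∀ x ∈ s, ∀ᶠ y in 𝓝[s] x, (P x ↔ P y)) {x y : α} (hx : x ∈ s)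
    (hy : y ∈ s) : P x ↔ P y :=
  hs.induction₂ (fun a b => (P a ↔ P b)) h (fun _ _ _ _ _ _ h₁ h₂ => h₁.trans h₂)
    (fun _ _ _ _ h => h.symm) hx hy

variable {E : Type*} [NormedAddCommGroup E] [NormedSpace ℝ E] (ℓ : E →L[ℝ] ℝ)

lemma convex_halfSpace : Convex ℝ (halfSpace ℓ) := by
  have := (convex_Ici (0 : ℝ)).is_linear_preimage ℓ.isLinear
  exact this

/-- Treats the cases without and with boundary together: `w` points into the half-space when there
is a boundary. -/
lemma exists_transverse : ∃ w : E, ℓ = 0 ∨ ℓ w = 1 := by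
  by_cases h : ℓ = 0
  · exact ⟨0, Or.inl h⟩
  · obtain ⟨v, hv⟩ : ∃ v, ℓ v ≠ 0 := by
      by_contra! h'
      exact h (ContinuousLinearMap.ext h')
    exact ⟨(ℓ v)⁻¹ • v, Or.inr (by simp [hv])⟩

lemma interior_halfSpace_nonempty : (interior (halfSpace ℓ)).Nonempty := by
  obtain ⟨w, h | h⟩ := exists_transverse ℓ
  · subst h
    have : halfSpace (0 : E →L[ℝ] ℝ) = univ := by ext; simp [halfSpace]
    rw [this, interior_univ]
    exact univ_nonempty
  · refine ⟨w, mem_interior.2 ⟨ℓ ⁻¹' Ioi 0, fun v hv => show 0 ≤ ℓ v from le_of_lt hv,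
      isOpen_Ioi.preimage ℓ.continuous, ?_⟩⟩
    simp [h]

lemma uniqueDiffOn_halfSpace : UniqueDiffOn ℝ (halfSpace ℓ) :=
  uniqueDiffOn_convex (convex_halfSpace ℓ) (interior_halfSpace_nonempty ℓ)

/-- A two-sided Grönwall inequality. -/
lemma norm_le_of_norm_deriv_le {F : Type*} [NormedAddCommGroup F] [NormedSpace ℝ F]
    {u u' : ℝ → F} {K ε d : ℝ} (hK : 0 < K) (hε : 0 ≤ ε)
    (h : ∀ t ∈ Ioo (-d) d, HasDerivAt u (u' t) t)
    (bound : ∀ t ∈ Ioo (-d) d, ‖u' t‖ ≤ K * ‖u t‖ + ε) {t : ℝ} (ht : t ∈ Ioo (-d) d) :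
    ‖u t‖ ≤ Real.exp (K * d) * (‖u 0‖ + ε / K) := by
  have key : ∀ (v v' : ℝ → F), (∀ t ∈ Ioo (-d) d, HasDerivAt v (v' t) t) →
      (∀ t ∈ Ioo (-d) d, ‖v' t‖ ≤ K * ‖v t‖ + ε) → ∀ t ∈ Ico 0 d,
      ‖v t‖ ≤ Real.exp (K * d) * (‖v 0‖ + ε / K) := by
    intro v v' hv hb t ht
    have hsub : ∀ s ∈ Icc 0 t, s ∈ Ioo (-d) d := fun s hs =>
      ⟨by linarith [hs.1, ht.1, ht.2], by linarith [hs.2, ht.2]⟩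
    have := norm_le_gronwallBound_of_norm_deriv_right_le (f := v) (f' := v') (a := 0) (b := t)
      (δ := ‖v 0‖) (K := K) (ε := ε)
      (fun s hs => (hv s (hsub s hs)).continuousAt.continuousWithinAt)
      (fun s hs => (hv s (hsub s (Ico_subset_Icc_self hs))).hasDerivWithinAt) le_rfl
      (fun s hs => hb s (hsub s (Ico_subset_Icc_self hs))) t ⟨ht.1, le_rfl⟩
    rw [gronwallBound_of_K_ne_0 hK.ne'] at this
    have h1 : Real.exp (K * (t - 0)) ≤ Real.exp (K * d) := by
      apply Real.exp_le_exp.2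
      have := ht.2
      nlinarith
    have h2 : 0 ≤ ε / K := by positivity
    calc ‖v t‖ ≤ _ := this
      _ ≤ ‖v 0‖ * Real.exp (K * d) + ε / K * Real.exp (K * d) :=
        add_le_add (mul_le_mul_of_nonneg_left h1 (norm_nonneg _))
          (mul_le_mul_of_nonneg_left (by linarith) h2)
      _ = _ := by ring
  rcases le_or_gt 0 t with h0 | h0
  · exact key u u' h bound t ⟨h0, ht.2⟩
  -- Negative times reduce to positive ones by reversing time.
  · have := key (fun s => u (-s)) (fun s => -u' (-s)) (fun s hs => by
      have h1 := h (-s) ⟨by linarith [hs.2], by linarith [hs.1]⟩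
      have := h1.scomp s (hasDerivAt_neg s)
      simpa [Function.comp_def] using this) (fun s hs => by
      simpa using bound (-s) ⟨by linarith [hs.2], by linarith [hs.1]⟩) (-t)
      ⟨by linarith, by linarith [ht.1]⟩
    simpa using this

/-- Squaring removes the corner of the negative part at `0`, so that it can be differentiated along
a solution. -/
lemma hasDerivAt_min_zero_sq (r : ℝ) :
    HasDerivAt (fun r : ℝ => (min r 0) ^ 2) (2 * min r 0) r := by
  rcases lt_trichotomy r 0 with h | h | h
  · have h1 : HasDerivAt (fun r : ℝ => r ^ 2) (2 * r) r := by simpa using hasDerivAt_pow 2 r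
    rw [min_eq_left h.le]
    refine h1.congr_of_eventuallyEq ?_
    filter_upwards [Iio_mem_nhds h] with s hs
    rw [min_eq_left (le_of_lt hs)]
  · subst h
    rw [min_self, mul_zero, hasDerivAt_iff_isLittleO]
    have : (fun x : ℝ => x ^ 2) =o[𝓝 0] fun x : ℝ => x ^ 1 :=
      Asymptotics.isLittleO_pow_pow one_lt_two
    simp only [pow_one] at this
    simp only [min_self, sub_zero, smul_eq_mul, mul_zero]
    refine Asymptotics.IsBigO.trans_isLittleO (Asymptotics.IsBigO.of_bound 1 ?_) this
    refine Filter.Eventually.of_forall fun x => ?_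
    simp only [norm_pow, Real.norm_eq_abs, sq_abs, one_mul, ne_eq, OfNat.ofNat_ne_zero,
      not_false_eq_true, zero_pow, sub_zero]
    rcases le_total x 0 with h | h
    · rw [min_eq_left h]
    · rw [min_eq_right h]; simpa using sq_nonneg x
  · rw [min_eq_right h.le, mul_zero]
    refine (hasDerivAt_const r (0 : ℝ)).congr_of_eventuallyEq ?_
    filter_upwards [Ioi_mem_nhds h] with s hs
    rw [min_eq_right (le_of_lt hs)]; simp

/-- A function that does not move while it is negative, and which starts nonnegative, stays so. -/
lemma nonneg_of_deriv_eq_zero {u u' : ℝ → ℝ} {d : ℝ}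
    (h : ∀ t ∈ Ioo (-d) d, HasDerivAt u (u' t) t) (h' : ∀ t ∈ Ioo (-d) d, u t < 0 → u' t = 0)
    (h0 : 0 ≤ u 0) {t : ℝ} (ht : t ∈ Ioo (-d) d) : 0 ≤ u t := by
  -- Where `u < 0` the factor `u'` vanishes; elsewhere the factor `min u 0` does. Hence the squared
  -- negative part is constant.
  have hd : ∀ s ∈ Ioo (-d) d, HasDerivAt (fun s => (min (u s) 0) ^ 2) 0 s := by
    intro s hs
    have := (hasDerivAt_min_zero_sq (u s)).comp s (h s hs)
    refine this.congr_deriv ?_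
    by_cases hn : u s < 0
    · rw [h' s hs hn, mul_zero]
    · rw [min_eq_right (not_lt.1 hn)]; simp
  have h0' : (0 : ℝ) ∈ Ioo (-d) d := ⟨by linarith [ht.1, ht.2], by linarith [ht.1, ht.2]⟩
  have := isOpen_Ioo.is_const_of_deriv_eq_zero isPreconnected_Ioo
    (fun s hs => (hd s hs).differentiableAt.differentiableWithinAt)
    (fun s hs => (hd s hs).deriv) ht h0'
  simp only [min_eq_right h0] at this
  by_contra! hn
  rw [min_eq_left hn.le] at this
  nlinarith

/-- `φ` is the local flow of `f` on the half-space, for initial points in a `δ`-ball and times in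
`(-δ, δ)`, and it does not leave an `r`-ball. -/
structure IsLocalFlow (f : E → E) (x₀ : E) (r δ : ℝ) (φ : E → ℝ → E) : Prop where
  zero : ∀ x ∈ Metric.ball x₀ δ ∩ halfSpace ℓ, φ x 0 = x
  mem : ∀ x ∈ Metric.ball x₀ δ ∩ halfSpace ℓ, ∀ t ∈ Ioo (-δ) δ,
    φ x t ∈ Metric.ball x₀ r ∩ halfSpace ℓ
  hasDerivAt : ∀ x ∈ Metric.ball x₀ δ ∩ halfSpace ℓ, ∀ t ∈ Ioo (-δ) δ,
    HasDerivAt (φ x) (f (φ x t)) t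

/-- Points outside are pushed along the transverse vector until they reach the hyperplane `ℓ = 0`.
Landing exactly there matters: the field is tangent there, so the field composed with `P` does not
change `ℓ` outside the half-space. -/
lemma exists_lipschitz_retraction : ∃ (C : NNReal) (P : E → E), 1 ≤ C ∧ LipschitzWith C P ∧
    (∀ v, P v ∈ halfSpace ℓ) ∧ (∀ v ∈ halfSpace ℓ, P v = v) ∧ ∀ v, ℓ v < 0 → ℓ (P v) = 0 := by
  obtain ⟨w, hw⟩ := exists_transverse ℓ
  have hP : ∀ v, ℓ (v + max 0 (-ℓ v) • w) = max (ℓ v) 0 := by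
    intro v
    rcases hw with h | h
    · simp [h]
    · simp only [map_add, map_smul, h, smul_eq_mul, mul_one]
      rcases le_total (ℓ v) 0 with h1 | h1
      · rw [max_eq_right (by linarith), max_eq_right h1]; ring
      · rw [max_eq_left (by linarith), max_eq_left h1]; ring
  refine ⟨1 + ‖ℓ‖₊ * ‖w‖₊, fun v => v + max 0 (-ℓ v) • w, by simp, ?_, ?_, ?_, ?_⟩
  · have h1 : LipschitzWith ‖ℓ‖₊ fun v => max 0 (-ℓ v) := by
      have := (LipschitzWith.const_max (ℓ.lipschitz.neg) 0)
      simpa using this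
    refine LipschitzWith.id.add (LipschitzWith.of_dist_le_mul fun x y => ?_)
    rw [dist_eq_norm, ← sub_smul, norm_smul, ← dist_eq_norm]
    have := h1.dist_le_mul x y
    calc _ ≤ ‖ℓ‖₊ * dist x y * ‖w‖ := by gcongr
      _ = _ := by simp; ring
  · intro v
    change 0 ≤ ℓ _
    rw [hP]; exact le_max_right _ _
  · intro v hv
    have : 0 ≤ ℓ v := hv
    simp [this]
  · intro v hv
    rw [hP, max_eq_right hv.le]

/-- The field `f ∘ P` is Lipschitz on a full neighbourhood, so the Picard–Lindelöf theorem applies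
to it. Its solutions that start in the half-space never leave it, and there `P` is the identity, so
they solve the original equation. -/
lemma exists_localFlow_continuousOn [CompleteSpace E] {f : E → E} {x₀ : E} {r : ℝ}
    (hx₀ : x₀ ∈ halfSpace ℓ) (hr : 0 < r) (hf : ContDiffWithinAt ℝ 1 f (halfSpace ℓ) x₀)
    (htan : ∀ᶠ x in 𝓝 x₀, ℓ x = 0 → ℓ (f x) = 0) :
    ∃ δ > 0, ∃ φ : E → ℝ → E, IsLocalFlow ℓ f x₀ r δ φ ∧
      ContinuousOn (Function.uncurry φ)
        ((Metric.ball x₀ δ ∩ halfSpace ℓ) ×ˢ Ioo (-δ) δ) := by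
  obtain ⟨K, t, ht, hK⟩ := hf.exists_lipschitzOnWith (convex_halfSpace ℓ)
  obtain ⟨ρ₁, hρ₁, hρt⟩ := Metric.mem_nhdsWithin_iff.1 ht
  obtain ⟨ρ₂, hρ₂, htan⟩ := Metric.eventually_nhds_iff_ball.1 htan
  obtain ⟨C, P, hC1, hP, hPmem, hPid, hPneg⟩ := exists_lipschitz_retraction ℓ
  set ρ := min r (min ρ₁ ρ₂) with hρdef
  have hρ : 0 < ρ := lt_min hr (lt_min hρ₁ hρ₂)
  have hC0 : (0 : ℝ) < C := by
    have : (1 : ℝ) ≤ C := by exact_mod_cast hC1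
    linarith
  -- Since `C * a < ρ`, the retraction maps the `a`-ball into the ball where `f` is controlled.
  set a : NNReal := ⟨ρ / (2 * C), by positivity⟩ with ha
  have ha0 : (0 : ℝ) < a := by change 0 < ρ / (2 * C); positivity
  have haC : C * (a : ℝ) < ρ := by
    change C * (ρ / (2 * C)) < ρ
    field_simp; linarith
  have hPx₀ : P x₀ = x₀ := hPid _ hx₀
  have hPball : ∀ x ∈ Metric.closedBall x₀ (a : ℝ), P x ∈ Metric.ball x₀ ρ := by
    intro x hx
    have := hP.dist_le_mul x x₀
    rw [hPx₀] at this
    have h2 : C * dist x x₀ ≤ C * a := by gcongr; exact hx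
    exact Metric.mem_ball.2 (by linarith)
  have hlip : LipschitzOnWith (K * C) (f ∘ P) (Metric.closedBall x₀ (a : ℝ)) := by
    refine hK.comp hP.lipschitzOnWith fun x hx => hρt ⟨?_, hPmem x⟩
    exact Metric.ball_subset_ball ((min_le_right _ _).trans (min_le_left _ _)) (hPball x hx)
  set L : NNReal := K * C * a + ‖f x₀‖₊ + 1 with hL
  have hL0 : (0 : ℝ) < L := by positivity
  have hbound : ∀ x ∈ Metric.closedBall x₀ (a : ℝ), ‖(f ∘ P) x‖ ≤ L := by
    intro x hx
    have h1 := hlip.dist_le_mul x hx x₀ (Metric.mem_closedBall_self ha0.le)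
    have h2 : ((K * C : NNReal) : ℝ) * dist x x₀ ≤ (K * C : NNReal) * a := by gcongr; exact hx
    simp only [Function.comp_apply, hPx₀, dist_eq_norm] at h1 h2 ⊢
    have h3 := norm_le_norm_sub_add (f (P x)) (f x₀)
    have h4 : (L : ℝ) = (K * C : NNReal) * a + ‖f x₀‖ + 1 := by simp [hL]
    linarith
  -- With speed at most `L`, a solution from the `a / 2`-ball moves by at most `L * ε = a / 2` and
  -- stays in the `a`-ball.
  set ε : ℝ := a / 2 / L with hε
  have hε0 : 0 < ε := by positivity
  have hPL : IsPicardLindelof (fun _ => f ∘ P) (tmin := -ε) (tmax := ε)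
      ⟨0, by constructor <;> linarith⟩ x₀ a (a / 2) L (K * C) := by
    refine IsPicardLindelof.of_time_independent hbound hlip ?_
    have : (L : ℝ) * ε = a / 2 := by rw [hε]; field_simp
    simp only [sub_zero, zero_sub, neg_neg, max_self, this]
    push_cast
    linarith
  obtain ⟨α, hα, hcont⟩ := hPL.exists_forall_mem_closedBall_eq_hasDerivWithinAt_continuousOn
  have hnhds : Metric.closedBall x₀ ((a / 2 : NNReal) : ℝ) ×ˢ Icc (-ε) ε ∈ 𝓝 (x₀, (0 : ℝ)) := by
    refine prod_mem_nhds (Metric.closedBall_mem_nhds _ ?_) (Icc_mem_nhds (by linarith) hε0)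
    push_cast; linarith
  have hα0 : α (x₀, 0) = x₀ := (hα x₀ (Metric.mem_closedBall_self (NNReal.coe_nonneg _))).1
  have hev : ∀ᶠ p in 𝓝 (x₀, (0 : ℝ)), p ∈ Metric.closedBall x₀ ((a / 2 : NNReal) : ℝ) ×ˢ Icc (-ε) ε
      ∧ α p ∈ Metric.ball x₀ (a : ℝ) := by
    refine Filter.Eventually.and hnhds ?_
    have := (hcont.continuousAt hnhds)
    refine this.eventually_mem ?_
    rw [hα0]
    exact Metric.ball_mem_nhds _ ha0
  obtain ⟨δ', hδ', hball⟩ := Metric.eventually_nhds_iff_ball.1 hev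
  set δ := min δ' ε with hδ
  have hδ0 : 0 < δ := lt_min hδ' hε0
  have hbox : ∀ x ∈ Metric.ball x₀ δ, ∀ t ∈ Ioo (-δ) δ, (x, t) ∈ Metric.ball (x₀, (0 : ℝ)) δ' := by
    intro x hx t ht
    rw [Metric.mem_ball, Prod.dist_eq, max_lt_iff]
    refine ⟨lt_of_lt_of_le hx (min_le_left _ _), ?_⟩
    rw [Real.dist_eq, sub_zero]
    exact lt_of_lt_of_le (abs_lt.2 ht) (min_le_left _ _)
  have hderiv : ∀ x ∈ Metric.ball x₀ δ, ∀ t ∈ Ioo (-δ) δ,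
      HasDerivAt (fun t => α (x, t)) (f (P (α (x, t)))) t := by
    intro x hx t ht
    have hb := (hball _ (hbox x hx t ht)).1
    have htε : t ∈ Ioo (-ε) ε := ⟨by linarith [ht.1, min_le_right δ' ε],
      by linarith [ht.2, min_le_right δ' ε]⟩
    exact ((hα x hb.1).2 t hb.2).hasDerivAt (Icc_mem_nhds htε.1 htε.2)
  have hzero : ∀ x ∈ Metric.ball x₀ δ, α (x, 0) = x := fun x hx =>
    (hα x (hball _ (hbox x hx 0 ⟨by linarith, hδ0⟩)).1.1).1
  have hS : ∀ x ∈ Metric.ball x₀ δ ∩ halfSpace ℓ, ∀ t ∈ Ioo (-δ) δ, α (x, t) ∈ halfSpace ℓ := by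
    rintro x ⟨hx, hxS⟩ t ht
    refine nonneg_of_deriv_eq_zero (u := fun t => ℓ (α (x, t)))
      (u' := fun t => ℓ (f (P (α (x, t)))))
      (fun t ht => ℓ.hasFDerivAt.comp_hasDerivAt t (hderiv x hx t ht)) (fun t ht hneg => ?_)
      (by simpa only [hzero x hx] using show 0 ≤ ℓ x from hxS) ht
    refine htan _ (Metric.ball_subset_ball ((min_le_right _ _).trans (min_le_right _ _))
      (hPball _ (Metric.ball_subset_closedBall (hball _ (hbox x hx t ht)).2))) (hPneg _ hneg)
  have ha_le : (a : ℝ) ≤ r := by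
    have h1 : (1 : ℝ) ≤ C := by exact_mod_cast hC1
    have h2 : (a : ℝ) ≤ C * a := by nlinarith
    linarith [min_le_left r (min ρ₁ ρ₂)]
  refine ⟨δ, hδ0, fun x t => α (x, t), ⟨fun x hx => hzero x hx.1, fun x hx t ht =>
    ⟨Metric.ball_subset_ball ha_le (hball _ (hbox x hx.1 t ht)).2, hS x hx t ht⟩,
    fun x hx t ht => ?_⟩, ?_⟩
  · have := hderiv x hx.1 t ht
    rwa [hPid _ (hS x hx t ht)] at this
  · refine hcont.mono ?_
    rintro ⟨x, t⟩ ⟨hx, ht⟩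
    exact (hball _ (hbox x hx.1 t ht)).1

/-- The mean value inequality on the segment from `x` to `y`, where `df` differs from `df x` by at
most `K * ‖y - x‖`. -/
lemma norm_sub_sub_le_sq {F : Type*} [NormedAddCommGroup F] [NormedSpace ℝ F] {f : E → F}
    {df : E → E →L[ℝ] F} {s : Set E} {K : NNReal} (hs : Convex ℝ s)
    (hf : ∀ x ∈ s, HasFDerivWithinAt f (df x) s x) (hK : LipschitzOnWith K df s) {x y : E}
    (hx : x ∈ s) (hy : y ∈ s) : ‖f y - f x - df x (y - x)‖ ≤ K * ‖y - x‖ ^ 2 := by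
  have hsub : segment ℝ x y ⊆ s := hs.segment_subset hx hy
  have := (convex_segment x y).norm_image_sub_le_of_norm_hasFDerivWithin_le' (𝕜 := ℝ)
    (C := K * ‖y - x‖) (φ := df x)
    (fun z hz => (hf z (hsub hz)).mono hsub) (fun z hz => ?_)
    (left_mem_segment ℝ x y) (right_mem_segment ℝ x y)
  · calc _ ≤ _ := this
      _ = _ := by ring
  · have h1 := hK.dist_le_mul z (hsub hz) x hx
    rw [dist_eq_norm, dist_eq_norm] at h1
    have h2 : ‖z - x‖ ≤ ‖y - x‖ := by
      obtain ⟨θ, ⟨h0, hθ⟩, rfl⟩ := (segment_eq_image' ℝ x y ▸ hz :)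
      rw [add_sub_cancel_left, norm_smul, Real.norm_of_nonneg h0]
      exact mul_le_of_le_one_left (norm_nonneg _) hθ
    exact h1.trans (by gcongr)

/-- The local flow of a vector field of class `C^(n+1)` on a half-space is of class `C^n`. -/
theorem exists_localFlow (n : ℕ) : ∀ {E : Type u} [NormedAddCommGroup E] [NormedSpace ℝ E]
    [CompleteSpace E] (ℓ : E →L[ℝ] ℝ) {f : E → E} {x₀ : E} {r : ℝ},
    x₀ ∈ halfSpace ℓ → 0 < r → ContDiffWithinAt ℝ (n + 1) f (halfSpace ℓ) x₀ →
    (∀ᶠ x in 𝓝 x₀, ℓ x = 0 → ℓ (f x) = 0) →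
    ∃ δ > 0, ∃ φ : E → ℝ → E, IsLocalFlow ℓ f x₀ r δ φ ∧
      ContDiffOn ℝ n (Function.uncurry φ)
        ((Metric.ball x₀ δ ∩ halfSpace ℓ) ×ˢ Ioo (-δ) δ) := by
  -- The space is quantified inside the induction, because the step applies the hypothesis to the
  -- field `(f, df ∘ A)` on `E × (E →L[ℝ] E)`. That field has one derivative less than `f`; started
  -- at the identity, its second component is the space derivative of the flow.
  induction n with
  | zero =>
    intro E _ _ _ ℓ f x₀ r hx₀ hr hf htan
    obtain ⟨δ, hδ, φ, hφ, hc⟩ := exists_localFlow_continuousOn ℓ hx₀ hr (by simpa using hf) htan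
    exact ⟨δ, hδ, φ, hφ, by simpa using hc⟩
  | succ n ih =>
    intro E _ _ _ ℓ f x₀ r hx₀ hr hf htan
    have hud := uniqueDiffOn_halfSpace ℓ
    set S := halfSpace ℓ with hS
    set df := fderivWithin ℝ f S with hdf
    have hdfC : ContDiffWithinAt ℝ (n + 1) df S x₀ :=
      hf.fderivWithin_right hud (by push_cast; rfl) hx₀
    -- a ball where everything is controlled
    obtain ⟨K₁, t₁, ht₁, hK₁⟩ := (hf.of_le (m := 1) (by
      push_cast; exact le_add_self)).exists_lipschitzOnWith (convex_halfSpace ℓ)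
    obtain ⟨K₂, t₂, ht₂, hK₂⟩ := (hdfC.of_le (m := 1) le_add_self).exists_lipschitzOnWith
      (convex_halfSpace ℓ)
    have hev : ∀ᶠ x in 𝓝[S] x₀, ContDiffWithinAt ℝ (n + 1) f S x := by
      have h1 : ContDiffWithinAt ℝ (n + 1) f S x₀ := hf.of_le (by push_cast; exact le_self_add)
      have := h1.eventually (by exact_mod_cast ENat.natCast_ne_top (n + 1))
      rwa [insert_eq_of_mem hx₀] at this
    obtain ⟨ρ, hρ, hρt⟩ := Metric.mem_nhdsWithin_iff.1
      (Filter.inter_mem (Filter.inter_mem ht₁ ht₂) hev)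
    set B := Metric.ball x₀ ρ ∩ S with hB
    have hBconv : Convex ℝ B := (convex_ball _ _).inter (convex_halfSpace ℓ)
    have hfl : LipschitzOnWith K₁ f B := hK₁.mono fun x hx => (hρt hx).1.1
    have hdfl : LipschitzOnWith K₂ df B := hK₂.mono fun x hx => (hρt hx).1.2
    have hfC : ∀ x ∈ B, ContDiffWithinAt ℝ (n + 1) f S x := fun x hx => (hρt hx).2
    have hfd : ∀ x ∈ B, HasFDerivWithinAt f (df x) B x := fun x hx =>
      ((hfC x hx).differentiableWithinAt (by simp)).hasFDerivWithinAt.mono inter_subset_right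
    have hx₀B : x₀ ∈ B := ⟨Metric.mem_ball_self hρ, hx₀⟩
    have hdfb : ∀ x ∈ B, ‖df x‖ ≤ ‖df x₀‖ + K₂ * ρ := by
      intro x hx
      have h1 := hdfl.dist_le_mul x hx x₀ hx₀B
      have h2 : (K₂ : ℝ) * dist x x₀ ≤ K₂ * ρ := by gcongr; exact (Metric.mem_ball.1 hx.1).le
      rw [dist_eq_norm] at h1
      have := norm_le_norm_sub_add (df x) (df x₀)
      linarith
    -- the extended system
    set ℓ' : E × (E →L[ℝ] E) →L[ℝ] ℝ := ℓ.comp (ContinuousLinearMap.fst ℝ E (E →L[ℝ] E)) with hℓ'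
    set g : E × (E →L[ℝ] E) → E × (E →L[ℝ] E) := fun p => (f p.1, (df p.1).comp p.2) with hg
    set p₀ : E × (E →L[ℝ] E) := (x₀, ContinuousLinearMap.id ℝ E) with hp₀
    have hmaps : MapsTo (Prod.fst : E × (E →L[ℝ] E) → E) (halfSpace ℓ') S := fun p hp => hp
    have hgC : ContDiffWithinAt ℝ (n + 1) g (halfSpace ℓ') p₀ := by
      have hfst : ContDiffWithinAt ℝ (n + 1) (Prod.fst : E × (E →L[ℝ] E) → E) (halfSpace ℓ') p₀ :=
        contDiffWithinAt_fst
      have h1 : ContDiffWithinAt ℝ (n + 1) (fun p : E × (E →L[ℝ] E) => f p.1)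
          (halfSpace ℓ') p₀ :=
        ContDiffWithinAt.comp (t := S) p₀ (hf.of_le (by push_cast; exact le_self_add)) hfst hmaps
      have h2 : ContDiffWithinAt ℝ (n + 1) (fun p : E × (E →L[ℝ] E) => df p.1)
          (halfSpace ℓ') p₀ := ContDiffWithinAt.comp (t := S) p₀ hdfC hfst hmaps
      exact h1.prodMk (h2.clm_comp contDiffWithinAt_snd)
    obtain ⟨δ, hδ, ψ, hψ, hψC⟩ := ih ℓ' (f := g) (x₀ := p₀) (r := min r (min ρ 1))
      hx₀ (by positivity) hgC (by
        have : Filter.Tendsto (Prod.fst : E × (E →L[ℝ] E) → E) (𝓝 p₀) (𝓝 x₀) :=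
          continuous_fst.tendsto p₀
        exact (this.eventually htan).mono fun p hp => hp)
    set φ : E → ℝ → E := fun x t => (ψ (x, ContinuousLinearMap.id ℝ E) t).1 with hφdef
    set A : E → ℝ → E →L[ℝ] E := fun x t => (ψ (x, ContinuousLinearMap.id ℝ E) t).2 with hA
    set D := Metric.ball x₀ δ ∩ S with hD
    have hin : ∀ x ∈ D, (x, ContinuousLinearMap.id ℝ E) ∈ Metric.ball p₀ δ ∩ halfSpace ℓ' := by
      intro x hx
      refine ⟨?_, hx.2⟩
      rw [Metric.mem_ball, Prod.dist_eq]
      exact max_lt hx.1 (by simpa [hp₀] using hδ)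
    have hψmem : ∀ x ∈ D, ∀ t ∈ Ioo (-δ) δ,
        φ x t ∈ Metric.ball x₀ r ∩ S ∧ φ x t ∈ B ∧ ‖A x t‖ ≤ 2 := by
      intro x hx t ht
      obtain ⟨h1, h2⟩ := hψ.mem _ (hin x hx) t ht
      rw [Metric.mem_ball, Prod.dist_eq, max_lt_iff, lt_min_iff, lt_min_iff, lt_min_iff,
        lt_min_iff] at h1
      refine ⟨⟨h1.1.1, h2⟩, ⟨h1.1.2.1, h2⟩, ?_⟩
      have h3 := h1.2.2.2
      rw [dist_eq_norm] at h3
      have h4 := norm_le_norm_sub_add (A x t) (ContinuousLinearMap.id ℝ E)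
      have h5 : ‖ContinuousLinearMap.id ℝ E‖ ≤ 1 := ContinuousLinearMap.norm_id_le
      change ‖A x t - ContinuousLinearMap.id ℝ E‖ < 1 at h3
      linarith
    have hφd : ∀ x ∈ D, ∀ t ∈ Ioo (-δ) δ, HasDerivAt (φ x) (f (φ x t)) t := fun x hx t ht =>
      (ContinuousLinearMap.fst ℝ E (E →L[ℝ] E)).hasFDerivAt.comp_hasDerivAt t
        (hψ.hasDerivAt _ (hin x hx) t ht)
    have hAd : ∀ x ∈ D, ∀ t ∈ Ioo (-δ) δ, HasDerivAt (A x) ((df (φ x t)).comp (A x t)) t :=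
      fun x hx t ht => (ContinuousLinearMap.snd ℝ E (E →L[ℝ] E)).hasFDerivAt.comp_hasDerivAt t
        (hψ.hasDerivAt _ (hin x hx) t ht)
    have hφ0 : ∀ x ∈ D, φ x 0 = x := fun x hx => by
      simp only [hφdef, hψ.zero _ (hin x hx)]
    have hA0 : ∀ x ∈ D, A x 0 = ContinuousLinearMap.id ℝ E := fun x hx => by
      simp only [hA, hψ.zero _ (hin x hx)]
    refine ⟨δ, hδ, φ, ⟨hφ0, fun x hx t ht => (hψmem x hx t ht).1, hφd⟩, ?_⟩
    -- Lipschitz dependence on the initial point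
    obtain ⟨C₁, hC₁0, hC₁⟩ : ∃ C ≥ 0, ∀ x ∈ D, ∀ y ∈ D, ∀ t ∈ Ioo (-δ) δ,
        ‖φ y t - φ x t‖ ≤ C * ‖y - x‖ := by
      refine ⟨Real.exp ((K₁ + 1) * δ), by positivity, fun x hx y hy t ht => ?_⟩
      have := norm_le_of_norm_deriv_le (u := fun t => φ y t - φ x t)
        (u' := fun t => f (φ y t) - f (φ x t)) (K := K₁ + 1) (ε := 0) (by positivity) le_rfl
        (fun t ht => (hφd y hy t ht).sub (hφd x hx t ht)) (fun t ht => ?_) ht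
      · simpa [hφ0 x hx, hφ0 y hy] using this
      · have h1 := hfl.dist_le_mul _ (hψmem y hy t ht).2.1 _ (hψmem x hx t ht).2.1
        rw [dist_eq_norm, dist_eq_norm] at h1
        nlinarith [norm_nonneg (φ y t - φ x t)]
    -- the solution of the linearized equation is the derivative, with a uniform quadratic error
    obtain ⟨C₂, hC₂0, hC₂⟩ : ∃ C ≥ 0, ∀ x ∈ D, ∀ y ∈ D, ∀ t ∈ Ioo (-δ) δ,
        ‖φ y t - φ x t - A x t (y - x)‖ ≤ C * ‖y - x‖ ^ 2 := by
      set Kb := ‖df x₀‖ + K₂ * ρ + 1 with hKb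
      have hKb0 : 0 < Kb := by positivity
      refine ⟨Real.exp (Kb * δ) * (K₂ * C₁ ^ 2 / Kb), by positivity, fun x hx y hy t ht => ?_⟩
      have := norm_le_of_norm_deriv_le (u := fun t => φ y t - φ x t - A x t (y - x))
        (u' := fun t => f (φ y t) - f (φ x t) - df (φ x t) (A x t (y - x))) (K := Kb)
        (ε := K₂ * C₁ ^ 2 * ‖y - x‖ ^ 2) hKb0 (by positivity)
        (fun t ht => ((hφd y hy t ht).sub (hφd x hx t ht)).sub
          (by simpa using (hAd x hx t ht).clm_apply (hasDerivAt_const t (y - x))))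
        (fun t ht => ?_) ht
      · simp only [hφ0 x hx, hφ0 y hy, hA0 x hx, ContinuousLinearMap.id_apply, sub_self, norm_zero,
          zero_add] at this
        calc _ ≤ _ := this
          _ = _ := by ring
      · have hyB := (hψmem y hy t ht).2.1
        have hxB := (hψmem x hx t ht).2.1
        have h1 := norm_sub_sub_le_sq hBconv hfd hdfl hxB hyB
        -- The deviation satisfies the linearized equation up to a Taylor remainder that is
        -- quadratic in `y - x`. Grönwall's inequality absorbs the linear term.
        have h2 : f (φ y t) - f (φ x t) - df (φ x t) (A x t (y - x)) =
            df (φ x t) (φ y t - φ x t - A x t (y - x)) +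
            (f (φ y t) - f (φ x t) - df (φ x t) (φ y t - φ x t)) := by
          simp only [map_sub]; abel
        have h3 : (K₂ : ℝ) * ‖φ y t - φ x t‖ ^ 2 ≤ K₂ * C₁ ^ 2 * ‖y - x‖ ^ 2 := by
          rw [mul_assoc, ← mul_pow]
          gcongr
          exact hC₁ x hx y hy t ht
        have h4 : ‖df (φ x t) (φ y t - φ x t - A x t (y - x))‖ ≤
            Kb * ‖φ y t - φ x t - A x t (y - x)‖ :=
          ContinuousLinearMap.le_of_opNorm_le _ (by linarith [hdfb _ hxB]) _
        rw [h2]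
        exact (norm_add_le _ _).trans (by linarith)
    have hudD : UniqueDiffOn ℝ (D ×ˢ Ioo (-δ) δ) := by
      refine UniqueDiffOn.prod ?_ isOpen_Ioo.uniqueDiffOn
      rw [hD, inter_comm]
      exact hud.inter Metric.isOpen_ball
    have hψC' : ContDiffOn ℝ n (fun p : E × ℝ => ψ (p.1, ContinuousLinearMap.id ℝ E) p.2)
        (D ×ˢ Ioo (-δ) δ) := by
      refine hψC.comp (g := Function.uncurry ψ) (f := fun p : E × ℝ =>
        ((p.1, ContinuousLinearMap.id ℝ E), p.2)) (by fun_prop) ?_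
      rintro ⟨x, t⟩ ⟨hx, ht⟩
      exact ⟨hin x hx, ht⟩
    have hφC : ContDiffOn ℝ n (Function.uncurry φ) (D ×ˢ Ioo (-δ) δ) := hψC'.fst
    have hAC : ContDiffOn ℝ n (fun p : E × ℝ => A p.1 p.2) (D ×ˢ Ioo (-δ) δ) := hψC'.snd
    have hfφ : ContDiffOn ℝ n (fun p : E × ℝ => f (φ p.1 p.2)) (D ×ˢ Ioo (-δ) δ) := by
      have hfB : ContDiffOn ℝ n f B := fun x hx =>
        ((hfC x hx).of_le le_self_add).mono inter_subset_right
      exact hfB.comp hφC fun p hp => (hψmem p.1 hp.1 p.2 hp.2).2.1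
    push_cast
    rw [contDiffOn_succ_iff_hasFDerivWithinAt_of_uniqueDiffOn hudD]
    refine ⟨by simp, fun p => (A p.1 p.2).comp (ContinuousLinearMap.fst ℝ E ℝ) +
      (ContinuousLinearMap.snd ℝ E ℝ).smulRight (f (φ p.1 p.2)), ?_, ?_⟩
    · exact (hAC.clm_comp contDiffOn_const).add (contDiffOn_const.smulRight hfφ)
    rintro ⟨x, t⟩ ⟨hx, ht⟩
    refine HasFDerivWithinAt.of_isLittleO ?_
    have hfst : (fun q : E × ℝ => q.1 - x) =O[𝓝[D ×ˢ Ioo (-δ) δ] (x, t)] fun q => q - (x, t) :=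
      Asymptotics.IsBigO.of_bound 1 (Filter.Eventually.of_forall fun q => by
        rw [one_mul]; exact norm_fst_le (q - (x, t)))
    have hsnd : (fun q : E × ℝ => q.2 - t) =O[𝓝[D ×ˢ Ioo (-δ) δ] (x, t)] fun q => q - (x, t) :=
      Asymptotics.IsBigO.of_bound 1 (Filter.Eventually.of_forall fun q => by
        rw [one_mul]; exact norm_snd_le (q - (x, t)))
    have htfst : Filter.Tendsto (fun q : E × ℝ => ‖q.1 - x‖) (𝓝[D ×ˢ Ioo (-δ) δ] (x, t))
        (𝓝 0) := by
      have : Continuous fun q : E × ℝ => ‖q.1 - x‖ := by fun_prop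
      simpa using (this.tendsto (x, t)).mono_left nhdsWithin_le_nhds
    have htsnd : Filter.Tendsto (fun q : E × ℝ => q.2) (𝓝[D ×ˢ Ioo (-δ) δ] (x, t)) (𝓝 t) :=
      (continuous_snd.tendsto (x, t)).mono_left nhdsWithin_le_nhds
    -- The joint differentiability error splits into three: the space increment at time `q.2`, small
    -- because the quadratic bound is uniform in time; the change of `A x` from `t` to `q.2`; and
    -- the time increment at `x`.
    have h1 : (fun q : E × ℝ => φ q.1 q.2 - φ x q.2 - A x q.2 (q.1 - x))
        =o[𝓝[D ×ˢ Ioo (-δ) δ] (x, t)] fun q => q - (x, t) := by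
      have hb : (fun q : E × ℝ => φ q.1 q.2 - φ x q.2 - A x q.2 (q.1 - x))
          =O[𝓝[D ×ˢ Ioo (-δ) δ] (x, t)] fun q => ‖q.1 - x‖ * ‖q.1 - x‖ := by
        refine Asymptotics.IsBigO.of_bound C₂ ?_
        filter_upwards [self_mem_nhdsWithin] with q hq
        have := hC₂ x hx q.1 hq.1 q.2 hq.2
        simpa [pow_two] using this
      refine hb.trans_isLittleO ?_
      have := ((Asymptotics.isLittleO_one_iff ℝ).2 htfst).mul_isBigO hfst.norm_norm
      simpa using this
    have h2 : (fun q : E × ℝ => (A x q.2 - A x t) (q.1 - x))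
        =o[𝓝[D ×ˢ Ioo (-δ) δ] (x, t)] fun q => q - (x, t) := by
      have hb : (fun q : E × ℝ => (A x q.2 - A x t) (q.1 - x))
          =O[𝓝[D ×ˢ Ioo (-δ) δ] (x, t)] fun q => ‖A x q.2 - A x t‖ * ‖q.1 - x‖ := by
        refine Asymptotics.IsBigO.of_bound 1 (Filter.Eventually.of_forall fun q => ?_)
        simpa using (A x q.2 - A x t).le_opNorm (q.1 - x)
      refine hb.trans_isLittleO ?_
      have hA' : Filter.Tendsto (fun q : E × ℝ => ‖A x q.2 - A x t‖)
          (𝓝[D ×ˢ Ioo (-δ) δ] (x, t)) (𝓝 0) := by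
        have := ((hAd x hx t ht).continuousAt.tendsto.comp htsnd).sub_const (A x t) |>.norm
        simpa using this
      have := ((Asymptotics.isLittleO_one_iff ℝ).2 hA').mul_isBigO hfst.norm_norm
      simpa using this
    have h3 : (fun q : E × ℝ => φ x q.2 - φ x t - (q.2 - t) • f (φ x t))
        =o[𝓝[D ×ˢ Ioo (-δ) δ] (x, t)] fun q => q - (x, t) :=
      ((hasDerivAt_iff_isLittleO.1 (hφd x hx t ht)).comp_tendsto htsnd).trans_isBigO hsnd
    refine ((h1.add h2).add h3).congr_left fun q => ?_
    simp only [Function.uncurry, add_apply, ContinuousLinearMap.comp_apply,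
      ContinuousLinearMap.coe_fst', ContinuousLinearMap.smulRight_apply,
      ContinuousLinearMap.coe_snd', Prod.fst_sub, Prod.snd_sub, sub_apply]
    abel

end LocalFlow

/-! ### An implicit function theorem with parameters in a half-space. -/

section Implicit

variable {E : Type*} [NormedAddCommGroup E] [NormedSpace ℝ E] (ℓ : E →L[ℝ] ℝ)

/-- The formula for the derivative of `μ` involves only `dG` at `(x, μ x)`. So if `μ` is of class
`C^n`, its derivative is too, and `μ` gains one order at each step. -/
lemma implicit_bootstrap {O : Set E} (hO : IsOpen O) {B : Set (E × ℝ)} {μ : E → ℝ}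
    {dG : E × ℝ → E × ℝ →L[ℝ] ℝ} (hdG : ContDiffOn ℝ ∞ dG B) (hne : ∀ p ∈ B, dG p (0, 1) ≠ 0)
    (hmaps : ∀ x ∈ O ∩ halfSpace ℓ, (x, μ x) ∈ B)
    (hμ : ∀ x ∈ O ∩ halfSpace ℓ, HasFDerivWithinAt μ (-(dG (x, μ x) (0, 1))⁻¹ •
      (dG (x, μ x)).comp (ContinuousLinearMap.inl ℝ E ℝ)) (O ∩ halfSpace ℓ) x) :
    ContDiffOn ℝ ∞ μ (O ∩ halfSpace ℓ) := by
  have hud : UniqueDiffOn ℝ (O ∩ halfSpace ℓ) := by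
    rw [inter_comm]
    exact (uniqueDiffOn_halfSpace ℓ).inter hO
  rw [contDiffOn_infty]
  intro n
  induction n with
  | zero =>
    rw [Nat.cast_zero, contDiffOn_zero]
    exact fun x hx => (hμ x hx).continuousWithinAt
  | succ n ih =>
    push_cast
    rw [contDiffOn_succ_iff_hasFDerivWithinAt_of_uniqueDiffOn hud]
    refine ⟨by simp, _, ?_, hμ⟩
    have h1 : ContDiffOn ℝ n (fun x => dG (x, μ x)) (O ∩ halfSpace ℓ) :=
      (hdG.of_le (by exact_mod_cast le_top)).comp (contDiffOn_id.prodMk ih) hmaps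
    exact ((h1.clm_apply contDiffOn_const).inv fun x hx => hne _ (hmaps x hx)).neg.smul
      (h1.clm_comp contDiffOn_const)

/-- A smooth implicit function theorem for a scalar unknown, with parameters in a half-space. -/
theorem exists_implicit {G : E × ℝ → ℝ} {x₀ : E} {s₀ c : ℝ} (hx₀ : x₀ ∈ halfSpace ℓ)
    (hG : ∀ᶠ p in 𝓝[halfSpace ℓ ×ˢ univ] (x₀, s₀),
      ContDiffWithinAt ℝ ∞ G (halfSpace ℓ ×ˢ univ) p)
    (hc : HasDerivAt (fun s => G (x₀, s)) c s₀) (hc0 : c ≠ 0) :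
    ∃ (O : Set E) (ε : ℝ) (μ : E → ℝ), IsOpen O ∧ x₀ ∈ O ∧ 0 < ε ∧ μ x₀ = s₀ ∧
      ContDiffOn ℝ ∞ μ (O ∩ halfSpace ℓ) ∧ ∀ x ∈ O ∩ halfSpace ℓ, |μ x - s₀| < ε ∧
        ∀ s, |s - s₀| < ε → (G (x, s) = G (x₀, s₀) ↔ s = μ x) := by
  -- normalization
  wlog hnorm : G (x₀, s₀) = 0 ∧ c = 1 generalizing G c
  · obtain ⟨O, ε, μ, hO, hxO, hε, hμ₀, hμ, h⟩ := this
      (G := fun p => c⁻¹ * (G p - G (x₀, s₀))) (c := 1)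
      (hG.mono fun p hp => contDiffWithinAt_const.mul (hp.sub contDiffWithinAt_const))
      (by simpa [hc0] using (hc.sub_const (G (x₀, s₀))).const_mul c⁻¹) one_ne_zero (by simp)
    refine ⟨O, ε, μ, hO, hxO, hε, hμ₀, hμ, fun x hx => ⟨(h x hx).1, fun s hs => ?_⟩⟩
    rw [← (h x hx).2 s hs]
    simp [hc0, sub_eq_zero]
  obtain ⟨hG0, rfl⟩ := hnorm
  set T : Set (E × ℝ) := halfSpace ℓ ×ˢ univ with hT
  have hTud : UniqueDiffOn ℝ T := (uniqueDiffOn_halfSpace ℓ).prod uniqueDiffOn_univ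
  set dG := fderivWithin ℝ G T with hdG
  have hp₀ : (x₀, s₀) ∈ T := ⟨hx₀, mem_univ _⟩
  have hG₀ := hG.self_of_nhdsWithin hp₀
  have hline : ∀ x ∈ halfSpace ℓ, ∀ s, ContDiffWithinAt ℝ ∞ G T (x, s) →
      HasDerivAt (fun s => G (x, s)) (dG (x, s) (0, 1)) s := by
    intro x hx s h
    have h1 := (h.differentiableWithinAt (by simp)).hasFDerivWithinAt
    have h2 : HasDerivWithinAt (fun s : ℝ => (x, s)) ((0 : E), (1 : ℝ)) univ s :=
      (hasDerivWithinAt_const s univ x).prodMk (hasDerivWithinAt_id s univ)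
    have := h1.comp_hasDerivWithinAt s h2 fun s _ => ⟨hx, mem_univ _⟩
    rwa [hasDerivWithinAt_univ] at this
  have hdG0 : dG (x₀, s₀) (0, 1) = 1 := (hline x₀ hx₀ s₀ hG₀).unique hc
  have hdGc : ContDiffWithinAt ℝ ∞ dG T (x₀, s₀) := hG₀.fderivWithin_right hTud (by simp) hp₀
  have hev : ∀ᶠ p in 𝓝[T] (x₀, s₀), ContDiffWithinAt ℝ ∞ G T p ∧ 1 / 2 < dG p (0, 1) := by
    refine hG.and ?_
    have h1 : ContinuousWithinAt (fun p => dG p (0, 1)) T (x₀, s₀) :=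
      hdGc.continuousWithinAt.clm_apply continuousWithinAt_const
    exact h1.eventually (lt_mem_nhds (by simp only [hdG0]; norm_num))
  obtain ⟨ρ, hρ, hball⟩ := Metric.mem_nhdsWithin_iff.1 hev
  set B := Metric.ball (x₀, s₀) ρ ∩ T with hB
  have hBmem : ∀ x ∈ Metric.ball x₀ ρ ∩ halfSpace ℓ, ∀ s, |s - s₀| < ρ → (x, s) ∈ B := by
    intro x hx s hs
    refine ⟨?_, hx.2, mem_univ _⟩
    rw [Metric.mem_ball, Prod.dist_eq]
    exact max_lt hx.1 (by rwa [Real.dist_eq])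
  have hGB : ∀ p ∈ B, ContDiffWithinAt ℝ ∞ G T p := fun p hp => (hball hp).1
  -- The derivative in `s` exceeds `1 / 2`. This estimate gives both the uniqueness of the root and
  -- the control of its increments.
  have hmono : ∀ x ∈ Metric.ball x₀ ρ ∩ halfSpace ℓ, ∀ s s', |s - s₀| < ρ → |s' - s₀| < ρ →
      |s' - s| ≤ 2 * |G (x, s') - G (x, s)| := by
    intro x hx
    have hd : ∀ s ∈ Ioo (s₀ - ρ) (s₀ + ρ), HasDerivAt (fun s => G (x, s)) (dG (x, s) (0, 1)) s :=
      fun s hs => hline x hx.2 s (hGB _ (hBmem x hx s (abs_lt.2 ⟨by linarith [hs.1],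
        by linarith [hs.2]⟩)))
    have key : ∀ s s', |s - s₀| < ρ → |s' - s₀| < ρ → s ≤ s' →
        1 / 2 * (s' - s) ≤ G (x, s') - G (x, s) := by
      intro s s' hs hs' hle
      rw [abs_lt] at hs hs'
      refine (convex_Ioo (s₀ - ρ) (s₀ + ρ)).mul_sub_le_image_sub_of_le_deriv
        (f := fun s => G (x, s)) (fun s hs => (hd s hs).continuousAt.continuousWithinAt) ?_ ?_
        s ⟨by linarith, by linarith⟩ s' ⟨by linarith, by linarith⟩ hle
      · rw [interior_Ioo]
        exact fun s hs => (hd s hs).differentiableAt.differentiableWithinAt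
      · rw [interior_Ioo]
        intro s hs
        rw [(hd s hs).deriv]
        exact (hball (hBmem x hx s (abs_lt.2 ⟨by linarith [hs.1], by linarith [hs.2]⟩))).2.le
    intro s s' hs hs'
    rcases le_total s s' with h | h
    · have := key s s' hs hs' h
      rw [abs_of_nonneg (by linarith), abs_of_nonneg (by linarith)]; linarith
    · have := key s' s hs' hs h
      rw [abs_of_nonpos (by linarith), abs_of_nonpos (by linarith)]; linarith
  have hcontB : ∀ x ∈ Metric.ball x₀ ρ ∩ halfSpace ℓ, ∀ s, |s - s₀| < ρ →
      ContinuousWithinAt (fun x => G (x, s)) (halfSpace ℓ) x := by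
    intro x hx s hs
    exact (hGB _ (hBmem x hx s hs)).continuousWithinAt.comp
      (f := fun x => (x, s)) (by fun_prop) fun y hy => ⟨hy, mem_univ _⟩
  -- Half the radius keeps the end points `s₀ ± ε` inside the region where the derivative bound
  -- holds.
  set ε := ρ / 2 with hε
  have hε0 : 0 < ε := by positivity
  have hx₀B : x₀ ∈ Metric.ball x₀ ρ ∩ halfSpace ℓ := ⟨Metric.mem_ball_self hρ, hx₀⟩
  -- signs at the ends of the interval
  have hmonoG : StrictMonoOn (fun s => G (x₀, s)) (Ioo (s₀ - ρ) (s₀ + ρ)) := by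
    refine strictMonoOn_of_deriv_pos (convex_Ioo _ _) (fun s hs => ?_) fun s hs => ?_
    · exact (hline x₀ hx₀ s (hGB _ (hBmem x₀ hx₀B s (abs_lt.2 ⟨by linarith [hs.1],
        by linarith [hs.2]⟩)))).continuousAt.continuousWithinAt
    · rw [interior_Ioo] at hs
      have hm := hBmem x₀ hx₀B s (abs_lt.2 ⟨by linarith [hs.1], by linarith [hs.2]⟩)
      rw [(hline x₀ hx₀ s (hGB _ hm)).deriv]
      have : 1 / 2 < dG (x₀, s) (0, 1) := (hball hm).2
      linarith
  have hpos : 0 < G (x₀, s₀ + ε) := by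
    rw [← hG0]
    exact hmonoG ⟨by linarith, by linarith⟩ ⟨by linarith, by linarith⟩ (by linarith)
  have hneg : G (x₀, s₀ - ε) < 0 := by
    rw [← hG0]
    exact hmonoG ⟨by linarith, by linarith⟩ ⟨by linarith, by linarith⟩ (by linarith)
  have hsign : ∀ᶠ x in 𝓝[halfSpace ℓ] x₀, x ∈ Metric.ball x₀ ρ ∧ 0 < G (x, s₀ + ε) ∧
      G (x, s₀ - ε) < 0 := by
    have hb : ∀ᶠ x in 𝓝[halfSpace ℓ] x₀, x ∈ Metric.ball x₀ ρ :=
      mem_nhdsWithin_of_mem_nhds (Metric.ball_mem_nhds _ hρ)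
    refine hb.and (Filter.Eventually.and ?_ ?_)
    · exact (hcontB x₀ hx₀B _ (by rw [add_sub_cancel_left, abs_of_pos hε0]; linarith)).eventually
        (lt_mem_nhds hpos)
    · exact (hcontB x₀ hx₀B _ (by
        rw [sub_sub_cancel_left, abs_neg, abs_of_pos hε0]; linarith)).eventually (gt_mem_nhds hneg)
  obtain ⟨O, hO, hxO, hOsub⟩ := mem_nhdsWithin.1 hsign
  have hroot : ∀ x ∈ O ∩ halfSpace ℓ, ∃ s, |s - s₀| < ε ∧ G (x, s) = 0 := by
    intro x hx
    obtain ⟨h1, h2, h3⟩ := hOsub hx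
    have hcont : ContinuousOn (fun s => G (x, s)) (Icc (s₀ - ε) (s₀ + ε)) := fun s hs =>
      (hline x hx.2 s (hGB _ (hBmem x ⟨h1, hx.2⟩ s (abs_lt.2 ⟨by linarith [hs.1],
        by linarith [hs.2]⟩)))).continuousAt.continuousWithinAt
    obtain ⟨s, hs, hs0⟩ := intermediate_value_Ioo (by linarith) hcont ⟨h3, h2⟩
    exact ⟨s, abs_lt.2 ⟨by linarith [hs.1], by linarith [hs.2]⟩, hs0⟩
  choose! μ hμε hμ0 using hroot
  have hOball : ∀ x ∈ O ∩ halfSpace ℓ, x ∈ Metric.ball x₀ ρ ∩ halfSpace ℓ := fun x hx =>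
    ⟨(hOsub hx).1, hx.2⟩
  have huniq : ∀ x ∈ O ∩ halfSpace ℓ, ∀ s, |s - s₀| < ε → G (x, s) = 0 → s = μ x := by
    intro x hx s hs h0
    have h1 := hmono x (hOball x hx) (μ x) s (by linarith [hμε x hx]) (by linarith)
    rw [h0, hμ0 x hx, sub_self, abs_zero, mul_zero] at h1
    exact sub_eq_zero.1 (abs_eq_zero.1 (le_antisymm h1 (abs_nonneg _)))
  refine ⟨O, ε, μ, hO, hxO, hε0, ?_, ?_, fun x hx => ⟨hμε x hx, fun s hs => ?_⟩⟩
  · exact (huniq x₀ ⟨hxO, hx₀⟩ s₀ (by simpa using hε0) hG0).symm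
  · have hmaps : ∀ x ∈ O ∩ halfSpace ℓ, (x, μ x) ∈ B := fun x hx =>
      hBmem x (hOball x hx) _ (by linarith [hμε x hx])
    have hdGB : ContDiffOn ℝ ∞ dG B := fun p hp =>
      ((hGB p hp).fderivWithin_right hTud (by simp) hp.2).mono inter_subset_right
    refine implicit_bootstrap ℓ hO hdGB (fun p hp => ?_) hmaps fun x hx => ?_
    · have : 1 / 2 < dG p (0, 1) := (hball hp).2
      linarith
    set S' := O ∩ halfSpace ℓ with hS'
    have hd := ((hGB _ (hmaps x hx)).differentiableWithinAt (by simp)).hasFDerivWithinAt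
    have hρμ : ∀ y ∈ S', |μ y - s₀| < ρ := fun y hy => by linarith [hμε y hy]
    -- the increment of `μ` is controlled by the increment of the point
    have hbig : (fun y => μ y - μ x) =O[𝓝[S'] x] fun y => y - x := by
      have h1 : HasFDerivWithinAt (fun y : E => (y, μ x)) (ContinuousLinearMap.inl ℝ E ℝ) S' x :=
        (hasFDerivWithinAt_id x S').prodMk (hasFDerivWithinAt_const _ _ _)
      have hm : MapsTo (fun y : E => (y, μ x)) S' T := fun y hy => ⟨hy.2, mem_univ _⟩
      have h2 := (hd.comp x h1 hm).isBigO_sub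
      refine (Asymptotics.IsBigO.of_bound 2 ?_).trans h2
      filter_upwards [self_mem_nhdsWithin] with y hy
      have := hmono y (hOball y hy) (μ y) (μ x) (hρμ y hy) (hρμ x hx)
      rw [hμ0 y hy] at this
      simp only [Function.comp_apply, hμ0 x hx, Real.norm_eq_abs]
      rwa [abs_sub_comm]
    have htend : Filter.Tendsto (fun y => (y, μ y)) (𝓝[S'] x) (𝓝[T] (x, μ x)) := by
      refine tendsto_nhdsWithin_iff.2 ⟨?_, ?_⟩
      · refine Filter.Tendsto.prodMk_nhds (tendsto_nhdsWithin_of_tendsto_nhds Filter.tendsto_id) ?_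
        have h1 : Filter.Tendsto (fun y => y - x) (𝓝[S'] x) (𝓝 0) := by
          have : Continuous fun y : E => y - x := by fun_prop
          simpa using (this.tendsto x).mono_left (nhdsWithin_le_nhds (s := S'))
        have := hbig.trans_tendsto h1
        simpa using this.add_const (μ x)
      · filter_upwards [self_mem_nhdsWithin] with y hy using ⟨hy.2, mem_univ _⟩
    have hlittle := (hd.isLittleO.comp_tendsto htend)
    have hpair : (fun y => (y, μ y) - (x, μ x)) =O[𝓝[S'] x] fun y => y - x := by
      simp only [Prod.mk_sub_mk]
      exact (Asymptotics.isBigO_refl _ _).prod_left hbig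
    have hc1 : dG (x, μ x) (0, 1) ≠ 0 := by
      have : 1 / 2 < dG (x, μ x) (0, 1) := (hball (hmaps x hx)).2
      linarith
    refine HasFDerivWithinAt.of_isLittleO ?_
    -- `G` vanishes at both `(x, μ x)` and `(y, μ y)`, so the first-order expansion of `G`, divided
    -- by minus its `s`-derivative, is the expansion of `μ`.
    refine ((hlittle.trans_isBigO hpair).const_mul_left (-(dG (x, μ x) (0, 1))⁻¹)).congr' ?_
      Filter.EventuallyEq.rfl
    filter_upwards [self_mem_nhdsWithin] with y hy
    have hsplit : dG (x, μ x) (y - x, μ y - μ x) =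
        dG (x, μ x) (y - x, 0) + (μ y - μ x) * dG (x, μ x) (0, 1) := by
      have : ((y - x, μ y - μ x) : E × ℝ) = (y - x, 0) + (μ y - μ x) • ((0 : E), (1 : ℝ)) := by
        simp
      rw [this, map_add, map_smul, smul_eq_mul]
    simp only [Function.comp_apply, hμ0 x hx, hμ0 y hy, Prod.mk_sub_mk]
    rw [← hdG, hsplit]
    simp only [FunLike.coe_smul, Pi.smul_apply, ContinuousLinearMap.comp_apply,
      ContinuousLinearMap.inl_apply, smul_eq_mul]
    field_simp
    ring
  · rw [hG0]
    exact ⟨huniq x hx s hs, fun h => h ▸ hμ0 x hx⟩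

end Implicit

/-! ### The vector field in charts, and uniqueness of integral curves. -/

section ChartField

variable {E : Type*} [NormedAddCommGroup E] [NormedSpace ℝ E]
  {H : Type*} [TopologicalSpace H] {I : ModelWithCorners ℝ E H} {ℓ : E →L[ℝ] ℝ}
  {M : Type*} [TopologicalSpace M] [ChartedSpace H M]
  {F : (x : M) → TangentSpace I x}

/-- A smooth vector field on a manifold modelled on a half-space, tangent to the boundary. -/
structure IsSmoothTangent (I : ModelWithCorners ℝ E H) (ℓ : E →L[ℝ] ℝ) [IsManifold I ∞ M]
    (F : (x : M) → TangentSpace I x) : Prop where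
  range_eq : range I = halfSpace ℓ
  contMDiff : ContMDiff I I.tangent ∞ (fun x => (⟨x, F x⟩ : TangentBundle I M))
  tangent : TangentToBoundary ℓ F

variable [IsManifold I ∞ M]

lemma le_of_extChartAt (hF : IsSmoothTangent I ℓ F) (p x : M) : 0 ≤ ℓ (extChartAt I p x) := by
  have : extChartAt I p x ∈ halfSpace ℓ := by
    rw [← hF.range_eq, extChartAt_coe]
    exact mem_range_self _
  exact this

/-- From an interior point one can still move a little along `-w` inside the half-space, and this
lowers `ℓ`. -/
lemma eq_zero_or_pos_of_mem_interior {u : E} (hu : u ∈ interior (halfSpace ℓ)) :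
    ℓ = 0 ∨ 0 < ℓ u := by
  obtain ⟨w, h | h⟩ := exists_transverse ℓ
  · exact Or.inl h
  · right
    have hc : ContinuousAt (fun s : ℝ => u - s • w) 0 := by fun_prop
    have := hc.eventually_mem (by simpa using isOpen_interior.mem_nhds hu)
    obtain ⟨ε, hε, hball⟩ := Metric.eventually_nhds_iff_ball.1 this
    have h1 : u - (ε / 2) • w ∈ halfSpace ℓ := hball (ε / 2) (by
      rw [Metric.mem_ball, Real.dist_eq, sub_zero, abs_of_pos (by positivity)]; linarith)
    have h2 : 0 ≤ ℓ (u - (ε / 2) • w) := h1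
    simp only [map_sub, map_smul, h, smul_eq_mul, mul_one] at h2
    linarith

variable (F) in
/-- The vector field, with values in the model vector space. -/
def fieldVec (x : M) : E := F x

variable (F) in
/-- The vector field read in the preferred chart at `p`. -/
noncomputable def chartField (p : M) (u : E) : E :=
  tangentCoordChange I ((extChartAt I p).symm u) p ((extChartAt I p).symm u)
    (fieldVec F ((extChartAt I p).symm u))

lemma chartField_contDiffWithinAt (hF : IsSmoothTangent I ℓ F) (p : M) {u : E}
    (hu : u ∈ (extChartAt I p).target) :
    ContDiffWithinAt ℝ ∞ (chartField F p) (halfSpace ℓ) u := by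
  rw [← hF.range_eq, ← contMDiffWithinAt_iff_contDiffWithinAt]
  set y := (extChartAt I p).symm u with hy
  have hysrc : y ∈ (chartAt H p).source := by
    rw [← extChartAt_source I]; exact (extChartAt I p).map_target hu
  have h1 : ContMDiffAt I 𝓘(ℝ, E) ∞
      (fun y => (trivializationAt E (TangentSpace I) p ⟨y, F y⟩).2) y := by
    refine ((trivializationAt E (TangentSpace I) p).contMDiffAt_section_iff ?_).1
      hF.contMDiff.contMDiffAt
    simpa using hysrc
  exact h1.comp_contMDiffWithinAt u (contMDiffWithinAt_extChartAt_symm_range p hu)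

/-- Being an interior point does not depend on the chart. Used in contrapositive form: when `ℓ ≠ 0`,
a point that some chart sends to `ℓ = 0` is a boundary point. -/
lemma eq_zero_of_isInteriorPoint (hF : IsSmoothTangent I ℓ F) {p x : M}
    (hx : x ∈ (extChartAt I p).source) (h0 : ℓ (extChartAt I p x) = 0)
    (hint : I.IsInteriorPoint x) : ℓ = 0 := by
  rw [extChartAt_source] at hx
  have h1 := (I.isInteriorPoint_iff_of_mem_atlas (n := ∞) (by simp) (chart_mem_atlas H p) hx).1
    hint
  have h2 : extChartAt I p x ∈ interior (halfSpace ℓ) := by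
    rw [← hF.range_eq]
    exact OpenPartialHomeomorph.interior_extend_target_subset_interior_range _ h1
  exact (eq_zero_or_pos_of_mem_interior h2).resolve_right (by rw [h0]; exact lt_irrefl _)

/-- Tangency is assumed in one chart at each point and has to be carried to the others. A vector `w`
with `ℓ w = 0` generates a line that stays in the half-space in both directions. In the other chart
`ℓ` is minimal along its image at time zero, so its derivative vanishes there. -/
lemma chartField_tangent (hF : IsSmoothTangent I ℓ F) (p : M) {u : E}
    (hu : u ∈ (extChartAt I p).target) (h0 : ℓ u = 0) : ℓ (chartField F p u) = 0 := by
  by_cases hℓ : ℓ = 0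
  · rw [hℓ]; simp
  set y := (extChartAt I p).symm u with hy
  have hysrc : y ∈ (extChartAt I p).source := (extChartAt I p).map_target hu
  have hyu : extChartAt I p y = u := (extChartAt I p).right_inv hu
  have hbd : I.IsBoundaryPoint y := by
    rw [I.isBoundaryPoint_iff_not_isInteriorPoint]
    exact fun h => hℓ (eq_zero_of_isInteriorPoint hF hysrc (by rw [hyu, h0]) h)
  have hFy : ℓ (fieldVec F y) = 0 := hF.tangent y hbd
  change ℓ (tangentCoordChange I y p y (fieldVec F y)) = 0
  generalize fieldVec F y = w at hFy ⊢
  set v₀ := extChartAt I y y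
  have hD := hasFDerivWithinAt_tangentCoordChange (I := I) (x := y) (y := p) (z := y)
    ⟨mem_extChartAt_source y, hysrc⟩
  have hline : HasDerivWithinAt (fun s : ℝ => v₀ + s • w) w univ 0 := by
    rw [hasDerivWithinAt_univ]
    simpa using ((hasDerivAt_id (0 : ℝ)).smul_const w).const_add v₀
  have hmaps : MapsTo (fun s : ℝ => v₀ + s • w) univ (range I) := by
    intro s _
    rw [hF.range_eq]
    change 0 ≤ ℓ _
    rw [map_add, map_smul, hFy, smul_zero, add_zero]
    exact le_of_extChartAt hF y y
  have h1 : HasDerivWithinAt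
      ((extChartAt I p ∘ (extChartAt I y).symm) ∘ fun s : ℝ => v₀ + s • w)
      (tangentCoordChange I y p y w) univ 0 := by
    refine HasFDerivWithinAt.comp_hasDerivWithinAt (t := range I) 0 ?_ hline hmaps
    rw [zero_smul, add_zero]
    exact hD
  rw [hasDerivWithinAt_univ] at h1
  have h2 := ℓ.hasFDerivAt.comp_hasDerivAt (0 : ℝ) h1
  -- The inequality holds for every `s`, since `extChartAt` takes values in the range of `I` even
  -- off its source.
  refine IsLocalMin.hasDerivAt_eq_zero (Filter.Eventually.of_forall fun s => ?_) h2
  simp only [Function.comp_apply, zero_smul, add_zero]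
  rw [show (extChartAt I y).symm v₀ = y from extChartAt_to_inv (I := I) y, hyu, h0]
  exact le_of_extChartAt hF p _

lemma extChartAt_target_mem_nhdsWithin_halfSpace (hF : IsSmoothTangent I ℓ F) (p : M) {u : E}
    (hu : u ∈ (extChartAt I p).target) : (extChartAt I p).target ∈ 𝓝[halfSpace ℓ] u := by
  rw [← hF.range_eq]
  exact extChartAt_target_mem_nhdsWithin_of_mem hu

/-- An integral curve of the vector field in a chart is an integral curve in the manifold. -/
lemma hasMFDerivAt_of_chart (p : M) {f : ℝ → E} {s : Set ℝ}
    (hs : IsOpen s) (hf : ∀ t ∈ s, HasDerivAt f (chartField F p (f t)) t)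
    (hmem : ∀ t ∈ s, f t ∈ (extChartAt I p).target) :
    IsMIntegralCurveOn ((extChartAt I p).symm ∘ f) F s := by
  intro t ht
  apply HasMFDerivAt.hasMFDerivWithinAt
  set xt : M := (extChartAt I p).symm (f t) with hxt
  have h : HasDerivAt f (tangentCoordChange I xt p xt (fieldVec F xt)) t := hf t ht
  have hft1 : xt ∈ (extChartAt I p).source := (extChartAt I p).map_target (hmem t ht)
  have hft2 := mem_extChartAt_source (I := I) xt
  have hrange : MapsTo f s (range I) := fun t' ht' =>
    extChartAt_target_subset_range p (hmem t' ht')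
  have hsn : s ∈ 𝓝 t := hs.mem_nhds ht
  have hcont : ContinuousAt ((extChartAt I p).symm ∘ f) t := 
    ContinuousAt.comp (continuousAt_extChartAt_symm'' (hmem t ht)) h.continuousAt
  suffices key : HasDerivAt ((extChartAt I xt ∘ (extChartAt I p).symm) ∘ f) (fieldVec F xt) t by
    refine ⟨hcont, ?_⟩
    have := key.hasFDerivAt.hasFDerivWithinAt (s := range 𝓘(ℝ, ℝ))
    rw [← ContinuousLinearMap.smulRight_one_eq_toSpanSingleton] at this
    exact this
  rw [← tangentCoordChange_self (I := I) (x := xt) (z := xt) (v := fieldVec F xt) hft2,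
    ← tangentCoordChange_comp (x := p) ⟨⟨hft2, hft1⟩, hft2⟩]
  refine HasDerivWithinAt.hasDerivAt (s := s) ?_ hsn
  refine HasFDerivWithinAt.comp_hasDerivWithinAt (t := range I) t ?_ h.hasDerivWithinAt hrange
  have := hasFDerivWithinAt_tangentCoordChange (I := I) (x := p) (y := xt) (z := xt) ⟨hft1, hft2⟩
  rwa [(extChartAt I p).right_inv (hmem t ht)] at this

/-- In the chart at the common point both curves solve the same equation. Uniqueness needs a
Lipschitz field only on a set containing the curves, and a neighbourhood within the half-space is
such a set; boundary points need no separate treatment. -/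
theorem eventuallyEq_of_isMIntegralCurveAt (hF : IsSmoothTangent I ℓ F) {γ γ' : ℝ → M} {t₀ : ℝ}
    (hγ : IsMIntegralCurveAt γ F t₀) (hγ' : IsMIntegralCurveAt γ' F t₀) (h : γ t₀ = γ' t₀) :
    γ =ᶠ[𝓝 t₀] γ' := by
  obtain ⟨K, s, hs, hlip⟩ := ((chartField_contDiffWithinAt hF (γ t₀)
    (mem_extChartAt_target (γ t₀))).of_le (m := 1) (by exact_mod_cast le_top)).exists_lipschitzOnWith
    (convex_halfSpace ℓ)
  have hlip (t : ℝ) : LipschitzOnWith K ((fun _ ↦ chartField F (γ t₀)) t) ((fun _ ↦ s) t) := hlip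
  have hsrc {g} (hg : IsMIntegralCurveAt g F t₀) :
    ∀ᶠ t in 𝓝 t₀, g ⁻¹' (extChartAt I (g t₀)).source ∈ 𝓝 t := eventually_mem_nhds_iff.mpr <|
      continuousAt_def.mp hg.continuousAt _ <| extChartAt_source_mem_nhds (g t₀)
  have hmem {g : ℝ → M} {t} (ht : g ⁻¹' (extChartAt I (g t₀)).source ∈ 𝓝 t) :
    g t ∈ (extChartAt I (g t₀)).source := mem_preimage.mp <| mem_of_mem_nhds ht
  have hdrv {g} (hg : IsMIntegralCurveAt g F t₀) (h' : γ t₀ = g t₀) : ∀ᶠ t in 𝓝 t₀,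
      HasDerivAt ((extChartAt I (g t₀)) ∘ g)
        ((fun _ ↦ chartField F (γ t₀)) t (((extChartAt I (g t₀)) ∘ g) t)) t ∧
      ((extChartAt I (g t₀)) ∘ g) t ∈ (fun _ ↦ s) t := by
    apply Filter.Eventually.and
    · apply (hsrc hg |>.and hg.eventually_hasDerivAt).mono
      rintro t ⟨ht1, ht2⟩
      rw [h']
      apply ht2.congr_deriv
      simp only [chartField]
      congr <;>
      rw [Function.comp_apply, PartialEquiv.left_inv _ (hmem ht1)]
    · have h1 : Filter.Tendsto (extChartAt I (g t₀) ∘ g) (𝓝 t₀)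
          (𝓝[halfSpace ℓ] (extChartAt I (g t₀) (g t₀))) :=
        tendsto_nhdsWithin_iff.2 ⟨(continuousAt_extChartAt (g t₀)).comp hg.continuousAt,
          Filter.Eventually.of_forall fun t => le_of_extChartAt hF _ _⟩
      exact h1 (by rw [← h']; exact hs)
  have heq {g} (hg : IsMIntegralCurveAt g F t₀) :
    g =ᶠ[𝓝 t₀] (extChartAt I (g t₀)).symm ∘ ↑(extChartAt I (g t₀)) ∘ g := by
    apply (hsrc hg).mono
    intro t ht
    rw [Function.comp_apply, Function.comp_apply, PartialEquiv.left_inv _ (hmem ht)]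
  suffices (extChartAt I (γ t₀)) ∘ γ =ᶠ[𝓝 t₀] (extChartAt I (γ' t₀)) ∘ γ' from
    (heq hγ).trans <| (this.fun_comp (extChartAt I (γ t₀)).symm).trans (h ▸ (heq hγ').symm)
  exact ODE_solution_unique_of_eventually (.of_forall hlip)
    (hdrv hγ rfl) (hdrv hγ' h) (by rw [Function.comp_apply, Function.comp_apply, h])

theorem eqOn_of_isMIntegralCurveOn [T2Space M] (hF : IsSmoothTangent I ℓ F) {γ γ' : ℝ → M}
    {a b t₀ : ℝ} (ht₀ : t₀ ∈ Ioo a b) (hγ : IsMIntegralCurveOn γ F (Ioo a b))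
    (hγ' : IsMIntegralCurveOn γ' F (Ioo a b)) (h : γ t₀ = γ' t₀) : EqOn γ γ' (Ioo a b) := by
  intro t ht
  refine (iff_of_eventually_iff isPreconnected_Ioo (fun t => γ t = γ' t) ?_ ht₀ ht).1 h
  intro s hs
  have h1 := hγ.isMIntegralCurveAt (isOpen_Ioo.mem_nhds hs)
  have h2 := hγ'.isMIntegralCurveAt (isOpen_Ioo.mem_nhds hs)
  refine Filter.Eventually.filter_mono nhdsWithin_le_nhds ?_
  by_cases hsγ : γ s = γ' s
  · filter_upwards [eventuallyEq_of_isMIntegralCurveAt hF h1 h2 hsγ] with t ht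
    simp [hsγ, ht]
  · filter_upwards [(h1.continuousAt.ne_iff_eventually_ne h2.continuousAt).1 hsγ] with t ht
    simp [hsγ, ht]

variable [CompleteSpace E]

/-- Here `U`, `δ` and `φ` depend on the order `n`; by uniqueness `φ` is always the same flow, which
is why all orders combine in `flow_smooth`. -/
theorem exists_local_flow (hF : IsSmoothTangent I ℓ F) (p : M) (n : ℕ) :
    ∃ U : Set M, IsOpen U ∧ p ∈ U ∧ ∃ δ > 0, ∃ φ : M → ℝ → M, (∀ x ∈ U, φ x 0 = x ∧
      IsMIntegralCurveOn (φ x) F (Ioo (-δ) δ)) ∧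
      ∀ x ∈ U, ∀ t ∈ Ioo (-δ) δ,
        ContMDiffAt (I.prod 𝓘(ℝ, ℝ)) I n (Function.uncurry φ) (x, t) := by
  set u₀ := extChartAt I p p with hu₀
  have hu₀t : u₀ ∈ (extChartAt I p).target := mem_extChartAt_target p
  have hu₀S : u₀ ∈ halfSpace ℓ := le_of_extChartAt hF p p
  obtain ⟨r, hr, hrt⟩ := Metric.mem_nhdsWithin_iff.1
    (extChartAt_target_mem_nhdsWithin_halfSpace hF p hu₀t)
  -- make the tangency hold on a full neighbourhood
  classical
  set f : E → E := fun u => if u ∈ halfSpace ℓ ∩ (extChartAt I p).target then chartField F p u else 0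
  have hfeq : ∀ u ∈ Metric.ball u₀ r ∩ halfSpace ℓ, f u = chartField F p u := fun u hu =>
    if_pos ⟨hu.2, hrt hu⟩
  have hfC : ContDiffWithinAt ℝ (n + 1) f (halfSpace ℓ) u₀ := by
    refine ((chartField_contDiffWithinAt hF p hu₀t).of_le ?_).congr_of_eventuallyEq ?_
      (hfeq u₀ ⟨Metric.mem_ball_self hr, hu₀S⟩)
    · exact_mod_cast le_top
    · filter_upwards [mem_nhdsWithin_of_mem_nhds (Metric.ball_mem_nhds u₀ hr), self_mem_nhdsWithin]
        with u h1 h2 using hfeq u ⟨h1, h2⟩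
  have hftan : ∀ᶠ u in 𝓝 u₀, ℓ u = 0 → ℓ (f u) = 0 := by
    refine Filter.Eventually.of_forall fun u h => ?_
    by_cases hu : u ∈ halfSpace ℓ ∩ (extChartAt I p).target
    · simp only [f, if_pos hu]
      exact chartField_tangent hF p hu.2 h
    · simp only [f, if_neg hu, map_zero]
  obtain ⟨δ, hδ, φ, hφ, hφC⟩ := exists_localFlow n ℓ hu₀S hr hfC hftan
  set U := (extChartAt I p).source ∩ extChartAt I p ⁻¹' Metric.ball u₀ δ with hU
  have hUin : ∀ x ∈ U, extChartAt I p x ∈ Metric.ball u₀ δ ∩ halfSpace ℓ := fun x hx =>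
    ⟨hx.2, le_of_extChartAt hF p x⟩
  refine ⟨U, isOpen_extChartAt_preimage' p Metric.isOpen_ball,
    ⟨mem_extChartAt_source p, Metric.mem_ball_self hδ⟩, δ, hδ,
    fun x t => (extChartAt I p).symm (φ (extChartAt I p x) t), fun x hx => ⟨?_, ?_⟩, ?_⟩
  · simp only [hφ.zero _ (hUin x hx)]
    exact (extChartAt I p).left_inv hx.1
  · refine hasMFDerivAt_of_chart p isOpen_Ioo (fun t ht => ?_)
      fun t ht => hrt (hφ.mem _ (hUin x hx) t ht)
    rw [← hfeq _ (hφ.mem _ (hUin x hx) t ht)]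
    exact hφ.hasDerivAt _ (hUin x hx) t ht
  · intro x hx t ht
    have h1 : ContMDiffWithinAt 𝓘(ℝ, E × ℝ) 𝓘(ℝ, E) n (Function.uncurry φ)
        ((Metric.ball u₀ δ ∩ halfSpace ℓ) ×ˢ Ioo (-δ) δ) (extChartAt I p x, t) :=
      (hφC _ ⟨hUin x hx, ht⟩).contMDiffWithinAt
    have h2 : ContMDiffWithinAt (I.prod 𝓘(ℝ, ℝ)) 𝓘(ℝ, E × ℝ) n
        (fun q : M × ℝ => (extChartAt I p q.1, q.2)) (U ×ˢ Ioo (-δ) δ) (x, t) := by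
      have hx' : x ∈ (chartAt H p).source := by rw [← extChartAt_source I]; exact hx.1
      have h3 : ContMDiffAt I 𝓘(ℝ, E) n (extChartAt I p) x := contMDiffAt_extChartAt' hx'
      exact ((h3.comp (x, t) contMDiffAt_fst).prodMk_space contMDiffAt_snd).contMDiffWithinAt
    have hm' : MapsTo (fun q : M × ℝ => (extChartAt I p q.1, q.2)) (U ×ˢ Ioo (-δ) δ)
        ((Metric.ball u₀ δ ∩ halfSpace ℓ) ×ˢ Ioo (-δ) δ) := fun q hq => ⟨hUin q.1 hq.1, hq.2⟩
    have h4 := h1.comp (x, t) h2 hm'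
    have hm : MapsTo (fun q : M × ℝ => φ (extChartAt I p q.1) q.2) (U ×ˢ Ioo (-δ) δ) (range I) :=
      fun q hq => extChartAt_target_subset_range p (hrt (hφ.mem _ (hUin q.1 hq.1) q.2 hq.2))
    have h5 := (contMDiffWithinAt_extChartAt_symm_range (I := I) (n := n) p
      (hrt (hφ.mem _ (hUin x hx) t ht))).comp (x, t) h4 hm
    refine h5.contMDiffAt (prod_mem_nhds ?_ (isOpen_Ioo.mem_nhds ht))
    exact (isOpen_extChartAt_preimage' p Metric.isOpen_ball).mem_nhds hx

end ChartField

/-! ### The local flow on the manifold: group law, open domain, smoothness. -/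

section Flow

variable {E : Type*} [NormedAddCommGroup E] [NormedSpace ℝ E]
  {H : Type*} [TopologicalSpace H] {I : ModelWithCorners ℝ E H} {ℓ : E →L[ℝ] ℝ}
  {M : Type*} [TopologicalSpace M] [ChartedSpace H M]
  {F : (x : M) → TangentSpace I x}

lemma isMIntegralCurveOn_shift {γ : ℝ → M} {a b : ℝ} (hγ : IsMIntegralCurveOn γ F (Ioo a b))
    (s : ℝ) : IsMIntegralCurveOn (fun t => γ (t + s)) F (Ioo (a - s) (b - s)) :=
  (hγ.comp_add s).mono fun t ht => ⟨by linarith [ht.1], by linarith [ht.2]⟩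

lemma FlowsTo.of_mem_uIcc {x y : M} {t s : ℝ} (h : FlowsTo F x t y) (hs : s ∈ uIcc 0 t) :
    ∃ z, FlowsTo F x s z := by
  obtain ⟨γ, a, b, h0, ht, hγ, hx, hy⟩ := h
  exact ⟨γ s, γ, a, b, h0, ordConnected_Ioo.uIcc_subset h0 ht hs, hγ, hx, rfl⟩

lemma FlowsTo.symm {x y : M} {t : ℝ} (h : FlowsTo F x t y) : FlowsTo F y (-t) x := by
  obtain ⟨γ, a, b, h0, ht, hγ, hx, hy⟩ := h
  exact ⟨fun s => γ (s + t), a - t, b - t, ⟨by linarith [ht.1], by linarith [ht.2]⟩,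
    ⟨by linarith [h0.1], by linarith [h0.2]⟩, isMIntegralCurveOn_shift hγ t, by simpa using hy,
    by simpa using hx⟩

lemma flowsTo_of_singular {x : M} (hx : x ∈ singularSet F) (t : ℝ) : FlowsTo F x t x :=
  ⟨fun _ => x, -(|t| + 1), |t| + 1, ⟨by linarith [abs_nonneg t], by linarith [abs_nonneg t]⟩,
    ⟨by linarith [neg_abs_le t], by linarith [le_abs_self t]⟩,
    (isMIntegralCurve_const hx).isMIntegralCurveOn _, rfl, rfl⟩

variable [IsManifold I ∞ M] [T2Space M]

lemma FlowsTo.unique (hF : IsSmoothTangent I ℓ F) {x y y' : M} {t : ℝ} (h : FlowsTo F x t y)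
    (h' : FlowsTo F x t y') : y = y' := by
  obtain ⟨γ, a, b, h0, ht, hγ, hx, hy⟩ := h
  obtain ⟨γ', a', b', h0', ht', hγ', hx', hy'⟩ := h'
  have h1 : ∀ s, s ∈ Ioo a b → s ∈ Ioo a' b' → s ∈ Ioo (max a a') (min b b') := fun s h h' =>
    ⟨max_lt h.1 h'.1, lt_min h.2 h'.2⟩
  rw [← hy, ← hy']
  exact eqOn_of_isMIntegralCurveOn hF (h1 0 h0 h0')
    (hγ.mono (Ioo_subset_Ioo (le_max_left _ _) (min_le_left _ _)))
    (hγ'.mono (Ioo_subset_Ioo (le_max_right _ _) (min_le_right _ _))) (hx.trans hx'.symm)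
    (h1 t ht ht')

/-- The second integral curve, delayed by `s`, agrees with the first on the common part of their
intervals by uniqueness, so the two glue. -/
lemma FlowsTo.trans (hF : IsSmoothTangent I ℓ F) {x y z : M} {s t : ℝ} (h : FlowsTo F x s y)
    (h' : FlowsTo F y t z) : FlowsTo F x (s + t) z := by
  classical
  obtain ⟨γ, a, b, h0, hs, hγ, hx, hy⟩ := h
  obtain ⟨γ', a', b', h0', ht', hγ', hy', hz⟩ := h'
  have hγ'' := isMIntegralCurveOn_shift hγ' (-s)
  set η := fun τ => γ' (τ + -s) with hη
  have hagree : ∀ τ ∈ Ioo a b, τ ∈ Ioo (a' - -s) (b' - -s) → γ τ = η τ := by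
    intro τ h1 h2
    refine eqOn_of_isMIntegralCurveOn hF (t₀ := s) (a := max a (a' - -s)) (b := min b (b' - -s))
      ⟨max_lt hs.1 (by linarith [h0'.1]), lt_min hs.2 (by linarith [h0'.2])⟩
      (hγ.mono (Ioo_subset_Ioo (le_max_left _ _) (min_le_left _ _)))
      (hγ''.mono (Ioo_subset_Ioo (le_max_right _ _) (min_le_right _ _)))
      (by simp [hη, hy, hy']) ⟨max_lt h1.1 h2.1, lt_min h1.2 h2.2⟩
  set θ := fun τ => if τ ∈ Ioo a b then γ τ else η τ with hθ
  have hθ1 : ∀ τ ∈ Ioo a b, θ τ = γ τ := fun τ h => if_pos h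
  have hθ2 : ∀ τ ∈ Ioo (a' - -s) (b' - -s), θ τ = η τ := by
    intro τ h
    by_cases h1 : τ ∈ Ioo a b
    · rw [hθ1 τ h1, hagree τ h1 h]
    · exact if_neg h1
  have hint1 : IsMIntegralCurveOn θ F (Ioo a b) := by
    intro τ h
    have := (hγ τ h).congr_of_eventuallyEq (f₁ := θ)
      (Filter.eventuallyEq_of_mem self_mem_nhdsWithin hθ1) (hθ1 τ h)
    rwa [← hθ1 τ h] at this
  have hint2 : IsMIntegralCurveOn θ F (Ioo (a' - -s) (b' - -s)) := by
    intro τ h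
    have := (hγ'' τ h).congr_of_eventuallyEq (f₁ := θ)
      (Filter.eventuallyEq_of_mem self_mem_nhdsWithin hθ2) (hθ2 τ h)
    change HasMFDerivWithinAt 𝓘(ℝ, ℝ) I θ _ τ
      ((1 : ℝ →L[ℝ] ℝ).smulRight (F (η τ))) at this
    rwa [← hθ2 τ h] at this
  refine ⟨θ, min a (a' - -s), max b (b' - -s), ⟨lt_of_le_of_lt (min_le_left _ _) h0.1,
    lt_of_lt_of_le h0.2 (le_max_left _ _)⟩, ⟨lt_of_le_of_lt (min_le_right _ _)
      (by linarith [ht'.1]), lt_of_lt_of_le (by linarith [ht'.2]) (le_max_right _ _)⟩, ?_, ?_, ?_⟩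
  · rw [isMIntegralCurveOn_iff_isMIntegralCurveAt isOpen_Ioo]
    intro τ h
    rw [mem_Ioo, min_lt_iff, lt_max_iff] at h
    -- Both intervals contain `s`, hence their union is the whole interval.
    have : τ ∈ Ioo a b ∨ τ ∈ Ioo (a' - -s) (b' - -s) := by
      simp only [mem_Ioo] at h0' hs ⊢
      rcases lt_or_ge τ s with h1 | h1
      · rcases h.1 with h2 | h2
        · exact Or.inl ⟨h2, by linarith⟩
        · exact Or.inr ⟨h2, by linarith⟩
      · rcases h.2 with h2 | h2
        · exact Or.inl ⟨by linarith, h2⟩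
        · exact Or.inr ⟨by linarith, h2⟩
    rcases this with h1 | h1
    · exact hint1.isMIntegralCurveAt (isOpen_Ioo.mem_nhds h1)
    · exact hint2.isMIntegralCurveAt (isOpen_Ioo.mem_nhds h1)
  · rw [hθ1 0 h0, hx]
  · rw [hθ2 (s + t) ⟨by linarith [ht'.1], by linarith [ht'.2]⟩]
    simp [hη, hz]

lemma eq_of_flowsTo_of_singular (hF : IsSmoothTangent I ℓ F) {x y : M} {t : ℝ}
    (hx : x ∈ singularSet F) (h : FlowsTo F x t y) : y = x :=
  h.unique hF (flowsTo_of_singular hx t)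

lemma FlowsTo.singular_iff (hF : IsSmoothTangent I ℓ F) {x y : M} {t : ℝ} (h : FlowsTo F x t y) :
    y ∈ singularSet F ↔ x ∈ singularSet F := by
  constructor
  · intro hy
    rwa [eq_of_flowsTo_of_singular hF hy h.symm]
  · intro hx
    rwa [eq_of_flowsTo_of_singular hF hx h]

variable (F) in
/-- The domain of the local flow. -/
def flowDomain : Set (M × ℝ) := {p | ∃ y, FlowsTo F p.1 p.2 y}

variable (F) in
open Classical in
/-- The local flow, extended by `x` outside of its domain. -/
noncomputable def flow (p : M × ℝ) : M :=
  if h : ∃ y, FlowsTo F p.1 p.2 y then h.choose else p.1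

omit [IsManifold I ∞ M] [T2Space M] in
lemma flow_spec {p : M × ℝ} (hp : p ∈ flowDomain F) : FlowsTo F p.1 p.2 (flow F p) := by
  have : ∃ y, FlowsTo F p.1 p.2 y := hp
  rw [flow, dif_pos this]
  exact this.choose_spec

omit [IsManifold I ∞ M] [T2Space M] in
lemma FlowsTo.mem_flowDomain {x y : M} {t : ℝ} (h : FlowsTo F x t y) : (x, t) ∈ flowDomain F :=
  ⟨y, h⟩

lemma FlowsTo.flow_eq (hF : IsSmoothTangent I ℓ F) {x y : M} {t : ℝ} (h : FlowsTo F x t y) :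
    flow F (x, t) = y :=
  (flow_spec h.mem_flowDomain).unique hF h

lemma isMIntegralCurveAt_flow (hF : IsSmoothTangent I ℓ F) {x : M} {t : ℝ}
    (h : (x, t) ∈ flowDomain F) : IsMIntegralCurveAt (fun s => flow F (x, s)) F t := by
  obtain ⟨y, γ, a, b, h0, ht, hγ, hx, hy⟩ := h
  have heq : ∀ s ∈ Ioo a b, flow F (x, s) = γ s := fun s hs =>
    FlowsTo.flow_eq hF ⟨γ, a, b, h0, hs, hγ, hx, rfl⟩
  have : IsMIntegralCurveOn (fun s => flow F (x, s)) F (Ioo a b) := by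
    intro s hs
    have := (hγ s hs).congr_of_eventuallyEq (f₁ := fun s => flow F (x, s))
      (Filter.eventuallyEq_of_mem self_mem_nhdsWithin heq) (heq s hs)
    rwa [← heq s hs] at this
  exact this.isMIntegralCurveAt (isOpen_Ioo.mem_nhds ht)

variable [CompleteSpace E]

/-- Near a time `s'` close to `s`, the flow is the flow up to time `s` followed by a local flow for
the short remaining time. So regularity passes from `s` to `s'`, and also back, as the local flow
runs in both directions. -/
lemma eventually_flow_smooth_iff (hF : IsSmoothTangent I ℓ F) (n : ℕ) {x : M} {γ : ℝ → M}
    {a b s₀ : ℝ} (h0 : 0 ∈ Ioo a b) (hγ : IsMIntegralCurveOn γ F (Ioo a b)) (hx : γ 0 = x)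
    (hs₀ : s₀ ∈ Ioo a b) : ∀ᶠ s in 𝓝[Ioo a b] s₀,
      ((flowDomain F ∈ 𝓝 (x, s₀) ∧ ContMDiffAt (I.prod 𝓘(ℝ, ℝ)) I n (flow F) (x, s₀)) ↔
      (flowDomain F ∈ 𝓝 (x, s) ∧ ContMDiffAt (I.prod 𝓘(ℝ, ℝ)) I n (flow F) (x, s))) := by
  obtain ⟨U, hU, hxU, δ, hδ, φ, hφ, hφC⟩ := exists_local_flow hF (γ s₀) n
  have key : ∀ s s', s ∈ Ioo a b → γ s ∈ U → |s' - s| < δ →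
      (flowDomain F ∈ 𝓝 (x, s) ∧ ContMDiffAt (I.prod 𝓘(ℝ, ℝ)) I n (flow F) (x, s)) →
      (flowDomain F ∈ 𝓝 (x, s') ∧ ContMDiffAt (I.prod 𝓘(ℝ, ℝ)) I n (flow F) (x, s')) := by
    rintro s s' hs hsU hss' ⟨hdom, hsm⟩
    have hflow : flow F (x, s) = γ s := FlowsTo.flow_eq hF ⟨γ, a, b, h0, hs, hγ, hx, rfl⟩
    have hins : ContMDiffAt (I.prod 𝓘(ℝ, ℝ)) (I.prod 𝓘(ℝ, ℝ)) n (fun q : M × ℝ => (q.1, s))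
        (x, s') := contMDiffAt_fst.prodMk contMDiffAt_const
    have hc : ContMDiffAt (I.prod 𝓘(ℝ, ℝ)) I n (fun q : M × ℝ => flow F (q.1, s)) (x, s') :=
      ContMDiffAt.comp (x, s') (g := flow F) (f := fun q : M × ℝ => (q.1, s)) hsm hins
    have hev : ∀ᶠ q in 𝓝 (x, s'), FlowsTo F q.1 q.2 (φ (flow F (q.1, s)) (q.2 - s)) := by
      have h1 : ∀ᶠ q in 𝓝 (x, s'), (q.1, s) ∈ flowDomain F := hins.continuousAt.eventually hdom
      have h2 : ∀ᶠ q in 𝓝 (x, s'), flow F (q.1, s) ∈ U :=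
        hc.continuousAt.eventually_mem (hU.mem_nhds (by simpa only [hflow] using hsU))
      have h3 : ∀ᶠ q in 𝓝 (x, s'), |q.2 - s| < δ := by
        have : ContinuousAt (fun q : M × ℝ => |q.2 - s|) (x, s') := by fun_prop
        exact this.eventually (gt_mem_nhds hss')
      filter_upwards [h1, h2, h3] with q hq1 hq2 hq3
      have := (flow_spec hq1).trans hF (z := φ (flow F (q.1, s)) (q.2 - s)) (t := q.2 - s)
        ⟨φ (flow F (q.1, s)), -δ, δ, ⟨by linarith, hδ⟩, abs_lt.1 hq3, (hφ _ hq2).2, (hφ _ hq2).1,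
          rfl⟩
      simpa using this
    refine ⟨hev.mono fun q hq => hq.mem_flowDomain, ?_⟩
    have h4 : ContMDiffAt (I.prod 𝓘(ℝ, ℝ)) 𝓘(ℝ, ℝ) n (fun q : M × ℝ => q.2 - s) (x, s') :=
      contMDiffAt_snd.sub contMDiffAt_const
    have h5 : ContMDiffAt (I.prod 𝓘(ℝ, ℝ)) I n
        (fun q : M × ℝ => Function.uncurry φ (flow F (q.1, s), q.2 - s)) (x, s') := by
      refine ContMDiffAt.comp (x, s') (g := Function.uncurry φ)
        (f := fun q : M × ℝ => (flow F (q.1, s), q.2 - s)) ?_ (hc.prodMk h4)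
      refine hφC _ ?_ _ (abs_lt.1 hss')
      simpa only [hflow] using hsU
    exact h5.congr_of_eventuallyEq (hev.mono fun q hq => hq.flow_eq hF)
  have hcont := (hγ.continuousOn s₀ hs₀).eventually_mem (hU.mem_nhds hxU)
  have hnear : ∀ᶠ s in 𝓝[Ioo a b] s₀, |s - s₀| < δ := by
    have : ContinuousAt (fun s : ℝ => |s - s₀|) s₀ := by fun_prop
    exact nhdsWithin_le_nhds (this.eventually (gt_mem_nhds (by simpa using hδ)))
  filter_upwards [hcont, hnear, self_mem_nhdsWithin] with s h1 h2 h3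
  exact ⟨key s₀ s hs₀ hxU h2, key s s₀ h3 h1 (by rwa [abs_sub_comm])⟩

/-- Openness of the domain and regularity `C^n` hold at time zero by the local flow and spread along
the trajectory by connectedness of the time interval. -/
theorem flow_smooth (hF : IsSmoothTangent I ℓ F) {x : M} {t : ℝ} (h : (x, t) ∈ flowDomain F) :
    flowDomain F ∈ 𝓝 (x, t) ∧ ContMDiffAt (I.prod 𝓘(ℝ, ℝ)) I ∞ (flow F) (x, t) := by
  obtain ⟨y, γ, a, b, h0, ht, hγ, hx, hy⟩ := h
  have key : ∀ n : ℕ, flowDomain F ∈ 𝓝 (x, t) ∧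
      ContMDiffAt (I.prod 𝓘(ℝ, ℝ)) I n (flow F) (x, t) := by
    intro n
    refine (iff_of_eventually_iff isPreconnected_Ioo
      (fun s => flowDomain F ∈ 𝓝 (x, s) ∧ ContMDiffAt (I.prod 𝓘(ℝ, ℝ)) I n (flow F) (x, s))
      (fun s hs => eventually_flow_smooth_iff hF n h0 hγ hx hs) h0 ht).1 ?_
    obtain ⟨U, hU, hxU, δ, hδ, φ, hφ, hφC⟩ := exists_local_flow hF x n
    have hev : ∀ᶠ q in 𝓝 (x, (0 : ℝ)), FlowsTo F q.1 q.2 (Function.uncurry φ q) := by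
      filter_upwards [prod_mem_nhds (hU.mem_nhds hxU) (Ioo_mem_nhds (neg_lt_zero.2 hδ) hδ)]
        with q hq
      exact ⟨φ q.1, -δ, δ, ⟨by linarith, hδ⟩, hq.2, (hφ _ hq.1).2, (hφ _ hq.1).1, rfl⟩
    exact ⟨hev.mono fun q hq => hq.mem_flowDomain,
      (hφC x hxU 0 ⟨by linarith, hδ⟩).congr_of_eventuallyEq (hev.mono fun q hq => hq.flow_eq hF)⟩
  exact ⟨(key 0).1, contMDiffAt_infty.2 fun n => (key n).2⟩

lemma isOpen_flowDomain (hF : IsSmoothTangent I ℓ F) : IsOpen (flowDomain F) :=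
  isOpen_iff_mem_nhds.2 fun _ hp => (flow_smooth hF hp).1

omit [T2Space M] in
lemma flowsTo_zero (hF : IsSmoothTangent I ℓ F) (x : M) : FlowsTo F x 0 x := by
  obtain ⟨U, hU, hxU, δ, hδ, φ, hφ, -⟩ := exists_local_flow hF x 0
  exact ⟨φ x, -δ, δ, ⟨by linarith, hδ⟩, ⟨by linarith, hδ⟩, (hφ x hxU).2, (hφ x hxU).1,
    (hφ x hxU).1⟩

end Flow

/-! ### Shifts near singular points and flow boxes near regular points. -/

section LocalStructure

variable {E : Type*} [NormedAddCommGroup E] [NormedSpace ℝ E]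
  {H : Type*} [TopologicalSpace H] {I : ModelWithCorners ℝ E H} {ℓ : E →L[ℝ] ℝ}
  {M : Type*} [TopologicalSpace M] [ChartedSpace H M]
  {N : Type*} [TopologicalSpace N] [ChartedSpace H N]
  {F : (x : M) → TangentSpace I x}

/-- Inverses near the points are enough: on `A ∩ h ⁻¹' B` and `B ∩ g ⁻¹' A` the two maps become
mutually inverse bijections of open sets. -/
lemma isLocalDiffeomorphAt_of_inverse {h : N → M} {g : M → N} {z : N}
    (hh : ∀ᶠ x in 𝓝 z, ContMDiffAt I I ∞ h x) (hg : ∀ᶠ y in 𝓝 (h z), ContMDiffAt I I ∞ g y)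
    (h1 : ∀ᶠ x in 𝓝 z, g (h x) = x) (h2 : ∀ᶠ y in 𝓝 (h z), h (g y) = y) :
    IsLocalDiffeomorphAt I I ∞ h z := by
  obtain ⟨A, hA, hAo, hzA⟩ := eventually_nhds_iff.1 (hh.and h1)
  obtain ⟨B, hB, hBo, hzB⟩ := eventually_nhds_iff.1 (hg.and h2)
  refine ⟨{ toFun := h, invFun := g, source := A ∩ h ⁻¹' B, target := B ∩ g ⁻¹' A,
            map_source' := fun x hx => ⟨hx.2, ?_⟩, map_target' := fun y hy => ⟨hy.2, ?_⟩,
            left_inv' := fun x hx => (hA x hx.1).2, right_inv' := fun y hy => (hB y hy.1).2,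
            open_source := ?_, open_target := ?_,
            contMDiffOn_toFun := fun x hx => (hA x hx.1).1.contMDiffWithinAt,
            contMDiffOn_invFun := fun y hy => (hB y hy.1).1.contMDiffWithinAt },
          ⟨hzA, hzB⟩, fun x _ => rfl⟩
  · rw [mem_preimage, (hA x hx.1).2]; exact hx.1
  · rw [mem_preimage, (hB y hy.1).2]; exact hy.1
  · exact ContinuousOn.isOpen_inter_preimage
      (fun x hx => (hA x hx).1.continuousAt.continuousWithinAt) hAo hBo
  · exact ContinuousOn.isOpen_inter_preimage
      (fun x hx => (hB x hx).1.continuousAt.continuousWithinAt) hBo hAo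

/-- The smooth implicit function theorem for a scalar unknown, with parameters in a manifold
modelled on a half-space. -/
theorem exists_implicit_manifold [IsManifold I ∞ N] (hI : range I = halfSpace ℓ)
    {G : N × ℝ → ℝ} {x₀ : N} {s₀ c : ℝ}
    (hG : ∀ᶠ p in 𝓝 (x₀, s₀), ContMDiffAt (I.prod 𝓘(ℝ, ℝ)) 𝓘(ℝ, ℝ) ∞ G p)
    (hc : HasDerivAt (fun s => G (x₀, s)) c s₀) (hc0 : c ≠ 0) :
    ∃ (O : Set N) (ε : ℝ) (μ : N → ℝ), IsOpen O ∧ x₀ ∈ O ∧ 0 < ε ∧ μ x₀ = s₀ ∧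
      (∀ x ∈ O, ContMDiffAt I 𝓘(ℝ, ℝ) ∞ μ x) ∧ ∀ x ∈ O, |μ x - s₀| < ε ∧
        ∀ s, |s - s₀| < ε → (G (x, s) = G (x₀, s₀) ↔ s = μ x) := by
  set e := extChartAt I x₀ with he
  set u₀ := e x₀ with hu₀
  have hSe : ∀ x, e x ∈ halfSpace ℓ := fun x => by
    rw [← hI, he, extChartAt_coe]; exact mem_range_self _
  have heu₀ : e.symm u₀ = x₀ := extChartAt_to_inv (I := I) x₀
  have htarget : ∀ᶠ p in 𝓝[halfSpace ℓ ×ˢ univ] (u₀, s₀), p.1 ∈ e.target := by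
    have h1 : Filter.Tendsto (Prod.fst : E × ℝ → E) (𝓝[halfSpace ℓ ×ˢ univ] (u₀, s₀))
        (𝓝[halfSpace ℓ] u₀) :=
      tendsto_nhdsWithin_iff.2 ⟨(continuous_fst.tendsto _).mono_left nhdsWithin_le_nhds,
        by filter_upwards [self_mem_nhdsWithin] with p hp using hp.1⟩
    exact h1 (hI ▸ extChartAt_target_mem_nhdsWithin x₀)
  have hsymm : ContinuousAt (fun p : E × ℝ => (e.symm p.1, p.2)) (u₀, s₀) :=
    ((continuousAt_extChartAt_symm x₀).comp (x := (u₀, s₀)) continuousAt_fst).prodMk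
      continuousAt_snd
  have hgood : ∀ᶠ p in 𝓝[halfSpace ℓ ×ˢ univ] (u₀, s₀),
      ContDiffWithinAt ℝ ∞ (fun p : E × ℝ => G (e.symm p.1, p.2)) (halfSpace ℓ ×ˢ univ) p := by
    have h1 : ∀ᶠ p in 𝓝[halfSpace ℓ ×ˢ univ] (u₀, s₀),
        ContMDiffAt (I.prod 𝓘(ℝ, ℝ)) 𝓘(ℝ, ℝ) ∞ G (e.symm p.1, p.2) := by
      refine nhdsWithin_le_nhds (hsymm.eventually ?_)
      simpa only [heu₀] using hG
    filter_upwards [htarget, h1] with p hp1 hp2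
    rw [← contMDiffWithinAt_iff_contDiffWithinAt]
    have h2 : ContMDiffWithinAt 𝓘(ℝ, E × ℝ) I ∞ (fun p : E × ℝ => e.symm p.1)
        (halfSpace ℓ ×ˢ univ) p :=
      ContMDiffWithinAt.comp (t := range I) p (contMDiffWithinAt_extChartAt_symm_range x₀ hp1)
        contDiff_fst.contDiffAt.contDiffWithinAt.contMDiffWithinAt
        fun q hq => by rw [hI]; exact hq.1
    have h3 : ContMDiffWithinAt 𝓘(ℝ, E × ℝ) 𝓘(ℝ, ℝ) ∞ (fun p : E × ℝ => p.2)
        (halfSpace ℓ ×ˢ univ) p := contDiff_snd.contDiffAt.contDiffWithinAt.contMDiffWithinAt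
    exact hp2.comp_contMDiffWithinAt p (h2.prodMk h3)
  obtain ⟨O, ε, μ, hO, hxO, hε, hμ₀, hμ, h⟩ := exists_implicit ℓ (hSe x₀) hgood
    (by simpa only [heu₀, ← hu₀] using hc) hc0
  have hinv : ∀ x ∈ e.source, e.symm (e x) = x := fun x hx => e.left_inv hx
  refine ⟨e.source ∩ e ⁻¹' O, ε, fun x => μ (e x), isOpen_extChartAt_preimage' x₀ hO,
    ⟨mem_extChartAt_source x₀, hxO⟩, hε, hμ₀, fun x hx => ?_, fun x hx => ?_⟩
  · have hx' : x ∈ (chartAt H x₀).source := by rw [← extChartAt_source I]; exact hx.1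
    have h1 : ContMDiffWithinAt 𝓘(ℝ, E) 𝓘(ℝ, ℝ) ∞ μ (O ∩ halfSpace ℓ) (e x) :=
      (hμ (e x) ⟨hx.2, hSe x⟩).contMDiffWithinAt
    have h2 : ContMDiffAt I 𝓘(ℝ, E) ∞ e x := contMDiffAt_extChartAt' hx'
    have h3 := h1.comp (s := e.source ∩ e ⁻¹' O) x h2.contMDiffWithinAt
      fun y hy => ⟨hy.2, hSe y⟩
    exact h3.contMDiffAt ((isOpen_extChartAt_preimage' x₀ hO).mem_nhds hx)
  · refine ⟨(h (e x) ⟨hx.2, hSe x⟩).1, fun s hs => ?_⟩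
    have := (h (e x) ⟨hx.2, hSe x⟩).2 s hs
    simpa only [hinv x hx.1, ← hu₀, heu₀] using this

/-- Near a regular point there is a function which strictly varies along the integral curves. -/
lemma exists_transverse_function [IsManifold I ∞ M] {y₀ : M} (hy₀ : y₀ ∉ singularSet F) :
    ∃ τ : M → ℝ, (∀ᶠ y in 𝓝 y₀, ContMDiffAt I 𝓘(ℝ, ℝ) ∞ τ y) ∧
      ∀ (γ : ℝ → M) (t₀ : ℝ), IsMIntegralCurveAt γ F t₀ → γ t₀ = y₀ →
        ∃ c ≠ 0, HasDerivAt (τ ∘ γ) c t₀ := by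
  have hv : fieldVec F y₀ ≠ 0 := hy₀
  -- A continuous linear functional that does not vanish on the vector `F y₀`, read in the chart at
  -- `y₀`, serves as `τ`.
  obtain ⟨g, hg⟩ := SeparatingDual.exists_ne_zero (R := ℝ) hv
  refine ⟨fun y => g (extChartAt I y₀ y), ?_, fun γ t₀ hγ h0 => ⟨g (fieldVec F y₀), hg, ?_⟩⟩
  · filter_upwards [extChartAt_source_mem_nhds (I := I) y₀] with y hy
    rw [extChartAt_source] at hy
    have h1 : ContMDiffAt I 𝓘(ℝ, E) ∞ (extChartAt I y₀) y := contMDiffAt_extChartAt' hy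
    exact g.contDiff.contMDiff.contMDiffAt.comp y h1
  · subst h0
    have h1 := hγ.eventually_hasDerivAt.self_of_nhds
    have h2 : tangentCoordChange I (γ t₀) (γ t₀) (γ t₀) (fieldVec F (γ t₀)) = fieldVec F (γ t₀) :=
      tangentCoordChange_self (mem_extChartAt_source _)
    have h3 : HasDerivAt (extChartAt I (γ t₀) ∘ γ) (fieldVec F (γ t₀)) t₀ := by
      rw [← h2]; exact h1
    exact g.hasFDerivAt.comp_hasDerivAt t₀ h3

variable [IsManifold I ∞ M] [T2Space M] [CompleteSpace E]

/-- A shift along the orbits is a local diffeomorphism at singular points. -/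
theorem isLocalDiffeomorphAt_shift (hF : IsSmoothTangent I ℓ F) {i h : N → M} {α : N → ℝ} {z : N}
    (hi : IsLocalDiffeomorphAt I I ∞ i z) (hα : ContMDiff I 𝓘(ℝ, ℝ) ∞ α)
    (hh : ContMDiff I I ∞ h) (hflow : ∀ x, FlowsTo F (i x) (α x) (h x))
    (hz : i z ∈ singularSet F) : IsLocalDiffeomorphAt I I ∞ h z := by
  have hhz : h z = i z := eq_of_flowsTo_of_singular hF hz (hflow z)
  obtain ⟨Ψ, hzΨ, hΨ⟩ := hi
  have hΨi : ∀ x ∈ Ψ.source, Ψ.symm (i x) = x := fun x hx => by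
    rw [hΨ hx]; exact Ψ.left_inv hx
  have hiΨ : ∀ y ∈ Ψ.target, i (Ψ.symm y) = y := fun y hy => by
    exact (hΨ (Ψ.map_target hy)).trans (Ψ.right_inv hy)
  have hizt : i z ∈ Ψ.target := by rw [hΨ hzΨ]; exact Ψ.map_source hzΨ
  have hflowz : ∀ s, flow F (i z, s) = i z := fun s => (flowsTo_of_singular hz s).flow_eq hF
  -- If `y = h x`, then `x = κ (y, s)` with `s = α x`, so the unknown time solves `s = α (κ (y,
  -- s))`. At `y = i z` the right side does not depend on `s`, so the `s`-derivative of the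
  -- difference is `1` and the solution `μ y` is smooth. The local inverse of `h` is then `y ↦ κ (y,
  -- μ y)`.
  set κ : M × ℝ → N := fun p => Ψ.symm (flow F (p.1, -p.2)) with hκ
  have hκz : ∀ s, κ (i z, s) = z := fun s => by
    simp only [hκ, hflowz]
    exact hΨi z hzΨ
  have hneg : ∀ p : M × ℝ, ContMDiffAt (I.prod 𝓘(ℝ, ℝ)) (I.prod 𝓘(ℝ, ℝ)) ∞
      (fun p : M × ℝ => (p.1, -p.2)) p := fun p =>
    contMDiffAt_fst.prodMk contMDiffAt_snd.neg
  have hgood : ∀ᶠ p in 𝓝 (i z, α z), (p.1, -p.2) ∈ flowDomain F ∧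
      flow F (p.1, -p.2) ∈ Ψ.target ∧ ContMDiffAt (I.prod 𝓘(ℝ, ℝ)) I ∞ κ p := by
    have h1 : ∀ᶠ p in 𝓝 (i z, α z), (p.1, -p.2) ∈ flowDomain F :=
      (hneg _).continuousAt.eventually_mem
        ((isOpen_flowDomain hF).mem_nhds (flowsTo_of_singular hz _).mem_flowDomain)
    have hsm : ∀ p : M × ℝ, (p.1, -p.2) ∈ flowDomain F → ContMDiffAt (I.prod 𝓘(ℝ, ℝ)) I ∞
        (fun p : M × ℝ => flow F (p.1, -p.2)) p := fun p hp =>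
      ContMDiffAt.comp p (g := flow F) (f := fun p : M × ℝ => (p.1, -p.2))
        (flow_smooth hF hp).2 (hneg p)
    have h2 : ∀ᶠ p in 𝓝 (i z, α z), flow F (p.1, -p.2) ∈ Ψ.target :=
      (hsm _ h1.self_of_nhds).continuousAt.eventually_mem
        (Ψ.open_target.mem_nhds (by simpa only [hflowz] using hizt))
    filter_upwards [h1, h2] with p hp1 hp2
    refine ⟨hp1, hp2, ?_⟩
    exact ContMDiffAt.comp p (g := Ψ.symm) (f := fun p : M × ℝ => flow F (p.1, -p.2))
      (Ψ.contMDiffOn_invFun.contMDiffAt (Ψ.open_target.mem_nhds hp2)) (hsm p hp1)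
  obtain ⟨O, ε, μ, hO, hzO, hε, hμz, hμ, hμO⟩ := exists_implicit_manifold hF.range_eq
    (G := fun p : M × ℝ => p.2 - α (κ p)) (x₀ := i z) (s₀ := α z) (c := 1)
    (hgood.mono fun p hp => contMDiffAt_snd.sub ((hα _).comp p hp.2.2))
    (by simp only [hκz]; exact (hasDerivAt_id (α z)).sub_const (α z)) one_ne_zero
  simp only [hκz, sub_self] at hμO
  have hpair : ∀ y ∈ O, ContMDiffAt I (I.prod 𝓘(ℝ, ℝ)) ∞ (fun y => (y, μ y)) y := fun y hy =>
    contMDiffAt_id.prodMk (hμ y hy)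
  have hgoodμ : ∀ᶠ y in 𝓝 (i z), (y, -μ y) ∈ flowDomain F ∧
      flow F (y, -μ y) ∈ Ψ.target ∧ ContMDiffAt (I.prod 𝓘(ℝ, ℝ)) I ∞ κ (y, μ y) := by
    refine (hpair _ hzO).continuousAt.eventually (p := fun p => (p.1, -p.2) ∈ flowDomain F ∧
      flow F (p.1, -p.2) ∈ Ψ.target ∧ ContMDiffAt (I.prod 𝓘(ℝ, ℝ)) I ∞ κ p) ?_
    simp only [hμz]; exact hgood
  have hOnhds : ∀ᶠ y in 𝓝 (i z), y ∈ O := hO.mem_nhds hzO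
  refine isLocalDiffeomorphAt_of_inverse (g := fun y => κ (y, μ y))
    (Filter.Eventually.of_forall fun x => hh x) ?_ ?_ ?_
  · rw [hhz]
    filter_upwards [hgoodμ, hOnhds] with y hy hyO
    exact ContMDiffAt.comp y (g := κ) (f := fun y => (y, μ y)) hy.2.2 (hpair y hyO)
  · have h1 : ∀ᶠ x in 𝓝 z, h x ∈ O := hh.continuous.continuousAt.eventually_mem (by
      rw [hhz]; exact hOnhds)
    have h2 : ∀ᶠ x in 𝓝 z, |α x - α z| < ε := by
      have : ContinuousAt (fun x => |α x - α z|) z :=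
        (hα.continuous.continuousAt.sub continuousAt_const).abs
      exact this.eventually (gt_mem_nhds (by simpa using hε))
    filter_upwards [h1, h2, Ψ.open_source.mem_nhds hzΨ] with x hx1 hx2 hx3
    have hk : κ (h x, α x) = x := by
      simp only [hκ, (hflow x).symm.flow_eq hF]
      exact hΨi x hx3
    rw [← ((hμO (h x) hx1).2 (α x) hx2).1 (by rw [hk, sub_self]), hk]
  · rw [hhz]
    filter_upwards [hgoodμ, hOnhds] with y hy hyO
    have h1 := ((hμO y hyO).2 (μ y) (hμO y hyO).1).2 rfl
    have h2 : FlowsTo F (i (κ (y, μ y))) (μ y) y := by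
      have := (flow_spec hy.1).symm
      rw [← hiΨ _ hy.2.1] at this
      simpa only [neg_neg] using this
    have h3 := hflow (κ (y, μ y))
    rw [← sub_eq_zero.1 h1] at h3
    exact h3.unique hF h2

/-- Near a regular point there is a continuous function which measures the time along continuous
paths that stay in one orbit. -/
theorem exists_time_function [MetrizableSpace M] (hF : IsSmoothTangent I ℓ F) {y₀ : M}
    (hy₀ : y₀ ∉ singularSet F) : ∃ (B : Set M) (σ : M → ℝ), IsOpen B ∧ y₀ ∈ B ∧
      ContinuousOn σ B ∧ ∀ {T : Type} [TopologicalSpace T] (J : Set T) (c : T → M) (w : M),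
        IsPreconnected J → ContinuousOn c J → MapsTo c J B → (∀ t ∈ J, c t ∈ orbit F w) →
        ∀ t ∈ J, ∀ t' ∈ J, FlowsTo F (c t) (σ (c t') - σ (c t)) (c t') := by
  obtain ⟨τ, hτ, hτγ⟩ := exists_transverse_function hy₀
  have h00 : FlowsTo F y₀ 0 y₀ := flowsTo_zero hF y₀
  have hflow0 : flow F (y₀, 0) = y₀ := h00.flow_eq hF
  obtain ⟨c, hc0, hc⟩ := hτγ _ 0 (isMIntegralCurveAt_flow hF h00.mem_flowDomain) hflow0
  have hdom : ∀ᶠ p in 𝓝 (y₀, (0 : ℝ)), p ∈ flowDomain F :=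
    (isOpen_flowDomain hF).mem_nhds h00.mem_flowDomain
  -- `μ y` is the short time in which `y` flows to the transversal on which `τ` has the value it
  -- takes at `y₀`; the time function is `-μ`.
  obtain ⟨O, ε, μ, hO, hyO, hε, hμ0, hμ, hμO⟩ := exists_implicit_manifold hF.range_eq
    (G := fun p : M × ℝ => τ (flow F p)) (x₀ := y₀) (s₀ := 0) (c := c) (by
      have h1 : ∀ᶠ p in 𝓝 (y₀, (0 : ℝ)), ContMDiffAt I 𝓘(ℝ, ℝ) ∞ τ (flow F p) :=
        (flow_smooth hF h00.mem_flowDomain).2.continuousAt.eventually (by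
          rw [hflow0]; exact hτ)
      filter_upwards [hdom, h1] with p hp1 hp2
      exact ContMDiffAt.comp p hp2 (flow_smooth hF (x := p.1) (t := p.2) hp1).2) hc hc0
  simp only [sub_zero] at hμO
  obtain ⟨A, hA, δ, hδ, hbox⟩ : ∃ A ∈ 𝓝 y₀, ∃ δ > 0, ∀ y ∈ A, ∀ s : ℝ, |s| < δ →
      (y, s) ∈ flowDomain F := by
    obtain ⟨A, hA, B, hB, hAB⟩ := mem_nhds_prod_iff.1 hdom
    obtain ⟨δ, hδ, hball⟩ := Metric.mem_nhds_iff.1 hB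
    exact ⟨A, hA, δ, hδ, fun y hy s hs => hAB ⟨hy, hball (by simpa using hs)⟩⟩
  -- The quarter leaves room for the sum of a hitting time and a difference of crossing times, each
  -- less than `η`, to stay below `ε`.
  set η := min ε δ / 4 with hη
  have hη0 : 0 < η := by positivity
  have hηε : 4 * η ≤ ε := by rw [hη]; linarith [min_le_left ε δ]
  have hηδ : 4 * η ≤ δ := by rw [hη]; linarith [min_le_right ε δ]
  have hev : ∀ᶠ y in 𝓝 y₀, y ∈ O ∧ y ∈ A ∧ |μ y| < η := by
    have hO' : ∀ᶠ y in 𝓝 y₀, y ∈ O := hO.mem_nhds hyO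
    refine hO'.and (Filter.Eventually.and hA ?_)
    exact (hμ y₀ hyO).continuousAt.abs.eventually (gt_mem_nhds (by simpa [hμ0] using hη0))
  obtain ⟨B, hB, hBo, hyB⟩ := eventually_nhds_iff.1 hev
  set π : M → M := fun y => flow F (y, μ y) with hπ
  have hπflow : ∀ y ∈ B, FlowsTo F y (μ y) (π y) := fun y hy =>
    flow_spec (p := (y, μ y)) (hbox y (hB y hy).2.1 _ (by linarith [(hB y hy).2.2]))
  have hτπ : ∀ y ∈ B, τ (π y) = τ (flow F (y₀, 0)) := fun y hy =>
    ((hμO y (hB y hy).1).2 (μ y) (hμO y (hB y hy).1).1).2 rfl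
  have hμc : ContinuousOn μ B := fun y hy =>
    (hμ y (hB y hy).1).continuousAt.continuousWithinAt
  have hπc : ContinuousOn π B := by
    intro y hy
    have h1 := (flow_smooth hF (hπflow y hy).mem_flowDomain).2.continuousAt
    exact ContinuousAt.comp_continuousWithinAt (f := fun y => (y, μ y)) h1
      (continuousWithinAt_id.prodMk (hμc y hy))
  refine ⟨B, fun y => -μ y, hBo, hyB, hμc.neg, ?_⟩
  intro T _ J c w hJ hcJ hcB hcw t ht t' ht'
  -- the orbit crosses the transversal at a countable set of times
  set R : Set ℝ := {r | ∃ y ∈ B, FlowsTo F w r (π y)} with hR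
  -- If two crossings are less than `η` apart, the point `y` of the first reaches the transversal
  -- both in time `μ y` and in time `μ y + (r' - r)`. Both are below `ε`, so they coincide.
  have hRsep : ∀ r ∈ R, ∀ r' ∈ R, |r' - r| < η → r = r' := by
    rintro r ⟨y, hy, hr⟩ r' ⟨y', hy', hr'⟩ hrr
    have h1 : FlowsTo F y (μ y + -r + r') (π y') := ((hπflow y hy).trans hF hr.symm).trans hF hr'
    have h2 : |μ y + -r + r'| < ε := by
      have h3 : |μ y + -r + r'| ≤ |μ y| + |r' - r| := by
        rw [show μ y + -r + r' = μ y + (r' - r) by ring]; exact abs_add_le _ _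
      linarith [(hB y hy).2.2]
    have h3 := ((hμO y (hB y hy).1).2 _ h2).1 (by rw [h1.flow_eq hF, hτπ y' hy'])
    linarith
  have hRc : R.Countable := by
    refine MapsTo.countable_of_injOn (f := fun r : ℝ => ⌊r / η⌋) (t := univ) (fun _ _ => mem_univ _)
      (fun r hr r' hr' h => hRsep r hr r' hr' ?_) (countable_univ)
    have := Int.abs_sub_lt_one_of_floor_eq_floor h.symm
    rwa [← sub_div, abs_div, abs_of_pos hη0, div_lt_one hη0] at this
  have hπw : (π ∘ c) '' J ⊆ (fun r => flow F (w, r)) '' R := by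
    rintro _ ⟨s, hs, rfl⟩
    obtain ⟨r, hr⟩ := hcw s hs
    have := hr.trans hF (hπflow (c s) (hcB hs))
    exact ⟨r + μ (c s), ⟨c s, hcB hs, this⟩, this.flow_eq hF⟩
  have hcount : ((π ∘ c) '' J).Countable := (hRc.image _).mono hπw
  have hpre : IsPreconnected ((π ∘ c) '' J) := hJ.image _ (hπc.comp hcJ hcB)
  let := metrizableSpaceMetric M
  -- A connected countable subset of a metric space has at most one point, so the path stays on one
  -- strand of the orbit.
  have hsub : ((π ∘ c) '' J).Subsingleton := hcount.isTotallyDisconnected _ Subset.rfl hpre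
  have heq : π (c t) = π (c t') := hsub (mem_image_of_mem _ ht) (mem_image_of_mem _ ht')
  have h1 := hπflow (c t) (hcB ht)
  have h2 := (hπflow (c t') (hcB ht')).symm
  rw [heq] at h1
  have h3 := h1.trans hF h2
  rwa [show -μ (c t') - -μ (c t) = μ (c t) + -μ (c t') by ring]

end LocalStructure

/-! ### Deformations versus continuous paths in the weak topology. -/

section JetContinuity

variable {E : Type*} [NormedAddCommGroup E] [NormedSpace ℝ E]

/-- The iterated partial derivatives of a smooth function depend smoothly on all variables. -/
lemma contDiffWithinAt_iteratedFDerivWithin_param {S : Set E} (hS : UniqueDiffOn ℝ S)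
    {φ : E × ℝ → E} {u₀ : E} {s₀ : ℝ} (hu₀ : u₀ ∈ S)
    (hφ : ContDiffWithinAt ℝ ∞ φ (S ×ˢ univ) (u₀, s₀)) (j : ℕ) :
    ContDiffWithinAt ℝ ∞
      (fun p : E × ℝ => iteratedFDerivWithin ℝ j (fun u => φ (u, p.2)) S p.1)
      (S ×ˢ univ) (u₀, s₀) := by
  induction j with
  | zero =>
    have h := ((continuousMultilinearCurryFin0 ℝ E E).symm :
      E →L[ℝ] ContinuousMultilinearMap ℝ (fun _ : Fin 0 => E) E).contDiff.contDiffAt.comp_contDiffWithinAt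
      (u₀, s₀) hφ
    exact h
  | succ j ih =>
    simp only [iteratedFDerivWithin_succ_eq_comp_left, Function.comp_apply]
    -- The whole pair `p` is taken as parameter, although only `p.2` matters, so that the point
    -- `p.1` of differentiation is a function of the parameter.
    set Hj : E × ℝ → E → ContinuousMultilinearMap ℝ (fun _ : Fin j => E) E :=
      fun p u => iteratedFDerivWithin ℝ j (fun u => φ (u, p.2)) S u with hHj
    have h1 : ContDiffWithinAt ℝ ∞ (Function.uncurry Hj) ((S ×ˢ univ) ×ˢ S) ((u₀, s₀), u₀) := by
      refine ContDiffWithinAt.comp (t := S ×ˢ univ)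
        (g := fun p : E × ℝ => iteratedFDerivWithin ℝ j (fun u => φ (u, p.2)) S p.1)
        (f := fun q : (E × ℝ) × E => (q.2, q.1.2)) ((u₀, s₀), u₀) ih ?_
        (fun q hq => ⟨hq.2, mem_univ _⟩)
      exact (contDiff_snd.prodMk (contDiff_snd.comp contDiff_fst)).contDiffAt.contDiffWithinAt
    have h2 : ContDiffWithinAt ℝ ∞ (fun p : E × ℝ => fderivWithin ℝ (Hj p) S p.1)
        (S ×ˢ univ) (u₀, s₀) :=
      ContDiffWithinAt.fderivWithin h1 contDiff_fst.contDiffAt.contDiffWithinAt hS le_rfl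
        ⟨hu₀, mem_univ _⟩ (fun p hp => hp.1)
    have h := ((continuousMultilinearCurryLeftEquiv ℝ (fun _ : Fin (j + 1) => E) E).symm :
      (E →L[ℝ] ContinuousMultilinearMap ℝ (fun _ : Fin j => E) E) →L[ℝ]
        ContinuousMultilinearMap ℝ (fun _ : Fin (j + 1) => E) E).contDiff.contDiffAt.comp_contDiffWithinAt
      (u₀, s₀) h2
    exact h

variable {H : Type*} [TopologicalSpace H] {I : ModelWithCorners ℝ E H}
  {M : Type*} [TopologicalSpace M] [ChartedSpace H M] [IsManifold I ∞ M]
  {N : Type*} [TopologicalSpace N] [ChartedSpace H N] [IsManifold I ∞ N]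
  {T : Type*} [TopologicalSpace T]

/-- The jets of a family of maps which depends smoothly on a real parameter are jointly
continuous. -/
lemma continuousOn_chartDeriv_of_contMDiffAt {G : N × ℝ → M} {e : T → ℝ} (he : Continuous e)
    {Ω : T → C^∞⟮I, N; I, M⟯} (hG : ∀ x t, ContMDiffAt (I.prod 𝓘(ℝ, ℝ)) I ∞ G (x, e t))
    (hΩ : ∀ x t, Ω t x = G (x, e t)) (a : N) (b : M) (j : ℕ) :
    ContinuousOn (fun p : N × T => chartDeriv a b j (Ω p.2) p.1)
      {p | p.1 ∈ (extChartAt I a).source ∧ Ω p.2 p.1 ∈ (extChartAt I b).source} := by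
  rintro ⟨x₀, t₀⟩ ⟨hx₀, hb⟩
  simp only at hx₀ hb
  set φ : E × ℝ → E := fun q => extChartAt I b (G ((extChartAt I a).symm q.1, q.2)) with hφ
  have hu₀ : extChartAt I a x₀ ∈ (extChartAt I a).target := (extChartAt I a).map_source hx₀
  have hinv : (extChartAt I a).symm (extChartAt I a x₀) = x₀ := (extChartAt I a).left_inv hx₀
  have hmem : ∀ x, extChartAt I a x ∈ range I := fun x => by
    rw [extChartAt_coe]; exact mem_range_self _
  have hφs : ContDiffWithinAt ℝ ∞ φ (range I ×ˢ univ) (extChartAt I a x₀, e t₀) := by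
    rw [← contMDiffWithinAt_iff_contDiffWithinAt]
    have h1 : ContMDiffWithinAt 𝓘(ℝ, E × ℝ) I ∞ (fun q : E × ℝ => (extChartAt I a).symm q.1)
        (range I ×ˢ univ) (extChartAt I a x₀, e t₀) :=
      ContMDiffWithinAt.comp (t := range I) _ (contMDiffWithinAt_extChartAt_symm_range a hu₀)
        contDiff_fst.contDiffAt.contDiffWithinAt.contMDiffWithinAt fun q hq => hq.1
    have h2 : ContMDiffWithinAt 𝓘(ℝ, E × ℝ) 𝓘(ℝ, ℝ) ∞ (fun q : E × ℝ => q.2)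
        (range I ×ˢ univ) (extChartAt I a x₀, e t₀) :=
      contDiff_snd.contDiffAt.contDiffWithinAt.contMDiffWithinAt
    have h3 : ContMDiffAt (I.prod 𝓘(ℝ, ℝ)) 𝓘(ℝ, E) ∞ (fun p => extChartAt I b (G p))
        ((extChartAt I a).symm (extChartAt I a x₀), e t₀) := by
      rw [hinv]
      refine ContMDiffAt.comp (g := extChartAt I b) (x₀, e t₀) ?_ (hG x₀ t₀)
      rw [hΩ] at hb
      exact contMDiffAt_extChartAt' (by rwa [← extChartAt_source I])
    exact h3.comp_contMDiffWithinAt (f := fun q : E × ℝ => ((extChartAt I a).symm q.1, q.2))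
      (extChartAt I a x₀, e t₀) (h1.prodMk h2)
  have h := (contDiffWithinAt_iteratedFDerivWithin_param I.uniqueDiffOn (hmem x₀) hφs
    j).continuousWithinAt
  have hc : ContinuousWithinAt (fun p : N × T => (extChartAt I a p.1, e p.2))
      {p | p.1 ∈ (extChartAt I a).source ∧ Ω p.2 p.1 ∈ (extChartAt I b).source} (x₀, t₀) :=
    (((continuousAt_extChartAt' hx₀).comp (x := (x₀, t₀)) continuousAt_fst).prodMk
      (he.continuousAt.comp continuousAt_snd)).continuousWithinAt
  have h' := ContinuousWithinAt.comp (x := (x₀, t₀)) (t := range I ×ˢ univ) h hc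
    (fun p _ => ⟨hmem p.1, mem_univ _⟩)
  refine h'.congr (fun p _ => ?_) ?_ <;>
  · simp only [chartDeriv, Function.comp_def, hφ, hΩ]

lemma continuousOn_chartDeriv (f : C^∞⟮I, N; I, M⟯) (a : N) (b : M) (j : ℕ) :
    ContinuousOn (chartDeriv a b j f)
      {x | x ∈ (extChartAt I a).source ∧ f x ∈ (extChartAt I b).source} := by
  have h := continuousOn_chartDeriv_of_contMDiffAt (T := Unit) (G := fun p : N × ℝ => f p.1)
    (e := fun _ => 0) continuous_const (Ω := fun _ => f)
    (fun x _ => (f.contMDiff x).comp (x, (0 : ℝ)) contMDiffAt_fst) (fun _ _ => rfl) a b j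
  exact h.comp (f := fun x : N => (x, ())) (by fun_prop) fun x hx => hx

omit [IsManifold I ∞ M] [IsManifold I ∞ N] in
lemma isOpen_jetDomain {Ω : T → C^∞⟮I, N; I, M⟯}
    (hΩ : Continuous fun p : N × T => Ω p.2 p.1) (a : N) (b : M) :
    IsOpen {p : N × T | p.1 ∈ (extChartAt I a).source ∧ Ω p.2 p.1 ∈ (extChartAt I b).source} :=
  ((isOpen_extChartAt_source a).preimage continuous_fst).inter
    ((isOpen_extChartAt_source b).preimage hΩ)

/-- A deformation is continuous for the weak topology. -/
theorem IsDeformation.continuous {k : ℕ∞} {S : Set C^∞⟮I, N; I, M⟯} {Ω : T → C^∞⟮I, N; I, M⟯}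
    (h : IsDeformation k S Ω) : Continuous[_, weakTopology k] Ω := by
  refine continuous_generateFrom_iff.2 ?_
  rintro _ ⟨f, a, b, K, j, ε, hK, hKa, hfK, hj, -, rfl⟩
  rw [isOpen_iff_mem_nhds]
  rintro t₀ ⟨ht₀, hε⟩
  have key : ∀ x ∈ K, ∀ᶠ z : T × N in 𝓝 (t₀, x), z.2 ∈ K →
      Ω z.1 z.2 ∈ (extChartAt I b).source ∧
        ‖chartDeriv a b j (Ω z.1) z.2 - chartDeriv a b j f z.2‖ < ε := by
    intro x hx
    have hD := (isOpen_jetDomain h.2.1 a b).mem_nhds (x := (x, t₀)) ⟨hKa hx, ht₀ hx⟩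
    have hswap : Filter.Tendsto (fun z : T × N => (z.2, z.1)) (𝓝 (t₀, x)) (𝓝 (x, t₀)) :=
      (continuous_swap.tendsto (t₀, x))
    have h1 : ContinuousAt (fun p : N × T => chartDeriv a b j (Ω p.2) p.1) (x, t₀) :=
      (h.2.2 a b j hj).continuousAt hD
    have h2 : ContinuousAt (fun p : N × T => chartDeriv a b j f p.1) (x, t₀) := by
      refine ContinuousAt.comp (f := Prod.fst) (g := chartDeriv a b j f) (x := (x, t₀)) ?_
        continuousAt_fst
      refine (continuousOn_chartDeriv f a b j).continuousAt ?_
      exact ((isOpen_extChartAt_source a).inter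
        ((isOpen_extChartAt_source b).preimage f.contMDiff.continuous)).mem_nhds
          ⟨hKa hx, hfK hx⟩
    have h3 := ((h1.sub h2).norm).eventually (gt_mem_nhds (hε x hx))
    filter_upwards [hswap.eventually hD, hswap.eventually h3] with z hz1 hz2 _
    exact ⟨hz1.2, hz2⟩
  -- Compactness of `K` replaces the neighbourhoods of the points `(t₀, x)` by one neighbourhood of
  -- `t₀`.
  have := hK.eventually_forall_of_forall_eventually (P := fun t x => x ∈ K →
      Ω t x ∈ (extChartAt I b).source ∧
        ‖chartDeriv a b j (Ω t) x - chartDeriv a b j f x‖ < ε) key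
  filter_upwards [this] with t ht
  exact ⟨fun x hx => (ht x hx hx).1, fun x hx => (ht x hx hx).2⟩

/-- A continuous path for the weak topology is a deformation. -/
theorem isDeformation_of_continuous [LocallyCompactSpace N] {k : ℕ∞} {S : Set C^∞⟮I, N; I, M⟯}
    {Ω : T → C^∞⟮I, N; I, M⟯} (hS : ∀ t, Ω t ∈ S) (h : Continuous[_, weakTopology k] Ω) :
    IsDeformation k S Ω := by
  have key : ∀ (a : N) (b : M) (j : ℕ), (j : ℕ∞) ≤ k → ∀ (x₀ : N) (t₀ : T),
      x₀ ∈ (extChartAt I a).source → Ω t₀ x₀ ∈ (extChartAt I b).source →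
      (∀ᶠ p in 𝓝 (x₀, t₀), Ω p.2 p.1 ∈ (extChartAt I b).source) ∧
        ContinuousAt (fun p : N × T => chartDeriv a b j (Ω p.2) p.1) (x₀, t₀) := by
    intro a b j hj x₀ t₀ hx₀ hb
    have hD : IsOpen {x | x ∈ (extChartAt I a).source ∧ Ω t₀ x ∈ (extChartAt I b).source} :=
      (isOpen_extChartAt_source a).inter
        ((isOpen_extChartAt_source b).preimage (Ω t₀).contMDiff.continuous)
    -- Weak closeness is uniform on compact sets only, so joint continuity at `x₀` requires a
    -- compact neighbourhood of `x₀`.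
    obtain ⟨K, hK, hKD, hKc⟩ := local_compact_nhds (hD.mem_nhds ⟨hx₀, hb⟩)
    have hev : ∀ ε > 0, ∀ᶠ t in 𝓝 t₀, Ω t ∈ weakNhd (Ω t₀) a b K j ε := by
      intro ε hε
      have hopen : IsOpen (Ω ⁻¹' weakNhd (Ω t₀) a b K j ε) :=
        continuous_generateFrom_iff.1 h _ ⟨Ω t₀, a, b, K, j, ε, hKc, fun x hx => (hKD hx).1,
          fun x hx => (hKD hx).2, hj, hε, rfl⟩
      refine hopen.mem_nhds ⟨fun x hx => (hKD hx).2, fun x _ => ?_⟩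
      rwa [sub_self, norm_zero]
    have hfst : ∀ᶠ p : N × T in 𝓝 (x₀, t₀), p.1 ∈ K := continuousAt_fst.eventually_mem hK
    refine ⟨?_, ?_⟩
    · filter_upwards [hfst, continuousAt_snd.eventually (hev 1 one_pos)] with p hp1 hp2
      exact hp2.1 hp1
    · rw [Metric.continuousAt_iff']
      intro ε hε
      have h1 : ContinuousAt (fun p : N × T => chartDeriv a b j (Ω t₀) p.1) (x₀, t₀) :=
        ContinuousAt.comp (f := Prod.fst) (g := chartDeriv a b j (Ω t₀)) (x := (x₀, t₀))
          ((continuousOn_chartDeriv (Ω t₀) a b j).continuousAt (hD.mem_nhds ⟨hx₀, hb⟩))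
          continuousAt_fst
      filter_upwards [hfst, continuousAt_snd.eventually (hev (ε / 2) (half_pos hε)),
        Metric.continuousAt_iff'.1 h1 (ε / 2) (half_pos hε)] with p hp1 hp2 hp3
      have h2 := hp2.2 p.1 hp1
      rw [← dist_eq_norm] at h2
      linarith [dist_triangle (chartDeriv a b j (Ω p.2) p.1) (chartDeriv a b j (Ω t₀) p.1)
        (chartDeriv a b j (Ω t₀) x₀)]
  refine ⟨hS, continuous_iff_continuousAt.2 ?_, ?_⟩
  · rintro ⟨x₀, t₀⟩
    obtain ⟨h1, h2⟩ := key x₀ (Ω t₀ x₀) 0 (by simp) x₀ t₀ (mem_extChartAt_source x₀)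
      (mem_extChartAt_source _)
    -- Continuity of the values is the case of derivatives of order `0`, which every `k` includes.
    have h3 : ContinuousAt (fun p : N × T => extChartAt I (Ω t₀ x₀) (Ω p.2 p.1)) (x₀, t₀) := by
      have h4 : ContinuousAt (fun p : N × T => chartDeriv x₀ (Ω t₀ x₀) 0 (Ω p.2) p.1
          (fun _ => 0)) (x₀, t₀) :=
        (ContinuousMultilinearMap.apply ℝ (fun _ : Fin 0 => E) E
          (fun _ => 0)).continuous.continuousAt.comp h2
      refine h4.congr ?_
      have h5 : ∀ᶠ p : N × T in 𝓝 (x₀, t₀), p.1 ∈ (extChartAt I x₀).source :=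
        continuousAt_fst.eventually_mem (extChartAt_source_mem_nhds x₀)
      filter_upwards [h5] with p hp
      simp only [chartDeriv, iteratedFDerivWithin_zero_apply, Function.comp_apply,
        (extChartAt I x₀).left_inv hp]
    have h6 := ContinuousAt.comp (g := (extChartAt I (Ω t₀ x₀)).symm) (x := (x₀, t₀))
      (continuousAt_extChartAt_symm (Ω t₀ x₀)) h3
    refine h6.congr ?_
    filter_upwards [h1] with p hp
    exact (extChartAt I (Ω t₀ x₀)).left_inv hp
  · intro a b j hj p hp
    exact (key a b j hj p.1 p.2 hp.1 hp.2).2.continuousWithinAt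

end JetContinuity

/-! ### The inclusion of an open set and the identity, treated together. -/

section ChartEmbedding

variable {E : Type*} [NormedAddCommGroup E] [NormedSpace ℝ E]
  {H : Type*} [TopologicalSpace H] {I : ModelWithCorners ℝ E H}
  {M : Type*} [TopologicalSpace M] [ChartedSpace H M]
  {N : Type*} [TopologicalSpace N] [ChartedSpace H N]
  {P : Type*} [TopologicalSpace P] [ChartedSpace H P]

variable (I) in
/-- An open embedding which respects the preferred charts. -/
structure IsChartEmbedding (i : N → M) : Prop where
  isOpenEmbedding : IsOpenEmbedding i
  extChartAt_apply : ∀ a x, extChartAt I (i a) (i x) = extChartAt I a x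
  source_eq : ∀ a, (extChartAt I a).source = i ⁻¹' (extChartAt I (i a)).source

lemma isChartEmbedding_id : IsChartEmbedding I (id : M → M) :=
  ⟨.id, fun _ _ => rfl, fun _ => rfl⟩

lemma isChartEmbedding_subtypeVal (V : Opens M) : IsChartEmbedding I (Subtype.val : V → M) where
  isOpenEmbedding := V.isOpenEmbedding'
  extChartAt_apply a x := by
    simp only [extChartAt_coe, Function.comp_apply, Opens.chartAt_eq,
      OpenPartialHomeomorph.subtypeRestr_coe]
    rfl
  source_eq a := by
    simp only [extChartAt_source, Opens.chartAt_eq, OpenPartialHomeomorph.subtypeRestr_source]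

namespace IsChartEmbedding

variable {i : N → M} (hi : IsChartEmbedding I i)
include hi

/-- Used to lift the inclusion of an open subset of `M` lying in the range of `i` to a map into `N`.
-/
lemma of_comp {j : P → N} (hij : IsChartEmbedding I (i ∘ j)) : IsChartEmbedding I j where
  isOpenEmbedding := .of_comp _ hi.isOpenEmbedding hij.isOpenEmbedding
  extChartAt_apply a x := by
    rw [← hi.extChartAt_apply]; exact hij.extChartAt_apply a x
  source_eq a := by
    rw [hi.source_eq, hij.source_eq]; rfl

lemma apply_extChartAt_symm {a : N} {u : E} (hu : u ∈ (extChartAt I a).target) :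
    i ((extChartAt I a).symm u) = (extChartAt I (i a)).symm u := by
  have h1 : (extChartAt I a).symm u ∈ (extChartAt I a).source := (extChartAt I a).map_target hu
  have h2 : i ((extChartAt I a).symm u) ∈ (extChartAt I (i a)).source := by
    rw [hi.source_eq] at h1; exact h1
  rw [← (extChartAt I (i a)).left_inv h2, hi.extChartAt_apply, (extChartAt I a).right_inv hu]

variable [IsManifold I ∞ M] [IsManifold I ∞ N]

omit [IsManifold I ∞ M] [IsManifold I ∞ N] in
lemma contMDiff : ContMDiff I I ∞ i := by
  intro x
  refine contMDiffAt_iff.2 ⟨hi.isOpenEmbedding.continuous.continuousAt, ?_⟩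
  refine contDiffWithinAt_id.congr_of_eventuallyEq ?_ ?_
  · filter_upwards [extChartAt_target_mem_nhdsWithin x] with u hu
    simp only [Function.comp_apply, hi.extChartAt_apply, (extChartAt I x).right_inv hu, id]
  · simp only [Function.comp_apply, hi.extChartAt_apply, extChartAt_to_inv, id]

/-- In preferred charts `i` is the identity, so the chart at `i z` followed by the inverse chart at
`z` is a local inverse. -/
lemma isLocalDiffeomorphAt (z : N) : IsLocalDiffeomorphAt I I ∞ i z := by
  have hsrc : ∀ᶠ x in 𝓝 z, x ∈ (extChartAt I z).source := extChartAt_source_mem_nhds z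
  have himg : ∀ᶠ y in 𝓝 (i z), y ∈ i '' (extChartAt I z).source :=
    hi.isOpenEmbedding.isOpenMap.image_mem_nhds hsrc
  refine isLocalDiffeomorphAt_of_inverse
    (g := fun y => (extChartAt I z).symm (extChartAt I (i z) y))
    (Filter.Eventually.of_forall fun x => hi.contMDiff x) ?_ ?_ ?_
  · filter_upwards [himg.eventually_nhds] with y hy
    obtain ⟨x, hx, rfl⟩ := hy.self_of_nhds
    have h1 : ContMDiffAt I 𝓘(ℝ, E) ∞ (extChartAt I (i z)) (i x) := by
      refine contMDiffAt_extChartAt' ?_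
      rw [← extChartAt_source I]
      rw [hi.source_eq] at hx; exact hx
    refine ContMDiffWithinAt.contMDiffAt (s := i '' (extChartAt I z).source) ?_ hy
    refine ContMDiffWithinAt.comp (t := (extChartAt I z).target) (i x)
      (contMDiffOn_extChartAt_symm z _ ?_) h1.contMDiffWithinAt ?_
    · rw [hi.extChartAt_apply]; exact (extChartAt I z).map_source hx
    · rintro _ ⟨x', hx', rfl⟩
      rw [hi.extChartAt_apply]; exact (extChartAt I z).map_source hx'
  · filter_upwards [hsrc] with x hx
    rw [hi.extChartAt_apply, (extChartAt I z).left_inv hx]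
  · filter_upwards [himg] with y hy
    obtain ⟨x, hx, rfl⟩ := hy
    rw [hi.extChartAt_apply, (extChartAt I z).left_inv hx]

omit [IsManifold I ∞ M] [IsManifold I ∞ N] in
-- The representatives of `f` and of `f ∘ i` in preferred charts coincide near the point, hence so
-- do all their derivatives.
lemma chartDeriv_comp {Q : Type*} [TopologicalSpace Q] [ChartedSpace H Q]
    (f : C^∞⟮I, M; I, Q⟯) (g : C^∞⟮I, N; I, Q⟯) (hg : ∀ x, g x = f (i x)) (a : N) (b : Q) (j : ℕ)
    {x : N} (hx : x ∈ (extChartAt I a).source) :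
    chartDeriv a b j g x = chartDeriv (i a) b j f (i x) := by
  simp only [chartDeriv, hi.extChartAt_apply]
  refine Filter.EventuallyEq.iteratedFDerivWithin_eq ?_ ?_ j
  · filter_upwards [extChartAt_target_mem_nhdsWithin' hx] with u hu
    simp only [Function.comp_apply, hg, hi.apply_extChartAt_symm hu]
  · simp only [Function.comp_apply, hg, hi.apply_extChartAt_symm ((extChartAt I a).map_source hx)]

end IsChartEmbedding

lemma isLocalDiffeomorphAt_comp {f : N → M} {j : P → N} {x : P}
    (hf : IsLocalDiffeomorphAt I I ∞ f (j x)) (hj : IsLocalDiffeomorphAt I I ∞ j x) :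
    IsLocalDiffeomorphAt I I ∞ (f ∘ j) x := by
  obtain ⟨Φ, hx, hΦ⟩ := hf
  obtain ⟨Ψ, hx', hΨ⟩ := hj
  refine ⟨Ψ.trans Φ, ⟨hx', ?_⟩, fun y hy => ?_⟩
  · rw [hΨ hx'] at hx; exact hx
  · have h1 : j y = Ψ y := hΨ hy.1
    have h2 : Ψ y ∈ Φ.source := hy.2
    change f (j y) = Φ (Ψ y)
    rw [h1, hΦ h2]

/-- Deformations in the endomorphisms restrict to open subsets. -/
lemma IsDeformation.comp_isChartEmbedding [IsManifold I ∞ N] [IsManifold I ∞ P]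
    {T : Type*} [TopologicalSpace T] {k : ℕ∞} {F : (x : M) → TangentSpace I x}
    {i : C^∞⟮I, N; I, M⟯} {Ω : T → C^∞⟮I, N; I, M⟯} (h : IsDeformation k (endomorphisms F i) Ω)
    {j : C^∞⟮I, P; I, N⟯} (hj : IsChartEmbedding I j) :
    IsDeformation k (endomorphisms F (i.comp j)) fun t => (Ω t).comp j := by
  refine ⟨fun t => ⟨fun y x hx => (h.1 t).1 y hx, fun z hz => ?_⟩, ?_, fun a b m hm => ?_⟩
  · change IsLocalDiffeomorphAt I I ∞ (Ω t ∘ j) z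
    exact isLocalDiffeomorphAt_comp ((h.1 t).2 (j z) hz) (hj.isLocalDiffeomorphAt z)
  · exact h.2.1.comp ((j.contMDiff.continuous.comp continuous_fst).prodMk continuous_snd)
  · have h1 : ContinuousOn (fun p : P × T => chartDeriv (j a) b m (Ω p.2) (j p.1))
        {p | p.1 ∈ (extChartAt I a).source ∧ (Ω p.2).comp j p.1 ∈ (extChartAt I b).source} :=
      (h.2.2 (j a) b m hm).comp (f := fun p : P × T => (j p.1, p.2))
        ((j.contMDiff.continuous.comp continuous_fst).prodMk continuous_snd).continuousOn
        fun p hp => ⟨by have := hp.1; rw [hj.source_eq] at this; exact this, hp.2⟩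
    exact h1.congr fun p hp => hj.chartDeriv_comp (Ω p.2) _ (fun _ => rfl) a b m hp.1

end ChartEmbedding

/-! ### Lifting paths in regular orbits to the time axis. -/

section Lifting

variable {E : Type*} [NormedAddCommGroup E] [NormedSpace ℝ E] [CompleteSpace E]
  {H : Type*} [TopologicalSpace H] {I : ModelWithCorners ℝ E H} {ℓ : E →L[ℝ] ℝ}
  {M : Type*} [TopologicalSpace M] [ChartedSpace H M] [IsManifold I ∞ M] [T2Space M]
  {F : (x : M) → TangentSpace I x}

omit [CompleteSpace E] [T2Space M] in
-- The raw vectors `F y` refer to charts that change with `y`. In the fixed chart at `y₀` the field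
-- is continuous, and zeros remain zeros because coordinate changes are linear.
lemma isOpen_compl_singularSet (hF : IsSmoothTangent I ℓ F) : IsOpen (singularSet F)ᶜ := by
  rw [isOpen_iff_mem_nhds]
  intro y₀ hy₀
  have hmem : ∀ y, extChartAt I y₀ y ∈ halfSpace ℓ := fun y => by
    rw [← hF.range_eq, extChartAt_coe]; exact mem_range_self _
  have h1 : ContinuousAt (fun y => chartField F y₀ (extChartAt I y₀ y)) y₀ := by
    rw [← continuousWithinAt_univ]
    exact (chartField_contDiffWithinAt hF y₀ (mem_extChartAt_target y₀)).continuousWithinAt.comp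
      (continuousAt_extChartAt y₀).continuousWithinAt fun y _ => hmem y
  have h2 : chartField F y₀ (extChartAt I y₀ y₀) = fieldVec F y₀ := by
    rw [chartField, extChartAt_to_inv]
    exact tangentCoordChange_self (mem_extChartAt_source y₀)
  have h3 : chartField F y₀ (extChartAt I y₀ y₀) ≠ 0 := by rw [h2]; exact hy₀
  filter_upwards [h1.eventually_ne h3, extChartAt_source_mem_nhds (I := I) y₀] with y hy hys hy0
  refine hy ?_
  have h4 : fieldVec F y = 0 := hy0
  rw [chartField, (extChartAt I y₀).left_inv hys, h4, map_zero]

/-- The return times to a regular point are isolated. -/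
lemma eventually_return_eq_zero (hF : IsSmoothTangent I ℓ F) {w : M} (hw : w ∉ singularSet F) :
    ∀ᶠ d : ℝ in 𝓝 0, FlowsTo F w d w → d = 0 := by
  obtain ⟨τ, -, hτ⟩ := exists_transverse_function hw
  have h0 := flowsTo_zero hF w
  obtain ⟨c, hc, hd⟩ := hτ _ 0 (isMIntegralCurveAt_flow hF h0.mem_flowDomain) (h0.flow_eq hF)
  have h1 := eventually_nhdsWithin_iff.1 (hd.eventually_ne (c := τ w) hc)
  filter_upwards [h1] with d hd' hflow
  by_contra hne
  exact hd' hne (by rw [Function.comp_apply, hflow.flow_eq hF])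

/-- Two continuous lifts of a path in a regular orbit agree if they agree at one time. -/
lemma lift_unique (hF : IsSmoothTangent I ℓ F) {w : M} (hw : w ∉ singularSet F) {s : Set ℝ}
    (hs : IsPreconnected s) {c : ℝ → M} {f g : ℝ → ℝ} (hf : ContinuousOn f s)
    (hg : ContinuousOn g s) (hfc : ∀ t ∈ s, FlowsTo F w (f t) (c t))
    (hgc : ∀ t ∈ s, FlowsTo F w (g t) (c t)) {t₀ t : ℝ} (ht₀ : t₀ ∈ s) (ht : t ∈ s)
    (h : f t₀ = g t₀) : f t = g t := by
  refine (iff_of_eventually_iff hs (fun t => f t = g t) (fun r hr => ?_) ht₀ ht).1 h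
  -- The difference of two lifts is a continuous function with values in the return times of `w`,
  -- and `0` is isolated among these.
  have hd : ContinuousWithinAt (fun r => f r - g r) s r := (hf r hr).sub (hg r hr)
  by_cases hr0 : f r = g r
  · have hd0 : Filter.Tendsto (fun r => f r - g r) (𝓝[s] r) (𝓝 0) := by
      have h := hd.tendsto
      rwa [hr0, sub_self] at h
    filter_upwards [hd0.eventually (eventually_return_eq_zero hF hw), self_mem_nhdsWithin]
      with r' hr' hr's
    have := hr' ((hfc r' hr's).trans hF (hgc r' hr's).symm)
    simp only [hr0, sub_eq_zero.1 this]
  · filter_upwards [hd.eventually_ne (sub_ne_zero.2 hr0)] with r' hr'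
    exact iff_of_false hr0 (sub_ne_zero.1 hr')

/-- Near every time of a continuous family of paths of regular points, differences of lifts are
given by a continuous function. -/
lemma exists_local_time [MetrizableSpace M] (hF : IsSmoothTangent I ℓ F)
    {N : Type*} [TopologicalSpace N] {c : N × ℝ → M} (hc : Continuous c) {x₀ : N} {t₀ : ℝ}
    (h0 : c (x₀, t₀) ∉ singularSet F) : ∃ A ∈ 𝓝 x₀, ∃ (δ : ℝ) (g : N × ℝ → ℝ), 0 < δ ∧
      ContinuousOn g (A ×ˢ Ioo (t₀ - δ) (t₀ + δ)) ∧
      ∀ x ∈ A, ∀ w, (∀ t, c (x, t) ∈ orbit F w) →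
        ∀ t ∈ Ioo (t₀ - δ) (t₀ + δ), ∀ t' ∈ Ioo (t₀ - δ) (t₀ + δ),
          FlowsTo F (c (x, t)) (g (x, t') - g (x, t)) (c (x, t')) := by
  obtain ⟨B, σ, hB, hyB, hσ, hσc⟩ := exists_time_function hF h0
  obtain ⟨A, hA, A', hA', hAA⟩ := mem_nhds_prod_iff.1 ((hB.preimage hc).mem_nhds hyB)
  obtain ⟨δ, hδ, hball⟩ := Metric.mem_nhds_iff.1 hA'
  rw [Real.ball_eq_Ioo] at hball
  have hmem : ∀ x ∈ A, ∀ t ∈ Ioo (t₀ - δ) (t₀ + δ), c (x, t) ∈ B := fun x hx t ht =>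
    hAA ⟨hx, hball ht⟩
  refine ⟨A, hA, δ, fun p => σ (c p), hδ, hσ.comp hc.continuousOn
    fun p hp => hmem p.1 hp.1 p.2 hp.2, fun x hx w hw => ?_⟩
  exact hσc (Ioo (t₀ - δ) (t₀ + δ)) (fun t => c (x, t)) w isPreconnected_Ioo
    (hc.comp (by fun_prop)).continuousOn (fun t ht => hmem x hx t ht) fun t _ => hw t

/-- Paths in a regular orbit lift to the time axis. -/
lemma exists_lift [MetrizableSpace M] (hF : IsSmoothTangent I ℓ F) {c : ℝ → M} (hc : Continuous c)
    (h0 : c 0 ∉ singularSet F) (horb : ∀ t, c t ∈ orbit F (c 0)) :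
    ∃ f : ℝ → ℝ, ContinuousOn f (Icc 0 1) ∧ f 0 = 0 ∧
      ∀ t ∈ Icc (0 : ℝ) 1, FlowsTo F (c 0) (f t) (c t) := by
  set P : ℝ → Prop := fun a => ∃ f : ℝ → ℝ, ContinuousOn f (Icc 0 a) ∧ f 0 = 0 ∧
      ∀ t ∈ Icc (0 : ℝ) a, FlowsTo F (c 0) (f t) (c t) with hP
  have hreg : ∀ t, c t ∉ singularSet F := fun t => by
    obtain ⟨s, hs⟩ := horb t
    rwa [hs.singular_iff hF]
  have hext : ∀ a₀ ∈ Icc (0 : ℝ) 1, ∃ δ > 0, ∀ a ∈ Ioo (a₀ - δ) (a₀ + δ),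
      ∀ a' ∈ Ioo (a₀ - δ) (a₀ + δ), 0 ≤ a → P a → P a' := by
    intro a₀ _
    obtain ⟨A, hA, δ, g, hδ, hg, hgc⟩ := exists_local_time hF (N := Unit)
      (c := fun p => c p.2) (hc.comp continuous_snd) (x₀ := ()) (hreg a₀)
    have hunit : () ∈ A := mem_of_mem_nhds hA
    refine ⟨δ, hδ, fun a ha a' ha' ha0 ⟨f, hf, hf0, hfc⟩ => ?_⟩
    have hmax : ∀ t ≤ a', max t a ∈ Ioo (a₀ - δ) (a₀ + δ) := fun t ht =>
      ⟨lt_max_of_lt_right ha.1, max_lt (ht.trans_lt ha'.2) ha.2⟩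
    have hmin : ∀ t, 0 ≤ t → min t a ∈ Icc 0 a := fun t ht =>
      ⟨le_min ht ha0, min_le_right _ _⟩
    -- Up to time `a` this is `f`; afterwards local time is added. For `a' ≤ a` it is the
    -- restriction of `f`, so one formula serves both directions.
    refine ⟨fun t => f (min t a) + (g ((), max t a) - g ((), a)), ?_, ?_, fun t ht => ?_⟩
    · refine ContinuousOn.add ?_ (ContinuousOn.sub ?_ continuousOn_const)
      · exact hf.comp (by fun_prop) fun t ht => hmin t ht.1
      · exact hg.comp (f := fun t : ℝ => ((), max t a)) (by fun_prop)
          fun t ht => ⟨hunit, hmax t ht.2⟩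
    · simp [ha0, hf0]
    · have h1 := hfc _ (hmin t ht.1)
      have h2 := hgc () hunit (c 0) horb a ha _ (hmax t ht.2)
      simp only at h2
      rcases le_total t a with hta | hta
      · simpa [hta] using h1
      · simp only [min_eq_right hta, max_eq_left hta] at h1 h2 ⊢
        exact h1.trans hF h2
  have h00 : P 0 := ⟨fun _ => 0, continuousOn_const, rfl, fun t ht => by
    rw [Icc_self, mem_singleton_iff] at ht
    rw [ht]; exact flowsTo_zero hF _⟩
  refine (iff_of_eventually_iff isPreconnected_Icc P (fun a₀ ha₀ => ?_)
    (left_mem_Icc.2 zero_le_one) (right_mem_Icc.2 zero_le_one)).1 h00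
  obtain ⟨δ, hδ, h⟩ := hext a₀ ha₀
  have ha₀' : a₀ ∈ Ioo (a₀ - δ) (a₀ + δ) := ⟨by linarith, by linarith⟩
  filter_upwards [self_mem_nhdsWithin, nhdsWithin_le_nhds (isOpen_Ioo.mem_nhds ha₀')] with a ha ha'
  exact ⟨h a₀ ha₀' a ha' ha₀.1, h a ha' a₀ ha₀' ha.1⟩

/-- A family of lifts, starting at time zero, of a continuous family of paths in regular orbits is
jointly continuous. -/
lemma continuousOn_lift [MetrizableSpace M] (hF : IsSmoothTangent I ℓ F)
    {N : Type*} [TopologicalSpace N] {c : N × ℝ → M} (hc : Continuous c) {R : Set N}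
    (hR : IsOpen R) (hreg : ∀ x ∈ R, c (x, 0) ∉ singularSet F)
    (horb : ∀ x ∈ R, ∀ t, c (x, t) ∈ orbit F (c (x, 0))) {Λ : N × ℝ → ℝ}
    (hΛ : ∀ x ∈ R, ContinuousOn (fun t => Λ (x, t)) (Icc 0 1)) (hΛ0 : ∀ x ∈ R, Λ (x, 0) = 0)
    (hΛc : ∀ x ∈ R, ∀ t ∈ Icc (0 : ℝ) 1, FlowsTo F (c (x, 0)) (Λ (x, t)) (c (x, t))) :
    ContinuousOn Λ (R ×ˢ Icc 0 1) := by
  have hlocal : ∀ x₀ ∈ R, ∀ t₀ ∈ Icc (0 : ℝ) 1, ∃ A ∈ 𝓝 x₀, ∃ (δ : ℝ) (g : N × ℝ → ℝ), 0 < δ ∧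
      ContinuousOn g (A ×ˢ Ioo (t₀ - δ) (t₀ + δ)) ∧ A ⊆ R ∧
      ∀ x ∈ A, ∀ t ∈ Ioo (t₀ - δ) (t₀ + δ) ∩ Icc 0 1, ∀ t' ∈ Ioo (t₀ - δ) (t₀ + δ) ∩ Icc 0 1,
        Λ (x, t') = Λ (x, t) + (g (x, t') - g (x, t)) := by
    intro x₀ hx₀ t₀ ht₀
    have hregt : c (x₀, t₀) ∉ singularSet F := by
      rw [(hΛc x₀ hx₀ t₀ ht₀).singular_iff hF]; exact hreg x₀ hx₀
    obtain ⟨A, hA, δ, g, hδ, hg, hgc⟩ := exists_local_time hF hc hregt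
    refine ⟨A ∩ R, Filter.inter_mem hA (hR.mem_nhds hx₀), δ, g, hδ,
      hg.mono (prod_mono_left inter_subset_left), inter_subset_right, ?_⟩
    intro x hx t ht t' ht'
    have hgx : ContinuousOn (fun r => g (x, r)) (Ioo (t₀ - δ) (t₀ + δ)) :=
      hg.comp (by fun_prop) fun r hr => ⟨hx.1, hr⟩
    have hpre : IsPreconnected (Ioo (t₀ - δ) (t₀ + δ) ∩ Icc 0 1) :=
      (ordConnected_Ioo.inter ordConnected_Icc).isPreconnected
    refine lift_unique hF (hreg x hx.2) (c := fun r => c (x, r)) (f := fun r => Λ (x, r))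
      (g := fun r => Λ (x, t) + (g (x, r) - g (x, t))) hpre
      ((hΛ x hx.2).mono inter_subset_right)
      (continuousOn_const.add ((hgx.mono inter_subset_left).sub continuousOn_const))
      (fun r hr => hΛc x hx.2 r hr.2) (fun r hr => ?_) ht ht' (by simp)
    exact (hΛc x hx.2 t ht.2).trans hF (hgc x hx.1 _ (horb x hx.2) t ht.1 r hr.1)
  -- Near each time the lifts change by increments of a jointly continuous `g`, so continuity in `x`
  -- passes between nearby times. It holds at time zero, where `Λ` vanishes.
  have hslice : ∀ x₀ ∈ R, ∀ t₀ ∈ Icc (0 : ℝ) 1, ContinuousAt (fun x => Λ (x, t₀)) x₀ := by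
    intro x₀ hx₀ t₀ ht₀
    refine (iff_of_eventually_iff isPreconnected_Icc
      (fun t => ContinuousAt (fun x => Λ (x, t)) x₀) (fun t ht => ?_)
      (left_mem_Icc.2 zero_le_one) ht₀).1 ?_
    · obtain ⟨A, hA, δ, g, hδ, hg, -, hloc⟩ := hlocal x₀ hx₀ t ht
      have hxA := mem_of_mem_nhds hA
      have htδ : t ∈ Ioo (t - δ) (t + δ) := ⟨by linarith, by linarith⟩
      have hslice : ∀ r ∈ Ioo (t - δ) (t + δ), ContinuousAt (fun x => g (x, r)) x₀ := fun r hr =>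
        (hg.continuousAt (prod_mem_nhds hA (isOpen_Ioo.mem_nhds hr))).comp
          (f := fun x => (x, r)) (x := x₀) (by fun_prop)
      have himp : ∀ r ∈ Ioo (t - δ) (t + δ) ∩ Icc 0 1, ∀ r' ∈ Ioo (t - δ) (t + δ) ∩ Icc 0 1,
          ContinuousAt (fun x => Λ (x, r)) x₀ → ContinuousAt (fun x => Λ (x, r')) x₀ := by
        intro r hr r' hr' h
        refine (h.add ((hslice r' hr'.1).sub (hslice r hr.1))).congr ?_
        filter_upwards [hA] with x hx using (hloc x hx r hr r' hr').symm
      filter_upwards [self_mem_nhdsWithin, nhdsWithin_le_nhds (isOpen_Ioo.mem_nhds htδ)]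
        with r hr hr'
      exact ⟨himp t ⟨htδ, ht⟩ r ⟨hr', hr⟩, himp r ⟨hr', hr⟩ t ⟨htδ, ht⟩⟩
    · refine (continuousAt_const (y := (0 : ℝ))).congr ?_
      filter_upwards [hR.mem_nhds hx₀] with x hx using (hΛ0 x hx).symm
  rintro ⟨x₀, t₀⟩ ⟨hx₀, ht₀⟩
  obtain ⟨A, hA, δ, g, hδ, hg, hAR, hloc⟩ := hlocal x₀ hx₀ t₀ ht₀
  have htδ : t₀ ∈ Ioo (t₀ - δ) (t₀ + δ) := ⟨by linarith, by linarith⟩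
  have hbox : A ×ˢ Ioo (t₀ - δ) (t₀ + δ) ∈ 𝓝 (x₀, t₀) :=
    prod_mem_nhds hA (isOpen_Ioo.mem_nhds htδ)
  have h1 : ContinuousAt g (x₀, t₀) := hg.continuousAt hbox
  have h2 : ContinuousAt (fun p : N × ℝ => Λ (p.1, t₀)) (x₀, t₀) :=
    ContinuousAt.comp (f := Prod.fst) (x := (x₀, t₀)) (hslice x₀ hx₀ t₀ ht₀) continuousAt_fst
  have h3 : ContinuousAt (fun p : N × ℝ => g (p.1, t₀)) (x₀, t₀) :=
    ContinuousAt.comp (f := fun p : N × ℝ => (p.1, t₀)) (x := (x₀, t₀)) h1 (by fun_prop)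
  refine (h2.add (h1.sub h3)).continuousWithinAt.congr_of_eventuallyEq ?_ (by simp)
  filter_upwards [self_mem_nhdsWithin, nhdsWithin_le_nhds hbox] with p hp hp'
  exact hloc p.1 hp'.1 t₀ ⟨htδ, ht₀⟩ p.2 ⟨hp'.2, hp.2⟩

/-- A shift function which is continuous at a regular point is smooth there. -/
lemma contMDiffAt_of_flowsTo {N : Type*} [TopologicalSpace N] [ChartedSpace H N]
    [IsManifold I ∞ N] (hF : IsSmoothTangent I ℓ F) {i h : N → M} (hi : ContMDiff I I ∞ i)
    (hh : ContMDiff I I ∞ h) {f : N → ℝ} {x₀ : N} (hx₀ : i x₀ ∉ singularSet F)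
    (hf : ContinuousAt f x₀) (hfl : ∀ᶠ x in 𝓝 x₀, FlowsTo F (i x) (f x) (h x)) :
    ContMDiffAt I 𝓘(ℝ, ℝ) ∞ f x₀ := by
  have h0 := hfl.self_of_nhds
  have hreg : h x₀ ∉ singularSet F := by rwa [h0.singular_iff hF]
  obtain ⟨τ, hτ, hτγ⟩ := exists_transverse_function hreg
  have hflow0 : flow F (i x₀, f x₀) = h x₀ := h0.flow_eq hF
  obtain ⟨c, hc0, hc⟩ := hτγ _ _ (isMIntegralCurveAt_flow hF h0.mem_flowDomain) hflow0
  have hpair : ContMDiff (I.prod 𝓘(ℝ, ℝ)) (I.prod 𝓘(ℝ, ℝ)) ∞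
      (fun p : N × ℝ => (i p.1, p.2)) := (hi.comp contMDiff_fst).prodMk contMDiff_snd
  have hflowat : ∀ p : N × ℝ, (i p.1, p.2) ∈ flowDomain F →
      ContMDiffAt (I.prod 𝓘(ℝ, ℝ)) I ∞ (fun p : N × ℝ => flow F (i p.1, p.2)) p := fun p hp =>
    ContMDiffAt.comp p (g := flow F) (flow_smooth hF hp).2 hpair.contMDiffAt
  -- The time `s = f x` solves `τ (Φ (i x, s)) = τ (h x)`. This equation has only one solution near
  -- `f x₀`, and that one is smooth; continuity of `f` ensures that `f x` is it.
  obtain ⟨O, ε, μ, hO, hxO, hε, hμ0, hμ, hμO⟩ := exists_implicit_manifold hF.range_eq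
    (G := fun p : N × ℝ => τ (flow F (i p.1, p.2)) - τ (h p.1)) (x₀ := x₀) (s₀ := f x₀) (c := c) (by
      have h1 : ∀ᶠ p in 𝓝 (x₀, f x₀), (i p.1, p.2) ∈ flowDomain F :=
        hpair.continuous.continuousAt.eventually_mem
          ((isOpen_flowDomain hF).mem_nhds h0.mem_flowDomain)
      have h2 : ∀ᶠ p in 𝓝 (x₀, f x₀), ContMDiffAt I 𝓘(ℝ, ℝ) ∞ τ (flow F (i p.1, p.2)) :=
        (hflowat (x₀, f x₀) h0.mem_flowDomain).continuousAt.eventually (by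
          simp only [hflow0]; exact hτ)
      have h3 : ∀ᶠ p : N × ℝ in 𝓝 (x₀, f x₀), ContMDiffAt I 𝓘(ℝ, ℝ) ∞ τ (h p.1) :=
        (hh.continuous.comp continuous_fst).continuousAt.eventually hτ
      filter_upwards [h1, h2, h3] with p hp1 hp2 hp3
      exact (ContMDiffAt.comp p hp2 (hflowat p hp1)).sub
        (ContMDiffAt.comp p hp3 (hh.comp contMDiff_fst).contMDiffAt)) (hc.sub_const (τ (h x₀))) hc0
  refine (hμ x₀ hxO).congr_of_eventuallyEq ?_
  have hclose : ∀ᶠ x in 𝓝 x₀, |f x - f x₀| < ε :=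
    (hf.sub continuousAt_const).abs.eventually (gt_mem_nhds (by simpa using hε))
  filter_upwards [hclose, hfl, hO.mem_nhds hxO] with x hx1 hx2 hx3
  refine ((hμO x hx3).2 (f x) hx1).1 ?_
  simp only [hx2.flow_eq hF, hflow0, sub_self]

end Lifting

/-! ### The two inclusions. -/

section Main

variable {E : Type*} [NormedAddCommGroup E] [NormedSpace ℝ E]
  {H : Type*} [TopologicalSpace H] {I : ModelWithCorners ℝ E H} {ℓ : E →L[ℝ] ℝ}
  {M : Type*} [TopologicalSpace M] [ChartedSpace H M]
  {N : Type*} [TopologicalSpace N] [ChartedSpace H N]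
  {F : (x : M) → TangentSpace I x} {k : ℕ∞} {i : C^∞⟮I, N; I, M⟯}

variable (M) in
-- A convex set is locally path connected, and `H` is homeomorphic to the range of `I`. This
-- provides the connected neighbourhoods that `HasES01` asks for.
lemma locallyConnectedSpace_of_range_eq (hI : range I = halfSpace ℓ) :
    LocallyConnectedSpace M := by
  have h1 : LocallyPathConnectedSpace (range I) := by
    rw [hI]; exact (convex_halfSpace ℓ).locallyPathConnectedSpace
  have h2 : LocallyConnectedSpace H :=
    I.isClosedEmbedding.isEmbedding.toHomeomorph.locallyConnectedSpace
  exact ChartedSpace.locallyConnectedSpace H M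

/-- A function which is smooth at regular points and extends smoothly near singular points
extends globally. -/
lemma exists_contMDiff_extension {R : Set N} (hR : IsOpen R) (hd : Dense R) {f : N → ℝ}
    (hf : ∀ x ∈ R, ContMDiffAt I 𝓘(ℝ, ℝ) ∞ f x)
    (hext : ∀ z ∉ R, ∃ (W : Set N) (β : N → ℝ), IsOpen W ∧ z ∈ W ∧
      ContMDiffOn I 𝓘(ℝ, ℝ) ∞ β W ∧ ∀ x ∈ W ∩ R, β x = f x) :
    ∃ α : C^∞⟮I, N; ℝ⟯, ∀ x ∈ R, α x = f x := by
  classical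
  choose! W β hW hzW hβ hβf using hext
  -- Each point off `R` uses its own extension. Two extensions agree on the overlap of their
  -- domains, since they agree on its dense part in `R` and are continuous.
  set α : N → ℝ := fun x => if x ∈ R then f x else β x x with hα
  have hαR : ∀ x ∈ R, α x = f x := fun x hx => if_pos hx
  refine ⟨⟨α, fun z => ?_⟩, hαR⟩
  by_cases hz : z ∈ R
  · exact (hf z hz).congr_of_eventuallyEq (Filter.eventuallyEq_of_mem (hR.mem_nhds hz) hαR)
  · refine ((hβ z hz).contMDiffAt ((hW z hz).mem_nhds (hzW z hz))).congr_of_eventuallyEq ?_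
    filter_upwards [(hW z hz).mem_nhds (hzW z hz)] with x hx
    by_cases hxR : x ∈ R
    · rw [hαR x hxR, hβf z hz x ⟨hx, hxR⟩]
    · rw [hα]
      simp only [if_neg hxR]
      have hO : IsOpen (W x ∩ W z) := (hW x hxR).inter (hW z hz)
      have hsub : W x ∩ W z ⊆ closure (W x ∩ W z ∩ R) :=
        hd.open_subset_closure_inter hO
      have hEq : EqOn (β x) (β z) (W x ∩ W z ∩ R) := fun y hy => by
        rw [hβf x hxR y ⟨hy.1.1, hy.2⟩, hβf z hz y ⟨hy.1.2, hy.2⟩]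
      exact hEq.of_subset_closure ((hβ x hxR).continuousOn.mono inter_subset_left)
        ((hβ z hz).continuousOn.mono inter_subset_right) inter_subset_left hsub
        ⟨hzW x hxR, hx⟩

variable [IsManifold I ∞ M] [IsManifold I ∞ N] [T2Space M] [CompleteSpace E]

/-- Shift maps are joined to the inclusion by the shift maps of the multiples of a shift
function. -/
theorem shiftImage_subset_identityComponent (hF : IsSmoothTangent I ℓ F)
    (hi : IsChartEmbedding I i) : shiftImage F i ⊆ identityComponent F k i := by
  rintro h ⟨α, hα⟩
  have hdom : ∀ (x : N) (t : unitInterval), (i x, (t : ℝ) * α x) ∈ flowDomain F := by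
    intro x t
    -- `t * α x` lies between `0` and `α x`, and the times for which the flow of a point is defined
    -- fill the interval between.
    refine (hα x).of_mem_uIcc ?_
    rcases le_total 0 (α x) with h0 | h0
    · rw [uIcc_of_le h0]
      exact ⟨mul_nonneg t.2.1 h0, mul_le_of_le_one_left h0 t.2.2⟩
    · rw [uIcc_of_ge h0]
      exact ⟨by nlinarith [t.2.2], mul_nonpos_of_nonneg_of_nonpos t.2.1 h0⟩
  set G : N × ℝ → M := fun p => flow F (i p.1, p.2 * α p.1) with hG
  have harg : ContMDiff (I.prod 𝓘(ℝ, ℝ)) (I.prod 𝓘(ℝ, ℝ)) ∞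
      (fun p : N × ℝ => (i p.1, p.2 * α p.1)) :=
    (i.contMDiff.comp contMDiff_fst).prodMk
      (contMDiff_snd.mul (α.contMDiff.comp contMDiff_fst))
  have hGs : ∀ (x : N) (t : unitInterval), ContMDiffAt (I.prod 𝓘(ℝ, ℝ)) I ∞ G (x, (t : ℝ)) :=
    fun x t => ContMDiffAt.comp (x, (t : ℝ)) (g := flow F) (flow_smooth hF (hdom x t)).2
      harg.contMDiffAt
  set Ω : unitInterval → C^∞⟮I, N; I, M⟯ := fun t => ⟨fun x => G (x, t), fun x =>
    ContMDiffAt.comp (f := fun x : N => (x, (t : ℝ))) x (hGs x t)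
      (contMDiffAt_id.prodMk contMDiffAt_const)⟩ with hΩ
  have hflow : ∀ (t : unitInterval) (x : N), FlowsTo F (i x) (t * α x) (Ω t x) := fun t x =>
    flow_spec (hdom x t)
  have hΩd : IsDeformation k (endomorphisms F i) Ω := by
    refine ⟨fun t => ⟨?_, fun z hz => ?_⟩, ?_, fun a b j _ =>
      continuousOn_chartDeriv_of_contMDiffAt continuous_subtype_val hGs (fun _ _ => rfl) a b j⟩
    · rintro y x ⟨s, hs⟩
      exact ⟨s + t * α x, hs.trans hF (hflow t x)⟩
    · exact isLocalDiffeomorphAt_shift hF (hi.isLocalDiffeomorphAt z)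
        (contMDiff_const.mul α.contMDiff) (Ω t).contMDiff (hflow t) hz
    · refine continuous_iff_continuousAt.2 fun p => ?_
      exact ContinuousAt.comp (f := fun p : N × unitInterval => (p.1, (p.2 : ℝ))) (x := p)
        (hGs p.1 p.2).continuousAt (by fun_prop)
  let _ := weakTopology (I := I) (N := N) (M := M) k
  refine ⟨⟨⟨Ω, hΩd.continuous⟩, ?_, ?_⟩, hΩd.1⟩
  · ext x
    have h1 := hflow 0 x
    simp only [Icc.coe_zero, zero_mul] at h1
    exact h1.unique hF (flowsTo_zero hF _)
  · ext x
    have h1 := hflow 1 x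
    simp only [Icc.coe_one, one_mul] at h1
    exact h1.unique hF (hα x)

/-- If the regular points are dense and shift functions extend over singular points, every
endomorphism in the path component of the inclusion is a shift map. -/
theorem identityComponent_subset_shiftImage [MetrizableSpace M] [LocallyCompactSpace N]
    [LocallyConnectedSpace M] (hF : IsSmoothTangent I ℓ F) (hi : IsChartEmbedding I i)
    (hd : Dense (i ⁻¹' singularSet F)ᶜ) (hES : ∀ z, i z ∈ singularSet F → HasES01 F k (i z)) :
    identityComponent F k i ⊆ shiftImage F i := by
  intro h hh
  obtain ⟨Ω, hΩ, hΩ0, hΩ1⟩ : ∃ Ω : unitInterval → C^∞⟮I, N; I, M⟯,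
      IsDeformation k (endomorphisms F i) Ω ∧ Ω 0 = i ∧ Ω 1 = h := by
    let _ := weakTopology (I := I) (N := N) (M := M) k
    obtain ⟨γ, hγ⟩ := hh
    exact ⟨γ, isDeformation_of_continuous hγ γ.continuous, γ.source, γ.target⟩
  -- The homotopy is held constant outside `[0, 1]`, so that the lifting results for real times
  -- apply.
  set c : N × ℝ → M := fun p => Ω (projIcc 0 1 zero_le_one p.2) p.1 with hc
  have hcc : Continuous c :=
    hΩ.2.1.comp (continuous_fst.prodMk ((continuous_projIcc (h := zero_le_one)).comp continuous_snd))
  have hct : ∀ (x : N) (t : unitInterval), c (x, t) = Ω t x := fun x t => by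
    simp only [hc, projIcc_val]
  have hc0 : ∀ x, c (x, 0) = i x := fun x => by
    rw [← hΩ0]; exact hct x 0
  have hc1 : ∀ x, c (x, 1) = h x := fun x => by
    rw [← hΩ1]; exact hct x 1
  have horb : ∀ x t, c (x, t) ∈ orbit F (c (x, 0)) := fun x t => by
    rw [hc0]
    exact (hΩ.1 _).1 (i x) ⟨0, flowsTo_zero hF (i x)⟩
  set R : Set N := (i ⁻¹' singularSet F)ᶜ with hR
  have hRo : IsOpen R := (isOpen_compl_singularSet hF).preimage i.contMDiff.continuous
  have hreg : ∀ x ∈ R, c (x, 0) ∉ singularSet F := fun x hx => by rw [hc0]; exact hx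
  choose! f hfc hf0 hfl using fun x (hx : x ∈ R) =>
    exists_lift hF (c := fun t => c (x, t)) (hcc.comp (by fun_prop)) (hreg x hx) (horb x)
  have hfcont : ContinuousOn (fun p : N × ℝ => f p.1 p.2) (R ×ˢ Icc 0 1) :=
    continuousOn_lift hF hcc hRo hreg (fun x _ => horb x) hfc hf0 hfl
  simp only [hc0] at hfl
  have h1mem : (1 : ℝ) ∈ Icc (0 : ℝ) 1 := right_mem_Icc.2 zero_le_one
  have hsmooth : ∀ x ∈ R, ContMDiffAt I 𝓘(ℝ, ℝ) ∞ (fun x => f x 1) x := by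
    intro x hx
    refine contMDiffAt_of_flowsTo hF i.contMDiff h.contMDiff hx ?_ ?_
    · have h1 : ContinuousOn (fun x => f x 1) R :=
        hfcont.comp (f := fun x : N => (x, (1 : ℝ))) (by fun_prop) fun y hy => ⟨hy, h1mem⟩
      exact h1.continuousAt (hRo.mem_nhds hx)
    · filter_upwards [hRo.mem_nhds hx] with y hy
      rw [← hc1]; exact hfl y hy 1 h1mem
  obtain ⟨α, hα⟩ := exists_contMDiff_extension (I := I) hRo hd hsmooth (by
    intro z hz
    have hzs : i z ∈ singularSet F := not_not.1 hz
    -- The extension property concerns connected open subsets of `M`, so the homotopy is restricted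
    -- to one inside the range of `i`.
    obtain ⟨U₀, hU₀, hUo, hzU, hUc⟩ :=
      locallyConnectedSpace_iff_subsets_isOpen_isConnected.1 inferInstance (i z) (range i)
        (hi.isOpenEmbedding.isOpen_range.mem_nhds (mem_range_self z))
    set U : Opens M := ⟨U₀, hUo⟩ with hU
    choose j₀ hj₀ using fun u : U => hU₀ u.2
    have hjemb : IsChartEmbedding I j₀ := hi.of_comp (by
      rw [show i ∘ j₀ = Subtype.val from funext hj₀]; exact isChartEmbedding_subtypeVal U)
    set j : C^∞⟮I, U; I, N⟯ := ⟨j₀, hjemb.contMDiff⟩ with hj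
    have hij : i.comp j = incl I U := ContMDiffMap.ext hj₀
    have hΩU := hΩ.comp_isChartEmbedding (j := j) hjemb
    rw [hij] at hΩU
    have hjR : ∀ u : U, (u : M) ∉ singularSet F → j u ∈ R := fun u hu => by
      change ¬ (i (j₀ u) ∈ singularSet F)
      rwa [hj₀]
    -- At `t₀ = 0` the homotopy is the inclusion, with shift function `0`; the lifts start at `0`,
    -- as the property demands.
    obtain ⟨W, hzW, hWU, hW⟩ := hES z hzs U hzU hUc _ hΩU 0 ⟨fun _ => 0, contMDiff_const⟩
      (fun u => by
        change FlowsTo F u 0 (Ω 0 (j₀ u))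
        rw [hΩ0, hj₀]; exact flowsTo_zero hF _)
      (fun p => f (j p.1) p.2)
      (hfcont.comp (f := fun p : U × unitInterval => (j p.1, (p.2 : ℝ)))
        ((j.contMDiff.continuous.comp continuous_fst).prodMk
          (continuous_subtype_val.comp continuous_snd)).continuousOn
        fun p hp => ⟨hjR p.1 hp, p.2.2⟩)
      (fun u t hu => by
        have h1 := hfl (j u) (hjR u hu) t t.2
        rw [hct] at h1
        have h2 : i (j u) = u := hj₀ u
        rwa [h2] at h1)
      (fun u hu => hf0 (j u) (hjR u hu))
    obtain ⟨β, hβ, hβf⟩ := hW 1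
    refine ⟨i ⁻¹' W, fun x => β (i x), W.2.preimage i.contMDiff.continuous, hzW,
      hβ.comp i.contMDiff.contMDiffOn fun x hx => hx, fun x hx => ?_⟩
    have h1 := hβf ⟨i x, hWU hx.1⟩ hx.1 hx.2
    have h2 : j ⟨i x, hWU hx.1⟩ = x := hi.isOpenEmbedding.injective (hj₀ _)
    rwa [h2] at h1)
  refine ⟨α, fun x => ?_⟩
  by_cases hx : x ∈ R
  · rw [hα x hx, ← hc1]; exact hfl x hx 1 h1mem
  -- The orbit of a singular point is the point itself, so `h x = i x` and any value of `α x` is a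
  -- shift time.
  · have hxs : i x ∈ singularSet F := not_not.1 hx
    have h1 := horb x 1
    rw [hc0, hc1] at h1
    obtain ⟨s, hs⟩ := h1
    rw [eq_of_flowsTo_of_singular hF hxs hs]
    exact flowsTo_of_singular hxs _

/-- The image of the shift map is the path component of the inclusion. -/
theorem shiftImage_eq_identityComponent [MetrizableSpace M] [LocallyCompactSpace N]
    [LocallyConnectedSpace M] (hF : IsSmoothTangent I ℓ F) (hi : IsChartEmbedding I i)
    (hnd : IsNowhereDense (i ⁻¹' singularSet F))
    (hES : ∀ z, i z ∈ singularSet F → HasES01 F k (i z)) :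
    shiftImage F i = identityComponent F k i := by
  refine (shiftImage_subset_identityComponent hF hi).antisymm
    (identityComponent_subset_shiftImage hF hi ?_ hES)
  exact interior_eq_empty_iff_dense_compl.1
    (subset_empty_iff.1 ((interior_mono subset_closure).trans hnd.subset))

end Main

end ShiftMap

theorem mainTheorem9
    {E : Type*} [NormedAddCommGroup E] [NormedSpace ℝ E] [FiniteDimensional ℝ E]
    {H : Type*} [TopologicalSpace H] (I : ModelWithCorners ℝ E H)
    -- the model space is `E` (if `ℓ = 0`) or a closed half-space of `E`
    (ℓ : E →L[ℝ] ℝ) (hI : range I = {v | 0 ≤ ℓ v})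
    {M : Type*} [TopologicalSpace M] [ChartedSpace H M] [IsManifold I ∞ M]
    [T2Space M] [SecondCountableTopology M] [ConnectedSpace M]
    (F : (x : M) → TangentSpace I x)
    (hF : ContMDiff I I.tangent ∞ (fun x => (⟨x, F x⟩ : TangentBundle I M)))
    (hFtan : ShiftMap.TangentToBoundary ℓ F) (k : ℕ∞) :
    (∀ V : Opens M,
      IsNowhereDense ((↑) ⁻¹' ShiftMap.singularSet F : Set V) →
      (∀ z ∈ ShiftMap.singularSet F ∩ V, ShiftMap.HasES01 F k z) →
      ShiftMap.shiftImage F (ShiftMap.incl I V) =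
        ShiftMap.identityComponent F k (ShiftMap.incl I V)) ∧
    (IsNowhereDense (ShiftMap.singularSet F) →
      (∀ z ∈ ShiftMap.singularSet F, ShiftMap.HasES01 F k z) →
      ShiftMap.shiftImage F (ContMDiffMap.id : C^∞⟮I, M; I, M⟯) =
        ShiftMap.identityComponent F k (ContMDiffMap.id : C^∞⟮I, M; I, M⟯)) := by
  have hFs : ShiftMap.IsSmoothTangent I ℓ F := ⟨hI, hF, hFtan⟩
  -- Finite dimension enters through completeness (solving the equation), local compactness (weak
  -- topology) and metrizability (the countability argument).
  have : CompleteSpace E := FiniteDimensional.complete ℝ E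
  have : LocallyCompactSpace H := I.locallyCompactSpace
  have : LocallyCompactSpace M := ChartedSpace.locallyCompactSpace H M
  have : MetrizableSpace M := Manifold.metrizableSpace I M
  have : LocallyConnectedSpace M := ShiftMap.locallyConnectedSpace_of_range_eq M hI
  refine ⟨fun V hV hES => ?_, fun hnd hES => ?_⟩
  · have : LocallyCompactSpace V := V.isOpen.locallyCompactSpace
    exact ShiftMap.shiftImage_eq_identityComponent hFs (ShiftMap.isChartEmbedding_subtypeVal V) hV
      fun z hz => hES z ⟨hz, z.2⟩
  · exact ShiftMap.shiftImage_eq_identityComponent hFs ShiftMap.isChartEmbedding_id hnd hES
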